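/- **Setting.** Let $\Omega$ be a nonempty bounded open subset of $\mathbb R^N$ with Lipschitz boundary, let $m\ge 2$, $I=\{1,\dots,m\}$, and let $(\Omega_i)_{i\in I}$ be disjoint open subsets of $\Omega$ with Lipschitz boundaries such that $\overline\Omega=\bigcup_{i\in I}\overline{\Omega_i}$. For $i\in I$ let $\Upsilon_{ii}$ be the interior of $\operatorname{bdry}\Omega_i\cap\operatorname{bdry}\Omega$ relative to $\operatorname{bdry}\Omega$, and for $i<j$ let $\Upsilon_{ij}=\Upsilon_{ji}$ be the interior of $\operatorname{bdry}\Omega_i\cap\operatorname{bdry}\Omega_j$ relative to $\operatorname{bdry}\Omega_i$. Assume that, for every $i\in I$, $\Upsilon_{ii}\neq\varnothing$, that $J(i)=\{j\in I\smallsetminus\{i\}:\Upsilon_{ij}\ne\varnothing\}\neq\varnothing$, and that the closure of every connected component of $\Omega_i$ meets $\Upsilon_{ii}$ (automatic if $\Omega_i$ is connected). Set $J(i-)=\{j\in J(i):j<i\}$, $J(i+)=\{j\in J(i):j>i\}$ and $K=\{(i,j): i\in I,\ j\in J(i+)\}$. Let $S$ be surface measure, and let $\mathsf T_i\colon H^1(\Omega_i)\to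 L^2(\operatorname{bdry}\Omega_i)$ be the Sobolev trace operator, i.e. the bounded linear operator with $\mathsf T_iv=v|_{\operatorname{bdry}\Omega_i}$ for all $v\in C^1(\overline{\Omega_i})$. Let $\mathcal H_i=\{u\in H^1(\Omega_i):\mathsf T_iu=0 \text{ a.e. on }\Upsilon_{ii}\}$, with scalar product $\langle u,v\rangle=\int_{\Omega_i}(Du)^\top Dv$, and $\mathsf T_{ij}\colon\mathcal H_i\to L^2(\Upsilon_{ij})$, $u\mapsto(\mathsf T_iu)|_{\Upsilon_{ij}}$ for $j\in J(i)$. For $f\in L^2(\Omega_i)$ and $h=(h_j)_{j\in J(i)}\in\bigoplus_{j\in J(i)}L^2(\Upsilon_{ij})$, let $Q_i(f,h)$ be the weak solution in $\mathcal H_i$ of $-\Delta u=f$ on $\Omega_i$, $u=0$ on $\Upsilon_{ii}$, $\nu_i^\top Du=h_j$ on $\Upsilon_{ij}$ for $j\in J(i+)$, and $\nu_i^\top Du=-h_j$ on $\Upsilon_{ij}$ for $j\in J(i-)$ ($\nu_i$ the unit outward normal), i.e. the $u\in\mathcal H_i$ such that, for all $v\in\mathcal H_i$, $$\int_{\Omega_i}(Du)^\top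 Dv=\int_{\Omega_i}fv+\sum_{j\in J(i+)}\int_{\Upsilon_{ij}}h_j\,\mathsf T_{ij}v\,dS-\sum_{j\in J(i-)}\int_{\Upsilon_{ij}}h_j\,\mathsf T_{ij}v\,dS .$$ For $i\in I$ and $(i,j)\in K$, let $\varphi_i\colon\mathcal H_i\to\left]-\infty,+\infty\right]$ and $\psi_{ij}\colon L^2(\Upsilon_{ij})\to\left]-\infty,+\infty\right]$ be lower semicontinuous, convex and not identically $+\infty$, with subdifferentials $\partial\varphi_i,\partial\psi_{ij}$ and Fenchel conjugates $\varphi_i^*,\psi_{ij}^*$. Let $Z$ be the set of $(u,g)\in\bigoplus_{i\in I}\mathcal H_i\oplus\bigoplus_{(i,j)\in K}L^2(\Upsilon_{ij})$ such that $$g_{ij}\in\partial\psi_{ij}(\mathsf T_{ij}u_i-\mathsf T_{ji}u_j)\ \ \forall (i,j)\in K,\qquad -Q_i\big(0,(g_{ij})_{j\in J(i+)},(g_{ji})_{j\in J(i-)}\big)\in\partial\varphi_i(u_i)\ \ \forall i\in I.$$ Assume $Z\neq\varnothing$ and let $(u_0,g_0)\in\bigoplus_{i\in I}\mathcal H_i\oplus\bigoplus_{(i,j)\in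 K}L^2(\Upsilon_{ij})$. **Proposition.** The objects above are well defined: the trace operators $\mathsf T_i$ exist and are unique, the spaces $\mathcal H_i$ are Hilbert spaces, and the weak solution $Q_i(f,h)$ exists and is unique for all data. There is a unique point $(\bar u,\bar g)$ of $Z$ closest to $(u_0,g_0)$. Moreover, $\bar u=(\bar u_i)_{i\in I}$ minimizes $$\sum_{i\in I}\varphi_i(u_i)+\sum_{(i,j)\in K}\psi_{ij}(\mathsf T_{ij}u_i-\mathsf T_{ji}u_j)$$ over $(u_i)_{i\in I}\in\bigoplus_{i\in I}\mathcal H_i$, and $\bar g=(\bar g_{ij})_{(i,j)\in K}$ minimizes $$\sum_{i\in I}\varphi_i^*\Big(-Q_i\big(0,(g_{ij})_{j\in J(i+)},(g_{ji})_{j\in J(i-)}\big)\Big)+\sum_{(i,j)\in K}\psi_{ij}^*(g_{ij})$$ over $(g_{ij})_{(i,j)\in K}\in\bigoplus_{(i,j)\in K}L^2(\Upsilon_{ij})$. -/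

import Mathlib

open MeasureTheory Topology
open scoped ENNReal ContDiff

noncomputable section

namespace DomainDecomposition

/-! ### Convex analysis in (semi-)inner product spaces -/

section Convex

variable {H : Type*} [SeminormedAddCommGroup H] [InnerProductSpace ℝ H]

/-- The class of lower semicontinuous convex functions with values in `]-∞, +∞]` that are not
identically `+∞`. -/
structure IsGammaZero (f : H → EReal) : Prop where
  ne_bot : ∀ u, f u ≠ ⊥
  proper : ∃ u, f u ≠ ⊤
  lsc : LowerSemicontinuous f
  convex : ∀ u v : H, ∀ a b : ℝ, 0 < a → 0 < b → a + b = 1 →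
    f (a • u + b • v) ≤ (a : EReal) * f u + (b : EReal) * f v

/-- The subdifferential of `f` at `u`. -/
def subdifferential (f : H → EReal) (u : H) : Set H :=
  {w | ∀ v, f u + ((inner ℝ (v - u) w : ℝ) : EReal) ≤ f v}

/-- The Legendre-Fenchel conjugate of `f`. -/
def conjugate (f : H → EReal) (w : H) : EReal :=
  ⨆ u : H, ((inner ℝ u w : ℝ) : EReal) - f u

end Convex

/-! ### Domains, surface measure, Sobolev spaces -/

/-- The Euclidean space `ℝ^N`. -/
abbrev E (N : ℕ) : Type := EuclideanSpace ℝ (Fin N)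

variable {N : ℕ}

/-- `U` has a Lipschitz boundary: near each boundary point `x`, in suitable Cartesian coordinates
with last axis along the unit vector `e`, `U` is the set of points lying strictly below the graph
of a Lipschitz function `g` of the other coordinates (that is, `g` is invariant along `e`). -/
def HasLipschitzBoundary (U : Set (E N)) : Prop :=
  ∀ x ∈ frontier U, ∃ e : E N, ‖e‖ = 1 ∧ ∃ g : E N → ℝ,
    (∃ L : NNReal, LipschitzWith L g) ∧ (∀ (y : E N) (t : ℝ), g (y + t • e) = g y) ∧
    ∃ V ∈ 𝓝 x, ∀ y ∈ V, (y ∈ U ↔ inner ℝ e y < g y)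

/-- The interior of `B` relative to `A` (for `B ⊆ A`), as a subset of the ambient space. -/
def relInterior (A B : Set (E N)) : Set (E N) :=
  Subtype.val '' interior (Subtype.val ⁻¹' B : Set A)

/-- The `(N-1)`-dimensional surface measure: the Hausdorff measure, normalized so that it is
Lebesgue measure on `(N-1)`-dimensional Euclidean spaces. -/
def surf (N : ℕ) : Measure (E N) := Measure.euclideanHausdorffMeasure (N - 1)

/-- `L²(A)` with respect to surface measure, for a subset `A` of a hypersurface. -/
abbrev L2Surf (A : Set (E N)) : Type := Lp ℝ 2 ((surf N).restrict A)

/-- `L²(U)` with respect to Lebesgue measure. -/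
abbrev L2Vol (U : Set (E N)) : Type := Lp ℝ 2 ((volume : Measure (E N)).restrict U)

/-- `L²(U; ℝ^N)` with respect to Lebesgue measure. -/
abbrev L2VolVec (U : Set (E N)) : Type := Lp (E N) 2 ((volume : Measure (E N)).restrict U)

/-- Restriction of surface `L²` functions to a smaller set. -/
def restrictSurf {A B : Set (E N)} (h : B ⊆ A) (f : L2Surf A) : L2Surf B :=
  MemLp.toLp f ((Lp.memLp f).mono_measure (Measure.restrict_mono_set (surf N) h))

/-- `G` is the weak gradient of `u` on the open set `U`. -/
def HasWeakGradient (U : Set (E N)) (u : E N → ℝ) (G : E N → E N) : Prop :=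
  ∀ θ : E N → ℝ, ContDiff ℝ ∞ θ → HasCompactSupport θ → tsupport θ ⊆ U → ∀ v : E N,
    ∫ x in U, u x * fderiv ℝ θ x v = - ∫ x in U, inner ℝ (G x) v * θ x

lemma integrable_mul_of_compactSupport {U : Set (E N)} {u w : E N → ℝ}
    (hu : MemLp u 2 ((volume : Measure (E N)).restrict U)) (hw : Continuous w)
    (hc : HasCompactSupport w) : Integrable (fun x => u x * w x) (volume.restrict U) := by
  have h2 : MemLp w 2 ((volume : Measure (E N)).restrict U) :=
    hw.memLp_of_hasCompactSupport hc
  exact hu.integrable_mul h2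

/-- The Sobolev space `H¹(U)`, as the space of pairs `(u, Du)` in `L²(U) × L²(U; ℝ^N)` where `Du`
is the weak gradient of `u`. Its scalar product is `∫ u v + ∫ Du · Dv`. -/
def H1 (U : Set (E N)) : Submodule ℝ (WithLp 2 (L2Vol U × L2VolVec U)) where
  carrier := {p | HasWeakGradient U p.fst p.snd}
  zero_mem' := by
    intro θ _ _ _ v
    have e1 : ∫ x in U, (0 : L2Vol U) x * fderiv ℝ θ x v = 0 :=
      integral_eq_zero_of_ae ((Lp.coeFn_zero ℝ 2 (volume.restrict U)).mono fun x hx => by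
        beta_reduce; rw [hx]; simp)
    have e2 : ∫ x in U, inner ℝ ((0 : L2VolVec U) x) v * θ x = 0 :=
      integral_eq_zero_of_ae ((Lp.coeFn_zero (E N) 2 (volume.restrict U)).mono fun x hx => by
        beta_reduce; rw [hx]; simp)
    exact e1.trans (by rw [← neg_zero, ← e2]; rfl)
  add_mem' := by
    intro p q hp hq θ h1 h2 h3 v
    have d : Continuous (fun x => fderiv ℝ θ x v) :=
      (h1.continuous_fderiv (by simp)).clm_apply continuous_const
    have dc : HasCompactSupport (fun x => fderiv ℝ θ x v) := h2.fderiv_apply ℝ v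
    have i1 := integrable_mul_of_compactSupport (Lp.memLp p.fst) d dc
    have i2 := integrable_mul_of_compactSupport (Lp.memLp q.fst) d dc
    have j1 := integrable_mul_of_compactSupport ((Lp.memLp p.snd).inner_const v) h1.continuous h2
    have j2 := integrable_mul_of_compactSupport ((Lp.memLp q.snd).inner_const v) h1.continuous h2
    have e1 : ∫ x in U, (p + q).fst x * fderiv ℝ θ x v =
        ∫ x in U, (p.fst x * fderiv ℝ θ x v + q.fst x * fderiv ℝ θ x v) :=
      integral_congr_ae ((Lp.coeFn_add p.fst q.fst).mono fun x hx => by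
        simp only [WithLp.add_fst, hx, Pi.add_apply]; ring)
    have e2 : ∫ x in U, inner ℝ ((p + q).snd x) v * θ x =
        ∫ x in U, (inner ℝ (p.snd x) v * θ x + inner ℝ (q.snd x) v * θ x) :=
      integral_congr_ae ((Lp.coeFn_add p.snd q.snd).mono fun x hx => by
        simp only [WithLp.add_snd, hx, Pi.add_apply, inner_add_left]; ring)
    rw [e1, e2, integral_add i1 i2, integral_add j1 j2, hp θ h1 h2 h3 v, hq θ h1 h2 h3 v]
    ring
  smul_mem' := by
    intro c p hp θ h1 h2 h3 v
    have e1 : ∫ x in U, (c • p).fst x * fderiv ℝ θ x v =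
        ∫ x in U, c * (p.fst x * fderiv ℝ θ x v) :=
      integral_congr_ae ((Lp.coeFn_smul c p.fst).mono fun x hx => by
        simp only [WithLp.smul_fst, hx, Pi.smul_apply, smul_eq_mul]; ring)
    have e2 : ∫ x in U, inner ℝ ((c • p).snd x) v * θ x =
        ∫ x in U, c * (inner ℝ (p.snd x) v * θ x) :=
      integral_congr_ae ((Lp.coeFn_smul c p.snd).mono fun x hx => by
        simp only [WithLp.smul_snd, hx, Pi.smul_apply, real_inner_smul_left]; ring)
    rw [e1, e2, integral_const_mul, integral_const_mul, hp θ h1 h2 h3 v]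
    ring

/-- `T` is a Sobolev trace operator on `U`: a bounded linear operator
`H¹(U) → L²(bdry U)` such that `T v = v|_{bdry U}` for every `v ∈ C¹(closure U)`, i.e. for every
restriction of a `C¹` function on `ℝ^N`. -/
def IsTraceOperator (U : Set (E N)) (T : H1 U →L[ℝ] L2Surf (frontier U)) : Prop :=
  ∀ v : E N → ℝ, ContDiff ℝ 1 v → ∀ u : H1 U,
    (u : WithLp 2 (L2Vol U × L2VolVec U)).fst =ᵐ[volume.restrict U] v →
    T u =ᵐ[(surf N).restrict (frontier U)] v

open Classical in
/-- The Sobolev trace operator on `U` (the zero operator if there is none, which does not occur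
for bounded open sets with Lipschitz boundary). -/
def trace (U : Set (E N)) : H1 U →L[ℝ] L2Surf (frontier U) :=
  if h : ∃ T, IsTraceOperator U T then h.choose else 0

/-- The subspace of those `u ∈ H¹(U)` with `trace u = 0` almost everywhere on `Γ ⊆ bdry U`. -/
def traceZero (U Γ : Set (E N)) : Submodule ℝ (H1 U) where
  carrier := {u | ∀ᵐ x ∂((surf N).restrict (frontier U)), x ∈ Γ → trace U u x = 0}
  zero_mem' := by
    have h := Lp.coeFn_zero ℝ 2 ((surf N).restrict (frontier U))
    rw [Set.mem_ofPred_eq, map_zero]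
    exact h.mono fun x hx _ => hx
  add_mem' := by
    intro a b ha hb
    have h := Lp.coeFn_add (trace U a) (trace U b)
    rw [Set.mem_ofPred_eq] at ha hb ⊢
    rw [map_add]
    filter_upwards [h, ha, hb] with x hx h1 h2 h3
    rw [hx, Pi.add_apply, h1 h3, h2 h3, add_zero]
  smul_mem' := by
    intro c a ha
    have h := Lp.coeFn_smul c (trace U a)
    rw [Set.mem_ofPred_eq] at ha ⊢
    rw [map_smul]
    filter_upwards [h, ha] with x hx h1 h3
    rw [hx, Pi.smul_apply, h1 h3, smul_zero]

/-- The space `H¹_{0,Γ}(U)`, to be endowed with the scalar product `∫ Du · Dv` (and not with that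
of `H¹(U)`). -/
def HZero (U Γ : Set (E N)) : Type := ↥(traceZero U Γ)

namespace HZero

variable {U Γ : Set (E N)}

instance : AddCommGroup (HZero U Γ) := inferInstanceAs (AddCommGroup ↥(traceZero U Γ))

instance : Module ℝ (HZero U Γ) := inferInstanceAs (Module ℝ ↥(traceZero U Γ))

/-- The inclusion in `H¹(U)`. -/
def toH1 : HZero U Γ →ₗ[ℝ] H1 U := (traceZero U Γ).subtype

/-- The `L²` class of the function itself. -/
def fn : HZero U Γ →ₗ[ℝ] L2Vol U where
  toFun u := (toH1 u : WithLp 2 (L2Vol U × L2VolVec U)).fst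
  map_add' _ _ := by simp
  map_smul' _ _ := by simp

/-- The weak gradient. -/
def grad : HZero U Γ →ₗ[ℝ] L2VolVec U where
  toFun u := (toH1 u : WithLp 2 (L2Vol U × L2VolVec U)).snd
  map_add' _ _ := by simp
  map_smul' _ _ := by simp

/-- The norm `u ↦ (∫ |Du|²)^{1/2}`. -/
instance : SeminormedAddCommGroup (HZero U Γ) :=
  SeminormedAddCommGroup.induced (HZero U Γ) (L2VolVec U) grad

/-- The scalar product `∫ Du · Dv`. -/
instance : InnerProductSpace ℝ (HZero U Γ) where
  inner u v := ∫ x in U, inner ℝ (grad u x) (grad v x)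
  norm_smul_le c u := by
    change ‖grad (c • u)‖ ≤ ‖c‖ * ‖grad u‖
    rw [map_smul, norm_smul]
  norm_sq_eq_re_inner u := by
    change ‖grad u‖ ^ 2 = _
    rw [← real_inner_self_eq_norm_sq, L2.inner_def]
    rfl
  conj_inner_symm u v := by
    simp only [conj_trivial]
    exact integral_congr_ae (Filter.Eventually.of_forall fun x => real_inner_comm _ _)
  add_left u v w := by
    change ∫ x in U, inner ℝ (grad (u + v) x) (grad w x) =
      (∫ x in U, inner ℝ (grad u x) (grad w x)) + ∫ x in U, inner ℝ (grad v x) (grad w x)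
    rw [← L2.inner_def, ← L2.inner_def, ← L2.inner_def, map_add, inner_add_left]
  smul_left u v c := by
    change ∫ x in U, inner ℝ (grad (c • u) x) (grad v x) =
      (starRingEnd ℝ) c * ∫ x in U, inner ℝ (grad u x) (grad v x)
    rw [← L2.inner_def, ← L2.inner_def, map_smul, inner_smul_left]

/-- The trace of `u ∈ H¹_{0,Γ}(U)` restricted to a subset `A` of `bdry U`. -/
def traceOn {A : Set (E N)} (hA : A ⊆ frontier U) (u : HZero U Γ) : L2Surf A :=
  restrictSurf hA (trace U (toH1 u))

end HZero

/-! ### The decomposition -/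

/-- An open set and the family of its subdomains. -/
structure Decomposition (N m : ℕ) where
  /-- the whole domain `Ω` -/
  Ω : Set (E N)
  /-- the subdomains `Ω_i` -/
  sub : Fin m → Set (E N)

namespace Decomposition

variable {m : ℕ} (D : Decomposition N m)

/-- `Υ_ii` is the interior of `bdry Ω_i ∩ bdry Ω` relative to `bdry Ω` and, for `i < j`,
`Υ_ij = Υ_ji` is the interior of `bdry Ω_i ∩ bdry Ω_j` relative to `bdry Ω_i`. -/
def Υ (i j : Fin m) : Set (E N) :=
  if i = j then relInterior (frontier D.Ω) (frontier (D.sub i) ∩ frontier D.Ω)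
  else relInterior (frontier (D.sub (min i j)))
    (frontier (D.sub (min i j)) ∩ frontier (D.sub (max i j)))

lemma Υ_comm (i j : Fin m) : D.Υ i j = D.Υ j i := by
  by_cases h : i = j
  · subst h; rfl
  · simp only [Υ, h, Ne.symm h, if_false, min_comm i j, max_comm i j]

lemma Υ_subset_left (i j : Fin m) : D.Υ i j ⊆ frontier (D.sub i) := by
  unfold Υ
  split_ifs with h
  · rintro _ ⟨x, hx, rfl⟩
    exact (interior_subset hx).1
  · rintro _ ⟨x, hx, rfl⟩
    have h2 := interior_subset hx
    rcases le_total i j with hij | hij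
    · simpa [hij] using h2.1
    · simpa [hij] using h2.2

lemma Υ_subset_right (i j : Fin m) : D.Υ i j ⊆ frontier (D.sub j) := by
  rw [D.Υ_comm]; exact D.Υ_subset_left j i

/-- `J(i)`: the indices of the neighbors of `Ω_i`. -/
def J (i : Fin m) : Set (Fin m) := {j | j ≠ i ∧ (D.Υ i j).Nonempty}

/-- `K`: the indices `(i, j)`, `i < j`, of the interfaces. -/
def K : Set (Fin m × Fin m) := {k | k.1 < k.2 ∧ k.2 ∈ D.J k.1}

instance (i : Fin m) : Fintype (D.J i) := Fintype.ofFinite _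

instance : Fintype D.K := Fintype.ofFinite _

/-- The geometric assumptions. The last one, which holds in particular if the subdomains are
connected, says that no connected component of a subdomain `Ω_i` is away from the part `Υ_ii` of
its boundary. -/
structure IsAdmissible : Prop where
  isOpen : IsOpen D.Ω
  nonempty : D.Ω.Nonempty
  bounded : Bornology.IsBounded D.Ω
  lipschitz : HasLipschitzBoundary D.Ω
  isOpen_sub : ∀ i, IsOpen (D.sub i)
  sub_subset : ∀ i, D.sub i ⊆ D.Ω
  disjoint_sub : ∀ i j, i ≠ j → Disjoint (D.sub i) (D.sub j)
  lipschitz_sub : ∀ i, HasLipschitzBoundary (D.sub i)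
  closure_eq : closure D.Ω = ⋃ i, closure (D.sub i)
  nonempty_Υ : ∀ i, (D.Υ i i).Nonempty
  nonempty_J : ∀ i, (D.J i).Nonempty
  component : ∀ i, ∀ x ∈ D.sub i,
    (closure (connectedComponentIn (D.sub i) x) ∩ D.Υ i i).Nonempty

/-- `ℋ_i = H¹_{0,Υ_ii}(Ω_i)`. -/
abbrev H (i : Fin m) : Type := HZero (D.sub i) (D.Υ i i)

/-- The trace operator `T_ij : ℋ_i → L²(Υ_ij)`. -/
def T (i j : Fin m) (u : D.H i) : L2Surf (D.Υ i j) :=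
  HZero.traceOn (D.Υ_subset_left i j) u

/-- The trace operator `T_ji : ℋ_j → L²(Υ_ij)`, with values in the same space as `T_ij`. -/
def T' (i j : Fin m) (u : D.H j) : L2Surf (D.Υ i j) :=
  HZero.traceOn (D.Υ_subset_right i j) u

/-- `u` is the weak solution in `ℋ_i` of `-Δu = f` on `Ω_i`, `u = 0` on `Υ_ii`, with normal
derivative `h_j` on `Υ_ij` for `j ∈ J(i+)` and `-h_j` on `Υ_ij` for `j ∈ J(i-)`. -/
def IsWeakSolution (i : Fin m) (f : L2Vol (D.sub i)) (h : (j : D.J i) → L2Surf (D.Υ i j))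
    (u : D.H i) : Prop :=
  ∀ v : D.H i,
    ∫ x in D.sub i, inner ℝ (HZero.grad u x) (HZero.grad v x) =
      (∫ x in D.sub i, f x * HZero.fn v x) +
      ∑ j : D.J i, (if i < j.1 then 1 else -1) * ∫ x in D.Υ i j, h j x * D.T i j v x ∂(surf N)

open Classical in
/-- The operator `Q_i : L²(Ω_i) × 𝒢_i → ℋ_i`, sending the data to the weak solution. -/
def Q (i : Fin m) (f : L2Vol (D.sub i)) (h : (j : D.J i) → L2Surf (D.Υ i j)) : D.H i :=
  if hu : ∃ u, D.IsWeakSolution i f h u then hu.choose else 0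

/-- The primal space `⊕ ℋ_i`. -/
abbrev Primal : Type := PiLp 2 (fun i : Fin m => D.H i)

/-- The dual space `⊕_{(i,j) ∈ K} L²(Υ_ij)`. -/
abbrev Dual : Type := PiLp 2 (fun k : D.K => L2Surf (D.Υ k.1.1 k.1.2))

/-- The family `((g_ij)_{j ∈ J(i+)}, (g_ji)_{j ∈ J(i-)})` in `𝒢_i = ⊕_{j ∈ J(i)} L²(Υ_ij)`. -/
def interfaceData (g : D.Dual) (i : Fin m) (j : D.J i) : L2Surf (D.Υ i j) :=
  if h : i < j.1 then g ⟨(i, j.1), h, j.2⟩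
  else restrictSurf (D.Υ_comm i j.1).subset (g ⟨(j.1, i), lt_of_le_of_ne (not_lt.mp h) j.2.1,
    ⟨j.2.1.symm, by rw [D.Υ_comm]; exact j.2.2⟩⟩)

/-- The jump `T_ij u_i - T_ji u_j` across the interface `k = (i, j)`. -/
def jump (u : D.Primal) (k : D.K) : L2Surf (D.Υ k.1.1 k.1.2) :=
  D.T k.1.1 k.1.2 (u k.1.1) - D.T' k.1.1 k.1.2 (u k.1.2)

variable (φ : (i : Fin m) → D.H i → EReal)
  (ψ : (k : D.K) → L2Surf (D.Υ k.1.1 k.1.2) → EReal)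

/-- The set of pairs `(u, g)` with `g_ij ∈ ∂ψ_ij(T_ij u_i - T_ji u_j)` for every `(i, j) ∈ K` and
`-Q_i(0, (g_ij), (g_ji)) ∈ ∂φ_i(u_i)` for every `i`. -/
def optimalitySet : Set (WithLp 2 (D.Primal × D.Dual)) :=
  {p | (∀ k : D.K, p.snd k ∈ subdifferential (ψ k) (D.jump p.fst k)) ∧
    ∀ i, -D.Q i 0 (D.interfaceData p.snd i) ∈ subdifferential (φ i) (p.fst i)}

/-- `p` is a closest point to `p₀` in the optimality set. -/
def IsSolution (p₀ p : WithLp 2 (D.Primal × D.Dual)) : Prop :=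
  p ∈ D.optimalitySet φ ψ ∧ ∀ q ∈ D.optimalitySet φ ψ, ‖p - p₀‖ ≤ ‖q - p₀‖

/-- `∑ φ_i(u_i) + ∑ ψ_ij(T_ij u_i - T_ji u_j)`. -/
def primalObjective (u : D.Primal) : EReal :=
  ∑ i, φ i (u i) + ∑ k : D.K, ψ k (D.jump u k)

/-- `∑ φ_i*(-Q_i(0, (g_ij), (g_ji))) + ∑ ψ_ij*(g_ij)`. -/
def dualObjective (g : D.Dual) : EReal :=
  ∑ i, conjugate (φ i) (-D.Q i 0 (D.interfaceData g i)) + ∑ k : D.K, conjugate (ψ k) (g k)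

end Decomposition

end DomainDecomposition

end

/-!
A rotated Lipschitz graph turns the boundary of a domain locally into a hyperplane, and integrating
along the direction of the graph bounds the `L²` norm of a `C¹` function on the boundary by its
`H¹` norm. As translations in that direction push a Lipschitz domain into itself, mollification
shows that the restrictions of `C¹` functions are dense in `H¹`, which gives the trace operator.
The same integration gives a Poincaré inequality near `Υ_ii`, which propagates along the connected
components; hence `ℋ_i` is a Hilbert space, and `Q_i` is a case of the Riesz representation.

By the weak formulation, `g ↦ (Q_i(0, g))_i` is the adjoint of the jump operator. In the
inequalities defining the subdifferentials, added up over all indices, the terms bilinear in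
`(u, g)` therefore cancel: `Z` is the set of solutions of a family of convex lower semicontinuous
inequalities, so it is closed and convex, and `(u₀, g₀)` has a unique projection onto it. Optimality
of `ū` is one of these inequalities, and that of `ḡ` is the Fenchel-Young inequality.
-/

noncomputable section

namespace DomainDecomposition

open scoped Convolution Manifold

/-! ### Lipschitz graphs -/

section Hyperplane

variable {V : Type*} [NormedAddCommGroup V] [InnerProductSpace ℝ V] {e : V}

/-- The hyperplane orthogonal to `e`. -/
abbrev Hyp (e : V) : Type _ := ↥(ℝ ∙ e)ᗮ

/-- The orthogonal projection onto the hyperplane orthogonal to `e`. -/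
abbrev hypProj (e : V) : V →L[ℝ] Hyp e := (ℝ ∙ e)ᗮ.orthogonalProjectionOnto

lemma inner_hyp (y : Hyp e) : inner ℝ e (y : V) = 0 :=
  (Submodule.mem_orthogonal_singleton_iff_inner_right).1 y.2

lemma hypProj_add_inner_smul (he : ‖e‖ = 1) (x : V) :
    (hypProj e x : V) + inner ℝ e x • e = x := by
  have h := (ℝ ∙ e).starProjection_add_starProjection_orthogonal x
  rw [Submodule.starProjection_unit_singleton ℝ he, add_comm] at h
  exact h

lemma hypProj_coe_add_smul (y : Hyp e) (s : ℝ) : hypProj e ((y : V) + s • e) = y := by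
  rw [map_add, map_smul, Submodule.orthogonalProjectionOnto_mem_subspace_eq_self,
    Submodule.orthogonalProjectionOnto_orthogonalComplement_singleton_eq_zero, smul_zero, add_zero]

lemma inner_add_smul_self (he : ‖e‖ = 1) (x : V) (s : ℝ) :
    inner ℝ e (x + s • e) = inner ℝ e x + s := by
  rw [inner_add_right, inner_smul_right, real_inner_self_eq_norm_sq, he, one_pow, mul_one]

lemma inner_sub_smul_self (he : ‖e‖ = 1) (x : V) (s : ℝ) :
    inner ℝ e (x - s • e) = inner ℝ e x - s := by
  rw [sub_eq_add_neg, ← neg_smul, inner_add_smul_self he, sub_eq_add_neg]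

/-- The parametrization of the graph of `g` over the hyperplane orthogonal to `e`. The function
`g` is defined on the whole space and only its values on the hyperplane matter. -/
def graphMap (e : V) (g : V → ℝ) (y : Hyp e) : V := (y : V) + g y • e

lemma hypProj_graphMap (g : V → ℝ) (y : Hyp e) : hypProj e (graphMap e g y) = y :=
  hypProj_coe_add_smul y _

lemma continuous_graphMap {g : V → ℝ} (hg : Continuous g) : Continuous (graphMap e g) := by
  unfold graphMap
  fun_prop

lemma lipschitzWith_graphMap (he : ‖e‖ = 1) {g : V → ℝ} {L : NNReal} (hg : LipschitzWith L g) :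
    LipschitzWith (1 + L) (graphMap e g) := by
  refine LipschitzWith.of_dist_le_mul fun x y => ?_
  have hdiff : graphMap e g x - graphMap e g y = ((x : V) - y) + (g x - g y) • e := by
    simp only [graphMap]; module
  calc dist (graphMap e g x) (graphMap e g y)
      ≤ ‖(x : V) - y‖ + ‖(g x - g y) • e‖ := by
        rw [dist_eq_norm, hdiff]; exact norm_add_le _ _
    _ = dist (x : V) y + dist (g x) (g y) := by
        rw [norm_smul, he, mul_one, ← dist_eq_norm, ← dist_eq_norm]
    _ ≤ dist (x : V) y + L * dist (x : V) y := by gcongr; exact hg.dist_le_mul _ _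
    _ = (1 + L : NNReal) * dist x y := by rw [Subtype.dist_eq]; push_cast; ring

lemma graphMap_hypProj (he : ‖e‖ = 1) {g : V → ℝ} (hinv : ∀ (y : V) (t : ℝ), g (y + t • e) = g y)
    (x : V) : graphMap e g (hypProj e x) = x + (g x - inner ℝ e x) • e := by
  have hx := hypProj_add_inner_smul he x
  have hgx : g (hypProj e x) = g x := by rw [← hinv _ (inner ℝ e x), hx]
  calc graphMap e g (hypProj e x)
      = ((hypProj e x : V) + inner ℝ e x • e) + (g x - inner ℝ e x) • e := by
        rw [graphMap, hgx]; module
    _ = _ := by rw [hx]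

lemma inner_graphMap (he : ‖e‖ = 1) {g : V → ℝ} (hinv : ∀ (y : V) (t : ℝ), g (y + t • e) = g y)
    (y : Hyp e) : inner ℝ e (graphMap e g y) = g (graphMap e g y) := by
  rw [graphMap, inner_add_smul_self he, inner_hyp, hinv, zero_add]

variable [MeasurableSpace V] [BorelSpace V]

lemma euclideanHausdorffMeasure_image_le {X Y : Type*} [EMetricSpace X] [MeasurableSpace X]
    [BorelSpace X] [EMetricSpace Y] [MeasurableSpace Y] [BorelSpace Y] {K : NNReal} {f : X → Y}
    (hf : LipschitzWith K f) (d : ℕ) (s : Set X) :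
    (Measure.euclideanHausdorffMeasure d : Measure Y) (f '' s) ≤
      (K : ℝ≥0∞) ^ d * (Measure.euclideanHausdorffMeasure d : Measure X) s := by
  rw [Measure.euclideanHausdorffMeasure_def, Measure.euclideanHausdorffMeasure_def,
    Measure.smul_apply, Measure.smul_apply, ENNReal.smul_def, ENNReal.smul_def, smul_eq_mul,
    smul_eq_mul, mul_left_comm]
  gcongr
  simpa only [ENNReal.rpow_natCast] using hf.hausdorffMeasure_image_le (d := d) (by positivity) s

lemma map_graphMap_le (d : ℕ) {g : V → ℝ} (hg : Continuous g) (A : Set V) :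
    ((Measure.euclideanHausdorffMeasure d : Measure (Hyp e)).restrict
      (graphMap e g ⁻¹' A)).map (graphMap e g) ≤
      (Measure.euclideanHausdorffMeasure d : Measure V).restrict A := by
  refine Measure.le_iff.2 fun C hC => ?_
  have hm := (continuous_graphMap (e := e) hg).measurable
  have hproj : LipschitzWith 1 (hypProj e) := Submodule.lipschitzWith_orthogonalProjectionOnto _
  have himage := euclideanHausdorffMeasure_image_le hproj d (C ∩ A)
  rw [ENNReal.coe_one, one_pow, one_mul] at himage
  rw [Measure.map_apply hm hC, Measure.restrict_apply (hm hC), Measure.restrict_apply hC]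
  refine le_trans (measure_mono ?_) himage
  rintro y ⟨hyC, hyA⟩
  exact ⟨graphMap e g y, ⟨hyC, hyA⟩, hypProj_graphMap g y⟩

lemma restrict_le_smul_map_graphMap (d : ℕ) (he : ‖e‖ = 1) {g : V → ℝ} {L : NNReal}
    (hg : LipschitzWith L g) {A : Set V} (hA : A ⊆ Set.range (graphMap e g)) :
    (Measure.euclideanHausdorffMeasure d : Measure V).restrict A ≤ ((1 + L : NNReal) : ℝ≥0∞) ^ d •
      ((Measure.euclideanHausdorffMeasure d : Measure (Hyp e)).restrict
        (graphMap e g ⁻¹' A)).map (graphMap e g) := by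
  refine Measure.le_iff.2 fun C hC => ?_
  have hm := (continuous_graphMap (e := e) hg.continuous).measurable
  rw [Measure.restrict_apply hC, Measure.smul_apply, smul_eq_mul, Measure.map_apply hm hC,
    Measure.restrict_apply (hm hC), ← Set.preimage_inter]
  refine le_trans (measure_mono ?_)
    (euclideanHausdorffMeasure_image_le (lipschitzWith_graphMap he hg) d _)
  rw [Set.image_preimage_eq_of_subset (Set.inter_subset_right.trans hA)]

variable [FiniteDimensional ℝ V]

lemma measurePreserving_add_smul (he : ‖e‖ = 1) :
    MeasurePreserving (fun p : Hyp e × ℝ => (p.1 : V) + p.2 • e) (volume.prod volume) volume := by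
  have hsum := ((ℝ ∙ e).measurePreserving_measurableEquivProd (0 : V)).symm
  rw [InnerProductSpace.euclideanHausdorffMeasure_eq_volume] at hsum
  have hline := (LinearIsometryEquiv.toSpanUnitSingleton (𝕜 := ℝ) e he).measurePreserving
  have hpair := (hline.prod (MeasurePreserving.id (volume : Measure (Hyp e)))).comp
    (Measure.measurePreserving_swap (μ := (volume : Measure (Hyp e))) (ν := (volume : Measure ℝ)))
  refine (congrArg (fun f => MeasurePreserving f (volume.prod volume) volume) ?_).mp
    (hsum.comp hpair)
  funext p
  simp [add_comm]

lemma lintegral_eq_lintegral_graphMap_sub (he : ‖e‖ = 1) (g : V → ℝ) {F : V → ℝ≥0∞}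
    (hF : Measurable F) :
    ∫⁻ x, F x = ∫⁻ y : Hyp e, ∫⁻ t : ℝ, F (graphMap e g y - t • e) := by
  have hmp := measurePreserving_add_smul he
  rw [← hmp.lintegral_comp hF, lintegral_prod]
  swap
  · exact (hF.comp hmp.measurable).aemeasurable
  refine lintegral_congr fun y => ?_
  rw [← lintegral_sub_left_eq_self (μ := (volume : Measure ℝ)) (fun s => F ((y : V) + s • e)) (g y)]
  refine lintegral_congr fun t => ?_
  rw [graphMap, sub_smul, add_sub_assoc]

lemma lintegral_graphMap_sub_le (he : ‖e‖ = 1) {g : V → ℝ} {F : V → ℝ≥0∞} (hF : Measurable F)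
    {B : Set (Hyp e)} (hB : MeasurableSet B) {d : ℝ} {U : Set V} (hU : MeasurableSet U)
    (h : ∀ y ∈ B, ∀ t ∈ Set.Ioc 0 d, graphMap e g y - t • e ∈ U) :
    ∫⁻ y in B, ∫⁻ t in Set.Ioc 0 d, F (graphMap e g y - t • e) ≤ ∫⁻ x in U, F x := by
  rw [← lintegral_indicator hU, lintegral_eq_lintegral_graphMap_sub he g (hF.indicator hU)]
  refine (setLIntegral_mono' hB fun y hy => ?_).trans (setLIntegral_le_lintegral _ _)
  refine (setLIntegral_mono' measurableSet_Ioc fun t ht => ?_).trans (setLIntegral_le_lintegral _ _)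
  rw [Set.indicator_of_mem (h y hy t ht)]

lemma le_lintegral_graphMap_sub (he : ‖e‖ = 1) {g : V → ℝ}
    (hinv : ∀ (y : V) (t : ℝ), g (y + t • e) = g y) {F : V → ℝ≥0∞} (hF : Measurable F)
    {B : Set (Hyp e)} (hB : MeasurableSet B) {d : ℝ} {S : Set V} (hS : MeasurableSet S)
    (h : ∀ x ∈ S, hypProj e x ∈ B ∧ g x - inner ℝ e x ∈ Set.Ioc 0 d) :
    ∫⁻ x in S, F x ≤ ∫⁻ y in B, ∫⁻ t in Set.Ioc 0 d, F (graphMap e g y - t • e) := by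
  rw [← lintegral_indicator hS, lintegral_eq_lintegral_graphMap_sub he g (hF.indicator hS),
    ← lintegral_indicator hB]
  refine lintegral_mono fun y => ?_
  have hmem : ∀ t, graphMap e g y - t • e ∈ S → y ∈ B ∧ t ∈ Set.Ioc 0 d := fun t ht => by
    have hy : hypProj e (graphMap e g y - t • e) = y := by
      rw [graphMap, add_sub_assoc, ← sub_smul, hypProj_coe_add_smul]
    have hgt : g (graphMap e g y - t • e) = g (graphMap e g y) := by
      rw [sub_eq_add_neg, ← neg_smul, hinv]
    have := h _ ht
    rwa [hy, hgt, inner_sub_smul_self he, inner_graphMap he hinv, sub_sub_cancel] at this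
  by_cases hy : y ∈ B
  · rw [Set.indicator_of_mem hy, ← lintegral_indicator measurableSet_Ioc]
    refine lintegral_mono fun t => ?_
    by_cases ht : graphMap e g y - t • e ∈ S
    · rw [Set.indicator_of_mem ht, Set.indicator_of_mem (hmem t ht).2]
    · rw [Set.indicator_of_notMem ht]
      exact zero_le
  · rw [Set.indicator_of_notMem hy, lintegral_congr (g := 0) fun t =>
      Set.indicator_of_notMem (fun ht => hy (hmem t ht).1) _]
    simp

end Hyperplane

section SurfaceMeasure

variable {N : ℕ} {e : E N}

lemma volume_hyp (he : ‖e‖ = 1) :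
    (volume : Measure (Hyp e)) = Measure.euclideanHausdorffMeasure (N - 1) := by
  have hsum := (ℝ ∙ e).finrank_add_finrank_orthogonal
  rw [finrank_span_singleton (norm_ne_zero_iff.1 (he.trans_ne one_ne_zero)),
    finrank_euclideanSpace_fin] at hsum
  have hrank : Module.finrank ℝ (Hyp e) = N - 1 := Nat.eq_sub_of_add_eq' hsum
  rw [← InnerProductSpace.euclideanHausdorffMeasure_eq_volume, hrank]

lemma lintegral_graphMap_le_surf (he : ‖e‖ = 1) {g : E N → ℝ} (hg : Continuous g) (A : Set (E N))
    {F : E N → ℝ≥0∞} (hF : Measurable F) :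
    ∫⁻ y in graphMap e g ⁻¹' A, F (graphMap e g y) ≤ ∫⁻ x in A, F x ∂(surf N) := by
  rw [← lintegral_map hF (continuous_graphMap hg).measurable, volume_hyp he]
  exact lintegral_mono' (map_graphMap_le _ hg A) le_rfl

lemma lintegral_surf_le_graphMap (he : ‖e‖ = 1) {g : E N → ℝ} {L : NNReal}
    (hg : LipschitzWith L g) {A : Set (E N)} (hA : A ⊆ Set.range (graphMap e g))
    {F : E N → ℝ≥0∞} (hF : Measurable F) :
    ∫⁻ x in A, F x ∂(surf N) ≤
      ((1 + L : NNReal) ^ (N - 1)) * ∫⁻ y in graphMap e g ⁻¹' A, F (graphMap e g y) := by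
  rw [← lintegral_map hF (continuous_graphMap hg.continuous).measurable, volume_hyp he,
    ← smul_eq_mul, ← lintegral_smul_measure]
  exact lintegral_mono' (restrict_le_smul_map_graphMap _ he hg hA) le_rfl

end SurfaceMeasure

lemma sq_lintegral_mul_le {α : Type*} [MeasurableSpace α] {μ : Measure α} {f k : α → ℝ≥0∞}
    (hf : AEMeasurable f μ) (hk : AEMeasurable k μ) :
    (∫⁻ x, k x * f x ∂μ) ^ 2 ≤ (∫⁻ x, k x ∂μ) * ∫⁻ x, k x * f x ^ 2 ∂μ := by
  have hmul : ∀ a : ℝ≥0∞, a ^ (1 / 2 : ℝ) * a ^ (1 / 2 : ℝ) = a := fun a => by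
    rw [← ENNReal.rpow_add_of_nonneg _ _ (by norm_num) (by norm_num)]; norm_num
  have hsq : ∀ a : ℝ≥0∞, (a ^ (1 / 2 : ℝ)) ^ 2 = a := fun a => by rw [sq, hmul]
  have holder := ENNReal.lintegral_mul_le_Lp_mul_Lq μ (p := 2) (q := 2) .two_two
    (f := fun x => k x ^ (1 / 2 : ℝ)) (g := fun x => k x ^ (1 / 2 : ℝ) * f x)
    (hk.pow_const _) ((hk.pow_const _).mul hf)
  simp only [Pi.mul_apply, ← mul_assoc, hmul, ENNReal.rpow_two, mul_pow, hsq] at holder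
  simpa only [mul_pow, hsq] using pow_le_pow_left₀ zero_le holder 2

lemma enorm_sq_add_le {F : Type*} [TopologicalSpace F] [ESeminormedAddMonoid F] (x y : F) :
    ‖x + y‖ₑ ^ 2 ≤ 2 * ‖x‖ₑ ^ 2 + 2 * ‖y‖ₑ ^ 2 := by
  refine (pow_le_pow_left₀ zero_le (enorm_add_le x y) 2).trans ?_
  have h := ENNReal.rpow_add_le_mul_rpow_add_rpow ‖x‖ₑ ‖y‖ₑ (p := 2) (by norm_num)
  norm_num at h
  rwa [mul_add] at h

section Line

variable {W F : Type*} [NormedAddCommGroup W] [NormedSpace ℝ W] [NormedAddCommGroup F]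
  [NormedSpace ℝ F] [CompleteSpace F] {v : W → F}

lemma enorm_sub_line_le (hv : ContDiff ℝ 1 v) (x h : W) {d a b : ℝ}
    (ha : a ∈ Set.Icc 0 d) (hb : b ∈ Set.Icc 0 d) :
    ‖v (x + a • h) - v (x + b • h)‖ₑ ≤
      ‖h‖ₑ * ∫⁻ t in Set.Ioc 0 d, ‖fderiv ℝ v (x + t • h)‖ₑ := by
  have hc : Continuous fun t : ℝ => fderiv ℝ v (x + t • h) :=
    (hv.continuous_fderiv one_ne_zero).comp (by fun_prop)
  have hd (t : ℝ) : HasDerivAt (fun t : ℝ => v (x + t • h)) (fderiv ℝ v (x + t • h) h) t := by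
    have hline : HasDerivAt (fun t : ℝ => x + t • h) h t := by
      simpa using ((hasDerivAt_id t).smul_const h).const_add x
    exact (hv.differentiable one_ne_zero _).hasFDerivAt.comp_hasDerivAt t hline
  have hftc : ∫ t in b..a, fderiv ℝ v (x + t • h) h = v (x + a • h) - v (x + b • h) :=
    intervalIntegral.integral_eq_sub_of_hasDerivAt (fun t _ => hd t)
      ((hc.clm_apply continuous_const).intervalIntegrable _ _)
  calc ‖v (x + a • h) - v (x + b • h)‖ₑ
      = ‖∫ t in Set.uIoc b a, fderiv ℝ v (x + t • h) h‖ₑ := by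
        rw [← hftc]
        exact enorm_eq_iff_norm_eq.2 (intervalIntegral.norm_intervalIntegral_eq _ _ _ _)
    _ ≤ ∫⁻ t in Set.uIoc b a, ‖fderiv ℝ v (x + t • h) h‖ₑ := enorm_integral_le_lintegral_enorm _
    _ ≤ ∫⁻ t in Set.Ioc 0 d, ‖fderiv ℝ v (x + t • h) h‖ₑ :=
        lintegral_mono_set (Set.Ioc_subset_Ioc (le_min hb.1 ha.1) (max_le hb.2 ha.2))
    _ ≤ ∫⁻ t in Set.Ioc 0 d, ‖h‖ₑ * ‖fderiv ℝ v (x + t • h)‖ₑ :=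
        lintegral_mono fun t => (ContinuousLinearMap.le_opENorm _ _).trans_eq (mul_comm _ _)
    _ = _ := lintegral_const_mul _ hc.enorm.measurable

lemma enorm_sq_line_le (hv : ContDiff ℝ 1 v) (x h : W) {d a b : ℝ}
    (ha : a ∈ Set.Icc 0 d) (hb : b ∈ Set.Icc 0 d) :
    ‖v (x + a • h)‖ₑ ^ 2 ≤ 2 * ‖v (x + b • h)‖ₑ ^ 2 +
      2 * (ENNReal.ofReal d * ‖h‖ₑ ^ 2 *
        ∫⁻ t in Set.Ioc 0 d, ‖fderiv ℝ v (x + t • h)‖ₑ ^ 2) := by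
  have hc : Continuous fun t : ℝ => fderiv ℝ v (x + t • h) :=
    (hv.continuous_fderiv one_ne_zero).comp (by fun_prop)
  have hdiff : ‖v (x + a • h) - v (x + b • h)‖ₑ ^ 2 ≤ ENNReal.ofReal d * ‖h‖ₑ ^ 2 *
      ∫⁻ t in Set.Ioc 0 d, ‖fderiv ℝ v (x + t • h)‖ₑ ^ 2 := by
    have hcs := sq_lintegral_mul_le (μ := volume.restrict (Set.Ioc 0 d)) (k := 1)
      hc.enorm.aemeasurable aemeasurable_const
    simp only [Pi.one_apply, one_mul, lintegral_const, Measure.restrict_apply MeasurableSet.univ,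
      Set.univ_inter, Real.volume_Ioc, sub_zero] at hcs
    refine (pow_le_pow_left₀ zero_le (enorm_sub_line_le hv x h ha hb) 2).trans ?_
    rw [mul_pow, mul_comm (ENNReal.ofReal d), mul_assoc]
    gcongr
  have hadd := enorm_sq_add_le (v (x + b • h)) (v (x + a • h) - v (x + b • h))
  rw [add_sub_cancel] at hadd
  refine hadd.trans ?_
  gcongr

lemma mul_enorm_sq_le_lintegral_line (hv : ContDiff ℝ 1 v) (x h : W) (d : ℝ) :
    ENNReal.ofReal d * ‖v x‖ₑ ^ 2 ≤ 2 * (∫⁻ t in Set.Ioc 0 d, ‖v (x + t • h)‖ₑ ^ 2) +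
      2 * (ENNReal.ofReal d ^ 2 * ‖h‖ₑ ^ 2 *
        ∫⁻ t in Set.Ioc 0 d, ‖fderiv ℝ v (x + t • h)‖ₑ ^ 2) := by
  have hm : Measurable fun t : ℝ => ‖v (x + t • h)‖ₑ ^ 2 := by
    have := hv.continuous
    exact Continuous.measurable (by fun_prop)
  set I := ∫⁻ t in Set.Ioc 0 d, ‖fderiv ℝ v (x + t • h)‖ₑ ^ 2
  calc ENNReal.ofReal d * ‖v x‖ₑ ^ 2 = ∫⁻ t in Set.Ioc 0 d, ‖v x‖ₑ ^ 2 := by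
        rw [setLIntegral_const, Real.volume_Ioc, sub_zero, mul_comm]
    _ ≤ ∫⁻ t in Set.Ioc 0 d, (2 * ‖v (x + t • h)‖ₑ ^ 2 +
          2 * (ENNReal.ofReal d * ‖h‖ₑ ^ 2 * I)) := by
        refine setLIntegral_mono' measurableSet_Ioc fun t ht => ?_
        simpa using enorm_sq_line_le hv x h (d := d) (a := 0) (b := t)
          ⟨le_rfl, ht.1.le.trans ht.2⟩ ⟨ht.1.le, ht.2⟩
    _ = _ := by
        rw [lintegral_add_left (hm.const_mul 2), lintegral_const_mul _ hm, setLIntegral_const,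
          Real.volume_Ioc, sub_zero]
        ring

lemma lintegral_line_enorm_sq_le (hv : ContDiff ℝ 1 v) (x h : W) (d : ℝ) :
    ∫⁻ t in Set.Ioc 0 d, ‖v (x + t • h)‖ₑ ^ 2 ≤ 2 * (ENNReal.ofReal d * ‖v x‖ₑ ^ 2) +
      2 * (ENNReal.ofReal d ^ 2 * ‖h‖ₑ ^ 2 *
        ∫⁻ t in Set.Ioc 0 d, ‖fderiv ℝ v (x + t • h)‖ₑ ^ 2) := by
  set I := ∫⁻ t in Set.Ioc 0 d, ‖fderiv ℝ v (x + t • h)‖ₑ ^ 2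
  calc ∫⁻ t in Set.Ioc 0 d, ‖v (x + t • h)‖ₑ ^ 2
      ≤ ∫⁻ t in Set.Ioc 0 d, (2 * ‖v x‖ₑ ^ 2 + 2 * (ENNReal.ofReal d * ‖h‖ₑ ^ 2 * I)) := by
        refine setLIntegral_mono' measurableSet_Ioc fun t ht => ?_
        simpa using enorm_sq_line_le hv x h (d := d) (a := t) (b := 0)
          ⟨ht.1.le, ht.2⟩ ⟨le_rfl, ht.1.le.trans ht.2⟩
    _ = _ := by
        rw [setLIntegral_const, Real.volume_Ioc, sub_zero]
        ring

lemma lintegral_translate_le [MeasurableSpace W] [BorelSpace W] [SecondCountableTopology W]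
    {μ : Measure W} [SFinite μ] [μ.IsAddRightInvariant] (hv : ContDiff ℝ 1 v) {A U : Set W}
    (hA : MeasurableSet A) (hU : MeasurableSet U) {h : W}
    (hAU : ∀ y ∈ A, ∀ t ∈ Set.Icc (0 : ℝ) 1, y + t • h ∈ U) :
    ∫⁻ x in A, ‖v (x + h)‖ₑ ^ 2 ∂μ ≤ 2 * (∫⁻ x in A, ‖v x‖ₑ ^ 2 ∂μ) +
      2 * (‖h‖ₑ ^ 2 * ∫⁻ x in U, ‖fderiv ℝ v x‖ₑ ^ 2 ∂μ) := by
  have hvm : Measurable fun x => ‖v x‖ₑ ^ 2 := hv.continuous.enorm.measurable.pow_const 2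
  have hkU : Measurable (U.indicator fun x => ‖fderiv ℝ v x‖ₑ ^ 2) :=
    ((hv.continuous_fderiv one_ne_zero).enorm.measurable.pow_const 2).indicator hU
  set k := U.indicator fun x => ‖fderiv ℝ v x‖ₑ ^ 2 with hk
  have hline (y) (hy : y ∈ A) : ‖v (y + h)‖ₑ ^ 2 ≤
      2 * ‖v y‖ₑ ^ 2 + 2 * (‖h‖ₑ ^ 2 * ∫⁻ t in Set.Ioc (0 : ℝ) 1, k (y + t • h)) := by
    have hle := enorm_sq_line_le hv y h (d := 1) (a := 1) (b := 0) (by simp) (by simp)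
    rw [one_smul, zero_smul, add_zero, ENNReal.ofReal_one, one_mul] at hle
    refine hle.trans ?_
    gcongr 2 * _ + 2 * (_ * ?_)
    refine setLIntegral_mono' measurableSet_Ioc fun t ht => ?_
    rw [hk, Set.indicator_of_mem (hAU y hy t ⟨ht.1.le, ht.2⟩)]
  have hkm : Measurable fun q : W × ℝ => k (q.1 + q.2 • h) := hkU.comp (by fun_prop)
  have htranslate (t : ℝ) : ∫⁻ y, k (y + t • h) ∂μ = ∫⁻ x in U, ‖fderiv ℝ v x‖ₑ ^ 2 ∂μ := by
    rw [lintegral_add_right_eq_self, hk, lintegral_indicator hU]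
  refine (setLIntegral_mono' hA hline).trans ?_
  rw [lintegral_add_left (hvm.const_mul 2), lintegral_const_mul _ hvm,
    lintegral_const_mul _ (hkm.lintegral_prod_right'.const_mul _),
    lintegral_const_mul _ hkm.lintegral_prod_right']
  gcongr 2 * _ + 2 * (_ * ?_)
  refine (setLIntegral_le_lintegral _ _).trans ?_
  rw [lintegral_lintegral_swap (f := fun y t => k (y + t • h)) hkm.aemeasurable]
  simp only [htranslate, setLIntegral_const, Real.volume_Ioc, sub_zero, ENNReal.ofReal_one,
    mul_one, le_refl]

end Line

section Cylinder

variable {V F : Type*} [NormedAddCommGroup V] [InnerProductSpace ℝ V] [FiniteDimensional ℝ V]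
  [MeasurableSpace V] [BorelSpace V] [NormedAddCommGroup F] [NormedSpace ℝ F]
  {e : V} {g : V → ℝ} {d : ℝ} {B : Set (Hyp e)} {U S : Set V} {v : V → F}

lemma measurable_lintegral_graphMap_sub (hg : Continuous g) {f : V → ℝ≥0∞} (hf : Measurable f) :
    Measurable fun y : Hyp e => ∫⁻ t in Set.Ioc 0 d, f (graphMap e g y - t • e) := by
  have hG := continuous_graphMap (e := e) hg
  have : Measurable fun q : Hyp e × ℝ => f (graphMap e g q.1 - q.2 • e) := hf.comp (by fun_prop)
  exact this.lintegral_prod_right'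

variable [CompleteSpace F]

lemma mul_lintegral_graphMap_le (he : ‖e‖ = 1) (hg : Continuous g) (hB : MeasurableSet B)
    (hU : MeasurableSet U) (hBU : ∀ y ∈ B, ∀ t ∈ Set.Ioc 0 d, graphMap e g y - t • e ∈ U)
    (hv : ContDiff ℝ 1 v) :
    ENNReal.ofReal d * ∫⁻ y in B, ‖v (graphMap e g y)‖ₑ ^ 2 ≤
      2 * (∫⁻ x in U, ‖v x‖ₑ ^ 2) +
        2 * (ENNReal.ofReal d ^ 2 * ∫⁻ x in U, ‖fderiv ℝ v x‖ₑ ^ 2) := by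
  have hvm : Measurable fun x => ‖v x‖ₑ ^ 2 := hv.continuous.enorm.measurable.pow_const 2
  have hDm : Measurable fun x => ‖fderiv ℝ v x‖ₑ ^ 2 :=
    (hv.continuous_fderiv one_ne_zero).enorm.measurable.pow_const 2
  have hvG : Measurable fun y : Hyp e => ‖v (graphMap e g y)‖ₑ ^ 2 :=
    hvm.comp (continuous_graphMap hg).measurable
  have hIv := measurable_lintegral_graphMap_sub (e := e) (d := d) hg hvm
  have hID := measurable_lintegral_graphMap_sub (e := e) (d := d) hg hDm
  rw [← lintegral_const_mul _ hvG]
  have hline (y : Hyp e) := mul_enorm_sq_le_lintegral_line hv (graphMap e g y) (-e) d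
  simp only [smul_neg, ← sub_eq_add_neg, enorm_neg, ← ofReal_norm e, he, ENNReal.ofReal_one,
    one_pow, mul_one] at hline
  refine (lintegral_mono hline).trans ?_
  rw [lintegral_add_left (hIv.const_mul 2), lintegral_const_mul _ hIv,
    lintegral_const_mul _ (hID.const_mul _), lintegral_const_mul _ hID]
  gcongr
  · exact lintegral_graphMap_sub_le he hvm hB hU hBU
  · exact lintegral_graphMap_sub_le he hDm hB hU hBU

lemma lintegral_le_lintegral_graphMap (he : ‖e‖ = 1) (hg : Continuous g)
    (hinv : ∀ (y : V) (t : ℝ), g (y + t • e) = g y) (hB : MeasurableSet B)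
    (hU : MeasurableSet U) (hBU : ∀ y ∈ B, ∀ t ∈ Set.Ioc 0 d, graphMap e g y - t • e ∈ U)
    (hS : MeasurableSet S)
    (hSB : ∀ x ∈ S, hypProj e x ∈ B ∧ g x - inner ℝ e x ∈ Set.Ioc 0 d) (hv : ContDiff ℝ 1 v) :
    ∫⁻ x in S, ‖v x‖ₑ ^ 2 ≤
      2 * (ENNReal.ofReal d * ∫⁻ y in B, ‖v (graphMap e g y)‖ₑ ^ 2) +
        2 * (ENNReal.ofReal d ^ 2 * ∫⁻ x in U, ‖fderiv ℝ v x‖ₑ ^ 2) := by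
  have hvm : Measurable fun x => ‖v x‖ₑ ^ 2 := hv.continuous.enorm.measurable.pow_const 2
  have hDm : Measurable fun x => ‖fderiv ℝ v x‖ₑ ^ 2 :=
    (hv.continuous_fderiv one_ne_zero).enorm.measurable.pow_const 2
  have hvG : Measurable fun y : Hyp e => ‖v (graphMap e g y)‖ₑ ^ 2 :=
    hvm.comp (continuous_graphMap hg).measurable
  have hID := measurable_lintegral_graphMap_sub (e := e) (d := d) hg hDm
  refine (le_lintegral_graphMap_sub he hinv hvm hB hS hSB).trans ?_
  have hline (y : Hyp e) := lintegral_line_enorm_sq_le hv (graphMap e g y) (-e) d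
  simp only [smul_neg, ← sub_eq_add_neg, enorm_neg, ← ofReal_norm e, he, ENNReal.ofReal_one,
    one_pow, mul_one] at hline
  refine (lintegral_mono hline).trans ?_
  rw [lintegral_add_left ((hvG.const_mul _).const_mul 2),
    lintegral_const_mul _ (hvG.const_mul _), lintegral_const_mul _ hvG,
    lintegral_const_mul _ (hID.const_mul _), lintegral_const_mul _ hID]
  gcongr
  exact lintegral_graphMap_sub_le he hDm hB hU hBU

end Cylinder

section Chart

variable {V : Type*} [NormedAddCommGroup V] [InnerProductSpace ℝ V] {U : Set V} {p e : V}
  {g : V → ℝ} {L : NNReal} {R : ℝ}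

/-- In the ball `B(p, R)`, the set `U` is the subgraph of the `L`-Lipschitz function `g` of the
coordinates orthogonal to the unit vector `e`. -/
structure IsChart (U : Set V) (p e : V) (g : V → ℝ) (L : NNReal) (R : ℝ) : Prop where
  norm_eq : ‖e‖ = 1
  lip : LipschitzWith L g
  inv : ∀ (y : V) (t : ℝ), g (y + t • e) = g y
  pos : 0 < R
  mem_iff : ∀ y ∈ Metric.ball p R, (y ∈ U ↔ inner ℝ e y < g y)

lemma HasLipschitzBoundary.exists_isChart {N : ℕ} {U : Set (E N)} (hU : HasLipschitzBoundary U)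
    {p : E N} (hp : p ∈ frontier U) : ∃ e g L R, IsChart U p e g L R := by
  obtain ⟨e, he, g, ⟨L, hL⟩, hinv, W, hW, hmem⟩ := hU p hp
  obtain ⟨R, hR, hRW⟩ := Metric.mem_nhds_iff.1 hW
  exact ⟨e, g, L, R, he, hL, hinv, hR, fun y hy => hmem y (hRW hy)⟩

namespace IsChart

lemma mono (h : IsChart U p e g L R) {r : ℝ} (hr : 0 < r) (hrR : r ≤ R) : IsChart U p e g L r :=
  ⟨h.norm_eq, h.lip, h.inv, hr, fun y hy => h.mem_iff y (Metric.ball_subset_ball hrR hy)⟩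

lemma mem_of_inner_lt (h : IsChart U p e g L R) {y : V} (hy : y ∈ Metric.ball p R)
    (hlt : inner ℝ e y < g y) : y ∈ U := (h.mem_iff y hy).2 hlt

lemma isOpen_below (h : IsChart U p e g L R) : IsOpen {y | inner ℝ e y < g y} :=
  isOpen_lt (by fun_prop) h.lip.continuous

lemma isOpen_above (h : IsChart U p e g L R) : IsOpen {y | g y < inner ℝ e y} :=
  isOpen_lt h.lip.continuous (by fun_prop)

lemma not_mem_closure (h : IsChart U p e g L R) {y : V} (hy : y ∈ Metric.ball p R)
    (hlt : g y < inner ℝ e y) : y ∉ closure U := by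
  intro hcl
  obtain ⟨z, ⟨hz, hz_above⟩, hzU⟩ :=
    mem_closure_iff.1 hcl _ (Metric.isOpen_ball.inter h.isOpen_above) ⟨hy, hlt⟩
  exact absurd ((h.mem_iff z hz).1 hzU) (not_lt.2 (le_of_lt hz_above))

lemma add_smul_mem_ball (h : IsChart U p e g L R) {y : V} {t r : ℝ}
    (hy : y ∈ Metric.ball p r) (ht : |t| ≤ R - r) : y + t • e ∈ Metric.ball p R := by
  have hdist : dist (y + t • e) y = |t| := by
    rw [dist_eq_norm, add_sub_cancel_left, norm_smul, h.norm_eq, mul_one, Real.norm_eq_abs]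
  rw [Metric.mem_ball] at hy ⊢
  linarith [dist_triangle (y + t • e) y p]

lemma mem_frontier_iff (h : IsChart U p e g L R) {y : V} (hy : y ∈ Metric.ball p R) :
    y ∈ frontier U ↔ inner ℝ e y = g y := by
  constructor
  · intro hf
    rcases lt_trichotomy (inner ℝ e y) (g y) with hlt | heq | hgt
    · exact absurd (mem_interior.2 ⟨_, fun z hz => h.mem_of_inner_lt hz.1 hz.2,
        Metric.isOpen_ball.inter h.isOpen_below, ⟨hy, hlt⟩⟩) hf.2
    · exact heq
    · exact absurd hf.1 (h.not_mem_closure hy hgt)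
  · intro heq
    refine ⟨?_, fun hi => absurd ((h.mem_iff y hy).1 (interior_subset hi)) heq.not_lt⟩
    have hlim : Filter.Tendsto (fun t : ℝ => y + t • e) (𝓝[<] 0) (𝓝 y) := by
      have : Continuous fun t : ℝ => y + t • e := by fun_prop
      simpa using (this.tendsto 0).mono_left nhdsWithin_le_nhds
    refine mem_closure_of_tendsto hlim ?_
    filter_upwards [hlim (Metric.isOpen_ball.mem_nhds hy), self_mem_nhdsWithin] with t ht ht0
    refine h.mem_of_inner_lt ht ?_
    rw [inner_add_smul_self h.norm_eq, h.inv, heq]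
    exact add_lt_of_neg_right _ ht0

lemma sub_smul_mem (h : IsChart U p e g L R) {x : V} (hx : x ∈ Metric.ball p (R / 2))
    (hxg : inner ℝ e x = g x) {t : ℝ} (ht : t ∈ Set.Ioc 0 (R / 2)) : x - t • e ∈ U := by
  rw [sub_eq_add_neg, ← neg_smul]
  refine h.mem_of_inner_lt (h.add_smul_mem_ball hx ?_) ?_
  · rw [abs_neg, abs_of_pos ht.1]
    linarith [ht.2]
  · rw [inner_add_smul_self h.norm_eq, h.inv, hxg]
    linarith [ht.1]

lemma ball_inter_frontier_subset_range (h : IsChart U p e g L R) :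
    Metric.ball p R ∩ frontier U ⊆ Set.range (graphMap e g) := fun x hx =>
  ⟨hypProj e x, by
    rw [graphMap_hypProj h.norm_eq h.inv, (h.mem_frontier_iff hx.1).1 hx.2, sub_self, zero_smul,
      add_zero]⟩

lemma sub_inner_le (h : IsChart U p e g L R) (hp : p ∈ frontier U) (x : V) :
    g x - inner ℝ e x ≤ (L + 1) * dist x p := by
  have hgp := (h.mem_frontier_iff (Metric.mem_ball_self h.pos)).1 hp
  have hg : g x - g p ≤ L * dist x p :=
    (le_abs_self _).trans ((Real.dist_eq _ _).symm.trans_le (h.lip.dist_le_mul x p))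
  have he : inner ℝ e p - inner ℝ e x ≤ dist x p := by
    rw [← inner_sub_right, dist_comm, dist_eq_norm]
    simpa [h.norm_eq] using real_inner_le_norm e (p - x)
  linarith

lemma graphMap_hypProj_mem (h : IsChart U p e g L R) (hp : p ∈ frontier U) {x : V}
    (hx : x ∈ Metric.ball p (R / (L + 2)) ∩ U) :
    graphMap e g (hypProj e x) ∈ Metric.ball p R ∩ frontier U ∧
      g x - inner ℝ e x ∈ Set.Ioc 0 R := by
  obtain ⟨hxp, hxU⟩ := hx
  have hρ : (L + 2) * (R / (L + 2)) = R := by field_simp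
  have hρ0 : 0 < R / (L + 2) := div_pos h.pos (by positivity)
  have hρR : R / (L + 2) ≤ R := div_le_self h.pos.le (by linarith [L.coe_nonneg])
  have hlt : inner ℝ e x < g x := (h.mem_iff x (Metric.ball_subset_ball hρR hxp)).1 hxU
  have hle : g x - inner ℝ e x ≤ R - R / (L + 2) := by
    have := mul_le_mul_of_nonneg_left (Metric.mem_ball.1 hxp).le
      (by positivity : (0 : ℝ) ≤ L + 1)
    linarith [h.sub_inner_le hp x]
  have hball : graphMap e g (hypProj e x) ∈ Metric.ball p R := by
    rw [graphMap_hypProj h.norm_eq h.inv]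
    refine h.add_smul_mem_ball hxp ?_
    rwa [abs_of_pos (sub_pos.2 hlt)]
  exact ⟨⟨hball, (h.mem_frontier_iff hball).2 (inner_graphMap h.norm_eq h.inv _)⟩,
    sub_pos.2 hlt, by linarith⟩

end IsChart

end Chart

section ChartEstimates

variable {N : ℕ} {U : Set (E N)} {p e : E N} {g : E N → ℝ} {L : NNReal} {R : ℝ}

namespace IsChart

lemma mul_lintegral_graphMap_frontier_le (h : IsChart U p e g L R) (hU : IsOpen U) {v : E N → ℝ}
    (hv : ContDiff ℝ 1 v) :
    ENNReal.ofReal (R / 2) * ∫⁻ y in graphMap e g ⁻¹' (Metric.ball p (R / 2) ∩ frontier U),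
        ‖v (graphMap e g y)‖ₑ ^ 2 ≤
      2 * (∫⁻ x in U, ‖v x‖ₑ ^ 2) +
        2 * (ENNReal.ofReal (R / 2) ^ 2 * ∫⁻ x in U, ‖fderiv ℝ v x‖ₑ ^ 2) :=
  mul_lintegral_graphMap_le h.norm_eq h.lip.continuous
    ((continuous_graphMap h.lip.continuous).measurable
      (Metric.isOpen_ball.measurableSet.inter isClosed_frontier.measurableSet)) hU.measurableSet
    (fun y hy _ ht => h.sub_smul_mem hy.1 (inner_graphMap h.norm_eq h.inv y) ht) hv

lemma lintegral_surf_le (h : IsChart U p e g L R) (hU : IsOpen U) :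
    ∃ C : NNReal, ∀ v : E N → ℝ, ContDiff ℝ 1 v →
      ∫⁻ x in Metric.ball p (R / 2) ∩ frontier U, ‖v x‖ₑ ^ 2 ∂(surf N) ≤
        C * ∫⁻ x in U, (‖v x‖ₑ ^ 2 + ‖fderiv ℝ v x‖ₑ ^ 2) := by
  have hR : 0 < R / 2 := half_pos h.pos
  obtain ⟨d, hd⟩ : ∃ d : NNReal, (d : ℝ≥0∞) = ENNReal.ofReal (R / 2) := ⟨_, rfl⟩
  have hd0 : d ≠ 0 := fun h0 => (ENNReal.ofReal_pos.2 hR).ne' (by rw [← hd, h0, ENNReal.coe_zero])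
  refine ⟨(1 + L) ^ (N - 1) * (d⁻¹ * (2 + 2 * d ^ 2)), fun v hv => ?_⟩
  have hgraph := h.mul_lintegral_graphMap_frontier_le hU hv
  rw [← hd] at hgraph
  have hsub : Metric.ball p (R / 2) ∩ frontier U ⊆ Set.range (graphMap e g) :=
    (Set.inter_subset_inter_left _ (Metric.ball_subset_ball (half_le_self h.pos.le))).trans
      h.ball_inter_frontier_subset_range
  have hv2 : Measurable fun x => ‖v x‖ₑ ^ 2 := hv.continuous.enorm.measurable.pow_const 2
  refine (lintegral_surf_le_graphMap h.norm_eq h.lip hsub hv2).trans ?_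
  rw [ENNReal.coe_mul, ENNReal.coe_pow, mul_assoc, ENNReal.coe_mul, ENNReal.coe_inv hd0, mul_assoc,
    ← ENNReal.div_eq_inv_mul]
  gcongr
  rw [ENNReal.le_div_iff_mul_le (by simp [hd0]) (by simp), mul_comm]
  refine hgraph.trans ?_
  rw [lintegral_add_left hv2, ENNReal.coe_add, ENNReal.coe_mul, ENNReal.coe_pow, mul_add,
    ← mul_assoc]
  gcongr
  · exact le_self_add
  · exact le_add_self

lemma lintegral_ball_le (h : IsChart U p e g L R) (hU : IsOpen U) (hp : p ∈ frontier U) :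
    ∃ ρ : ℝ, 0 < ρ ∧ ∃ C : NNReal, ∀ v : E N → ℝ, ContDiff ℝ 1 v →
      ∫⁻ x in Metric.ball p ρ ∩ U, ‖v x‖ₑ ^ 2 ≤
        C * ((∫⁻ x in Metric.ball p (R / 2) ∩ frontier U, ‖v x‖ₑ ^ 2 ∂(surf N)) +
          ∫⁻ x in U, ‖fderiv ℝ v x‖ₑ ^ 2) := by
  have hR : 0 < R / 2 := half_pos h.pos
  have hhalf := h.mono hR (half_le_self h.pos.le)
  obtain ⟨d, hd⟩ : ∃ d : NNReal, (d : ℝ≥0∞) = ENNReal.ofReal (R / 2) := ⟨_, rfl⟩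
  refine ⟨R / 2 / (L + 2), div_pos hR (by positivity), 2 * d + 2 * d ^ 2, fun v hv => ?_⟩
  have hv2 : Measurable fun x => ‖v x‖ₑ ^ 2 := hv.continuous.enorm.measurable.pow_const 2
  have hB : MeasurableSet (graphMap e g ⁻¹' (Metric.ball p (R / 2) ∩ frontier U)) :=
    (continuous_graphMap h.lip.continuous).measurable
      (Metric.isOpen_ball.measurableSet.inter isClosed_frontier.measurableSet)
  have hgraph := lintegral_le_lintegral_graphMap h.norm_eq h.lip.continuous h.inv hB
    hU.measurableSet
    (fun y hy _ ht => h.sub_smul_mem hy.1 (inner_graphMap h.norm_eq h.inv y) ht)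
    (Metric.isOpen_ball.measurableSet.inter hU.measurableSet)
    (fun _ hx => hhalf.graphMap_hypProj_mem hp hx) hv
  rw [← hd] at hgraph
  have hsurf := lintegral_graphMap_le_surf h.norm_eq h.lip.continuous
    (Metric.ball p (R / 2) ∩ frontier U) hv2
  calc _ ≤ _ := hgraph
    _ ≤ (2 * d) * (∫⁻ x in Metric.ball p (R / 2) ∩ frontier U, ‖v x‖ₑ ^ 2 ∂(surf N)) +
        (2 * d ^ 2) * ∫⁻ x in U, ‖fderiv ℝ v x‖ₑ ^ 2 := by
        rw [← mul_assoc, ← mul_assoc]; gcongr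
    _ ≤ _ := by
        push_cast
        rw [mul_add]
        gcongr
        · exact le_self_add
        · exact le_add_self

end IsChart

end ChartEstimates

/-! ### Sobolev spaces -/

section L2

variable {α F : Type*} [MeasurableSpace α] {μ : Measure α} [NormedAddCommGroup F]

lemma eLpNorm_two_sq (f : α → F) : eLpNorm f 2 μ ^ 2 = ∫⁻ x, ‖f x‖ₑ ^ 2 ∂μ := by
  simpa using eLpNorm_nnreal_pow_eq_lintegral (μ := μ) (f := f) (p := 2) (by simp)

lemma enorm_sq_Lp (f : Lp F 2 μ) : ‖f‖ₑ ^ 2 = ∫⁻ x, ‖f x‖ₑ ^ 2 ∂μ := by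
  rw [Lp.enorm_def, eLpNorm_two_sq]

lemma memLp_two_of_lintegral_lt_top {f : α → F} (hf : AEStronglyMeasurable f μ)
    (h : ∫⁻ x, ‖f x‖ₑ ^ 2 ∂μ < ⊤) : MemLp f 2 μ := by
  refine ⟨hf, lt_top_iff_ne_top.2 fun h_top => ?_⟩
  rw [← eLpNorm_two_sq, h_top] at h
  simp at h

lemma continuous_integral_inner [InnerProductSpace ℝ F] {a : α → F} (ha : MemLp a 2 μ) :
    Continuous fun f : Lp F 2 μ => ∫ x, inner ℝ (a x) (f x) ∂μ := by
  have integral_eq (f : Lp F 2 μ) : inner ℝ (ha.toLp a) f = ∫ x, inner ℝ (a x) (f x) ∂μ := by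
    rw [L2.inner_def]
    refine integral_congr_ae ?_
    filter_upwards [ha.coeFn_toLp] with x hx
    rw [hx]
  simp only [← integral_eq]
  fun_prop

end L2

section Restrict

variable {α F : Type*} [MeasurableSpace α] {μ : Measure α} [NormedAddCommGroup F]

lemma integrableOn_of_memLp [TopologicalSpace α] [IsFiniteMeasureOnCompacts μ] {p : ℝ≥0∞}
    {f : α → F} {K B : Set α} (hp : 1 ≤ p) (hf : MemLp f p (μ.restrict B)) (hKB : K ⊆ B)
    (hK : IsCompact K) : IntegrableOn f K μ := by
  have : IsFiniteMeasure (μ.restrict K) := isFiniteMeasure_restrict.2 hK.measure_lt_top.ne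
  exact (hf.mono_measure (Measure.restrict_mono_set μ hKB)).integrable hp

variable [NormedSpace ℝ F] {A B : Set α} {p : ℝ≥0∞} [Fact (1 ≤ p)]

variable (p) in
/-- Restriction of `L^p` functions to a smaller set; on surface `L²` functions it is
`restrictSurf`. -/
def restrictLp (h : A ⊆ B) : Lp F p (μ.restrict B) →L[ℝ] Lp F p (μ.restrict A) :=
  have hμ := Measure.restrict_mono_set μ h
  LinearMap.mkContinuous
    { toFun := fun f => MemLp.toLp f ((Lp.memLp f).mono_measure hμ)
      map_add' := fun f g => by
        rw [← MemLp.toLp_add]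
        exact MemLp.toLp_congr _ _ (ae_mono hμ (Lp.coeFn_add f g))
      map_smul' := fun c f => by
        rw [RingHom.id_apply, ← MemLp.toLp_const_smul]
        exact MemLp.toLp_congr _ _ (ae_mono hμ (Lp.coeFn_smul c f)) } 1
    fun f => by
      change ‖MemLp.toLp f ((Lp.memLp f).mono_measure hμ)‖ ≤ 1 * ‖f‖
      rw [one_mul, Lp.norm_toLp, Lp.norm_def f]
      exact ENNReal.toReal_mono (Lp.eLpNorm_ne_top f) (eLpNorm_mono_measure _ hμ)

lemma coeFn_restrictLp (h : A ⊆ B) (f : Lp F p (μ.restrict B)) :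
    restrictLp p h f =ᵐ[μ.restrict A] f :=
  MemLp.coeFn_toLp ((Lp.memLp f).mono_measure (Measure.restrict_mono_set μ h))

lemma enorm_sq_restrictLp (h : A ⊆ B) (f : Lp F 2 (μ.restrict B)) :
    ‖restrictLp 2 h f‖ₑ ^ 2 = ∫⁻ x in A, ‖f x‖ₑ ^ 2 ∂μ := by
  rw [enorm_sq_Lp]
  refine lintegral_congr_ae ?_
  filter_upwards [coeFn_restrictLp h f] with x hx
  rw [hx]

lemma continuous_setLIntegral_enorm_sq (h : A ⊆ B) :
    Continuous fun f : Lp F 2 (μ.restrict B) => ∫⁻ x in A, ‖f x‖ₑ ^ 2 ∂μ := by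
  simp only [← enorm_sq_restrictLp h]
  exact (ENNReal.continuous_pow 2).comp (restrictLp 2 h).continuous.enorm

end Restrict

section Gradient

variable {V : Type*} [NormedAddCommGroup V] [InnerProductSpace ℝ V]

lemma continuous_fderiv_apply {v : V → ℝ} (hv : ContDiff ℝ 1 v) (w : V) :
    Continuous fun x => fderiv ℝ v x w :=
  (hv.continuous_fderiv (by simp)).clm_apply continuous_const

variable [CompleteSpace V]

lemma enorm_gradient (v : V → ℝ) (x : V) : ‖gradient v x‖ₑ = ‖fderiv ℝ v x‖ₑ := by
  rw [gradient, LinearIsometryEquiv.enorm_map]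

lemma continuous_gradient {v : V → ℝ} (hv : ContDiff ℝ 1 v) : Continuous (gradient v) :=
  (InnerProductSpace.toDual ℝ V).symm.continuous.comp (hv.continuous_fderiv (by simp))

end Gradient

section WeakGradient

variable {N : ℕ} {U : Set (E N)} {u u' : E N → ℝ} {G G' : E N → E N}

lemma HasWeakGradient.congr (h : HasWeakGradient U u G) (hu : u =ᵐ[volume.restrict U] u')
    (hG : G =ᵐ[volume.restrict U] G') : HasWeakGradient U u' G' := by
  intro θ hθ hθc hθU w
  have integral_fn : ∫ x in U, u' x * fderiv ℝ θ x w = ∫ x in U, u x * fderiv ℝ θ x w :=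
    integral_congr_ae (hu.mono fun x hx => by beta_reduce; rw [hx])
  have integral_grad : ∫ x in U, inner ℝ (G' x) w * θ x = ∫ x in U, inner ℝ (G x) w * θ x :=
    integral_congr_ae (hG.mono fun x hx => by beta_reduce; rw [hx])
  rw [integral_fn, integral_grad, h θ hθ hθc hθU w]

lemma hasWeakGradient_of_contDiff {v : E N → ℝ} (hv : ContDiff ℝ 1 v) :
    HasWeakGradient U v (gradient v) := by
  intro θ hθ hθc hθU w
  have hθ' := continuous_fderiv_apply (hθ.of_le (by simp)) w
  have integral_fn : ∫ x in U, v x * fderiv ℝ θ x w = ∫ x, v x * fderiv ℝ θ x w :=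
    setIntegral_eq_integral_of_forall_compl_eq_zero fun x hx => by
      rw [fderiv_of_notMem_tsupport ℝ fun h => hx (hθU h)]; simp
  have integral_grad :
      ∫ x in U, inner ℝ (gradient v x) w * θ x = ∫ x, fderiv ℝ v x w * θ x := by
    simp only [inner_gradient_left]
    exact setIntegral_eq_integral_of_forall_compl_eq_zero fun x hx => by
      rw [image_eq_zero_of_notMem_tsupport fun h => hx (hθU h)]; simp
  rw [integral_fn, integral_grad]
  refine integral_mul_fderiv_eq_neg_fderiv_mul_of_integrable ?_ ?_ ?_
    (fun x _ => hv.differentiable (by simp) x) (fun x _ => hθ.differentiable (by simp) x)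
  · exact ((continuous_fderiv_apply hv w).mul hθ.continuous).integrable_of_hasCompactSupport
      hθc.mul_left
  · exact (hv.continuous.mul hθ').integrable_of_hasCompactSupport (hθc.fderiv_apply ℝ w).mul_left
  · exact (hv.continuous.mul hθ.continuous).integrable_of_hasCompactSupport hθc.mul_left

lemma HasWeakGradient.integral_inner_sub_mul_eq_zero (h : HasWeakGradient U u G)
    (h' : HasWeakGradient U u G') (hG : MemLp G 2 (volume.restrict U))
    (hG' : MemLp G' 2 (volume.restrict U)) {θ : E N → ℝ} (hθ : ContDiff ℝ ∞ θ)
    (hθc : HasCompactSupport θ) (hθU : tsupport θ ⊆ U) (w : E N) :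
    ∫ x in U, inner ℝ ((G - G') x) w * θ x = 0 := by
  simp only [Pi.sub_apply, inner_sub_left, sub_mul]
  rw [integral_sub (integrable_mul_of_compactSupport (hG.inner_const w) hθ.continuous hθc)
    (integrable_mul_of_compactSupport (hG'.inner_const w) hθ.continuous hθc), sub_eq_zero,
    ← neg_inj, ← h θ hθ hθc hθU w, h' θ hθ hθc hθU w]

lemma HasWeakGradient.unique (hU : IsOpen U) (h : HasWeakGradient U u G)
    (h' : HasWeakGradient U u G') (hG : MemLp G 2 (volume.restrict U))
    (hG' : MemLp G' 2 (volume.restrict U)) : G =ᵐ[volume.restrict U] G' := by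
  have h_sub := hG.sub hG'
  have sub_ae_eq_zero : ∀ᵐ x, x ∈ U → (G - G') x = 0 := by
    refine hU.ae_eq_zero_of_integral_contDiff_smul_eq_zero ?_ fun θ hθ hθc hθU => ?_
    · exact (locallyIntegrableOn_iff hU.isLocallyClosed).2 fun K hKU hK =>
        integrableOn_of_memLp one_le_two h_sub hKU hK
    · rw [← setIntegral_eq_integral_of_forall_compl_eq_zero (s := U) fun x hx => by
        rw [image_eq_zero_of_notMem_tsupport fun h => hx (hθU h), zero_smul]]
      have h_int : Integrable (fun x => θ x • (G - G') x) (volume.restrict U) :=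
        memLp_one_iff_integrable.1
          (h_sub.smul (hθ.continuous.memLp_of_hasCompactSupport (p := 2) hθc))
      refine ext_inner_right ℝ fun w => ?_
      rw [real_inner_comm, ← integral_inner h_int, inner_zero_left,
        ← h.integral_inner_sub_mul_eq_zero h' hG hG' hθ hθc hθU w]
      refine integral_congr_ae (.of_forall fun x => ?_)
      beta_reduce
      rw [inner_smul_right, real_inner_comm, mul_comm]
  rw [Filter.EventuallyEq, ae_restrict_iff' hU.measurableSet]
  exact sub_ae_eq_zero.mono fun x hx hxU => sub_eq_zero.1 (hx hxU)

lemma HasWeakGradient.mul_smooth (h : HasWeakGradient U u G) (hu : MemLp u 2 (volume.restrict U))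
    (hG : MemLp G 2 (volume.restrict U)) {ζ : E N → ℝ} (hζ : ContDiff ℝ ∞ ζ) :
    HasWeakGradient U (fun x => ζ x * u x) (fun x => ζ x • G x + u x • gradient ζ x) := by
  intro θ hθ hθc hθU w
  have hθ' := continuous_fderiv_apply (hθ.of_le (by simp)) w
  have hζ' := continuous_fderiv_apply (hζ.of_le (by simp)) w
  have fderiv_mul_apply (x : E N) : u x * fderiv ℝ (fun x => ζ x * θ x) x w =
      u x * (ζ x * fderiv ℝ θ x w) + u x * (θ x * fderiv ℝ ζ x w) := by
    rw [fderiv_fun_mul (hζ.differentiable (by simp) x) (hθ.differentiable (by simp) x)]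
    simp only [add_apply, smul_apply, smul_eq_mul]
    ring
  have inner_grad_mul (x : E N) : inner ℝ (ζ x • G x + u x • gradient ζ x) w * θ x =
      inner ℝ (G x) w * (ζ x * θ x) + u x * (θ x * fderiv ℝ ζ x w) := by
    rw [inner_add_left, real_inner_smul_left, real_inner_smul_left, inner_gradient_left]
    ring
  have int_fn : Integrable (fun x => u x * (ζ x * fderiv ℝ θ x w)) (volume.restrict U) :=
    integrable_mul_of_compactSupport hu (hζ.continuous.mul hθ') (hθc.fderiv_apply ℝ w).mul_left
  have int_cross : Integrable (fun x => u x * (θ x * fderiv ℝ ζ x w)) (volume.restrict U) :=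
    integrable_mul_of_compactSupport hu (hθ.continuous.mul hζ') hθc.mul_right
  have int_grad : Integrable (fun x => inner ℝ (G x) w * (ζ x * θ x)) (volume.restrict U) :=
    integrable_mul_of_compactSupport (hG.inner_const w) (hζ.continuous.mul hθ.continuous)
      hθc.mul_left
  have parts := h _ (hζ.mul hθ) hθc.mul_left (tsupport_mul_subset_right.trans hθU) w
  simp only [fderiv_mul_apply] at parts
  rw [integral_add int_fn int_cross] at parts
  simp only [inner_grad_mul]
  rw [integral_add int_grad int_cross]
  simp only [mul_comm (ζ _) (u _), mul_assoc]
  linarith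

end WeakGradient

section Sobolev

variable {N : ℕ} {U : Set (E N)}

/-- The function underlying an element of `H¹`. -/
def H1.fn : H1 U →L[ℝ] L2Vol U :=
  (WithLp.fstL 2 ℝ (L2Vol U) (L2VolVec U)).comp (H1 U).subtypeL

/-- The weak gradient of an element of `H¹`. -/
def H1.grad : H1 U →L[ℝ] L2VolVec U :=
  (WithLp.sndL 2 ℝ (L2Vol U) (L2VolVec U)).comp (H1 U).subtypeL

lemma H1.hasWeakGradient (u : H1 U) : HasWeakGradient U (H1.fn u) (H1.grad u) := u.2

/-- The element of `H¹(U)` given by a square integrable function with a square integrable weak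
gradient. -/
def H1.mk {u : E N → ℝ} {G : E N → E N} (hu : MemLp u 2 (volume.restrict U))
    (hG : MemLp G 2 (volume.restrict U)) (h : HasWeakGradient U u G) : H1 U :=
  ⟨WithLp.toLp 2 (hu.toLp u, hG.toLp G), h.congr hu.coeFn_toLp.symm hG.coeFn_toLp.symm⟩

lemma H1.fn_mk {u : E N → ℝ} {G : E N → E N} (hu : MemLp u 2 (volume.restrict U))
    (hG : MemLp G 2 (volume.restrict U)) (h : HasWeakGradient U u G) :
    H1.fn (H1.mk hu hG h) = hu.toLp u := rfl

lemma H1.grad_mk {u : E N → ℝ} {G : E N → E N} (hu : MemLp u 2 (volume.restrict U))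
    (hG : MemLp G 2 (volume.restrict U)) (h : HasWeakGradient U u G) :
    H1.grad (H1.mk hu hG h) = hG.toLp G := rfl

lemma H1.ext {u v : H1 U} (h_fn : H1.fn u = H1.fn v) (h_grad : H1.grad u = H1.grad v) : u = v :=
  Subtype.ext (WithLp.ofLp_injective 2 (Prod.ext h_fn h_grad))

lemma H1.norm_sq (u : H1 U) : ‖u‖ ^ 2 = ‖H1.fn u‖ ^ 2 + ‖H1.grad u‖ ^ 2 :=
  WithLp.prod_norm_sq_eq_of_L2 (u : WithLp 2 (L2Vol U × L2VolVec U))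

lemma H1.enorm_sq (u : H1 U) : ‖u‖ₑ ^ 2 =
    (∫⁻ x in U, ‖H1.fn u x‖ₑ ^ 2) + ∫⁻ x in U, ‖H1.grad u x‖ₑ ^ 2 := by
  rw [← enorm_sq_Lp, ← enorm_sq_Lp, ← ofReal_norm, ← ofReal_norm, ← ofReal_norm,
    ← ENNReal.ofReal_pow (norm_nonneg _), ← ENNReal.ofReal_pow (norm_nonneg _),
    ← ENNReal.ofReal_pow (norm_nonneg _), ← ENNReal.ofReal_add (by positivity) (by positivity),
    H1.norm_sq]

lemma isClosed_H1 (U : Set (E N)) : IsClosed (H1 U : Set (WithLp 2 (L2Vol U × L2VolVec U))) := by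
  have H1_eq_iInter : (H1 U : Set (WithLp 2 (L2Vol U × L2VolVec U))) =
      ⋂ (θ : E N → ℝ) (_ : ContDiff ℝ ∞ θ) (_ : HasCompactSupport θ) (_ : tsupport θ ⊆ U)
        (w : E N), {p : WithLp 2 (L2Vol U × L2VolVec U) |
          ∫ x in U, p.fst x * fderiv ℝ θ x w = - ∫ x in U, inner ℝ (p.snd x) w * θ x} := by
    ext p
    simp only [Set.mem_iInter]
    rfl
  rw [H1_eq_iInter]
  refine isClosed_iInter fun θ => isClosed_iInter fun hθ => isClosed_iInter fun hθc =>
    isClosed_iInter fun _ => isClosed_iInter fun w => ?_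
  have memLp_fderiv :
      MemLp (fun x => fderiv ℝ θ x w) 2 ((volume : Measure (E N)).restrict U) :=
    (continuous_fderiv_apply (hθ.of_le (by simp)) w).memLp_of_hasCompactSupport
      (hθc.fderiv_apply ℝ w)
  have memLp_smul : MemLp (fun x => θ x • w) 2 ((volume : Measure (E N)).restrict U) :=
    (hθ.continuous.smul continuous_const).memLp_of_hasCompactSupport hθc.smul_right
  refine isClosed_eq
    ((continuous_integral_inner memLp_fderiv).comp
      (WithLp.fstL 2 ℝ (L2Vol U) (L2VolVec U)).continuous)
    (((continuous_integral_inner memLp_smul).comp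
      (WithLp.sndL 2 ℝ (L2Vol U) (L2VolVec U)).continuous).neg.congr fun p => ?_)
  refine congrArg _ (integral_congr_ae (.of_forall fun x => ?_))
  beta_reduce
  rw [real_inner_smul_left, mul_comm, real_inner_comm]
  rfl

instance : CompleteSpace (H1 U) := (isClosed_H1 U).completeSpace_coe

end Sobolev

/-! ### Mollification -/

section Translation

variable {V F : Type*} [AddCommGroup V] [TopologicalSpace V] [IsTopologicalAddGroup V]
  [MeasurableSpace V] [BorelSpace V] {μ : Measure V} [μ.InnerRegularCompactLTTop]
  [IsLocallyFiniteMeasure μ] [μ.IsAddRightInvariant] [NormedAddCommGroup F]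

lemma tendsto_eLpNorm_translate_sub {p : ℝ≥0∞} [Fact (1 ≤ p)] (hp : p ≠ ⊤)
    {f : V → F} (hf : MemLp f p μ) :
    Filter.Tendsto (fun z => eLpNorm (fun y => f (y - z) - f y) p μ) (𝓝 0) (𝓝 0) := by
  let τ : V → C(V, V) := fun z => ⟨fun y => y - z, by fun_prop⟩
  have hτ : Continuous τ := by
    refine ContinuousMap.continuous_of_continuous_uncurry _ ?_
    simp only [Function.uncurry_def, τ, ContinuousMap.coe_mk]
    fun_prop
  have preserving : ∀ z, MeasurePreserving (τ z) μ μ := fun z => measurePreserving_sub_right μ z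
  have enorm_eq : ∀ z, eLpNorm (fun y => f (y - z) - f y) p μ =
      ‖Lp.compMeasurePreserving (τ z) (preserving z) (hf.toLp f) - hf.toLp f‖ₑ := fun z => by
    rw [Lp.toLp_compMeasurePreserving, ← MemLp.toLp_sub, Lp.enorm_toLp]
    rfl
  have cont : Continuous fun z => eLpNorm (fun y => f (y - z) - f y) p μ := by
    simp only [enorm_eq]
    exact ((continuous_const.compMeasurePreservingLp hτ preserving hp).sub continuous_const).enorm
  simpa using cont.tendsto 0

end Translation

section Mollifier

open ContinuousLinearMap (lsmul)

variable {V F : Type*} [NormedAddCommGroup V] [NormedSpace ℝ V] [MeasurableSpace V]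
  {k : V → ℝ} {μ : Measure V}

/-- A mollifier: a smooth probability density with compact support. It need not be centered at the
origin, so that mollification may shift a function into a domain along an interior cone. -/
structure IsMollifier (k : V → ℝ) (μ : Measure V) : Prop where
  contDiff : ContDiff ℝ ∞ k
  hasCompactSupport : HasCompactSupport k
  nonneg : ∀ z, 0 ≤ k z
  integral_eq_one : ∫ z, k z ∂μ = 1

variable [BorelSpace V]

lemma IsMollifier.integrable [IsFiniteMeasureOnCompacts μ] (hk : IsMollifier k μ) :
    Integrable k μ :=
  hk.contDiff.continuous.integrable_of_hasCompactSupport hk.hasCompactSupport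

lemma IsMollifier.lintegral_enorm [IsFiniteMeasureOnCompacts μ] (hk : IsMollifier k μ) :
    ∫⁻ z, ‖k z‖ₑ ∂μ = 1 := by
  rw [← ofReal_integral_norm_eq_lintegral_enorm hk.integrable]
  simp only [Real.norm_of_nonneg (hk.nonneg _), hk.integral_eq_one, ENNReal.ofReal_one]

variable [NormedAddCommGroup F] [NormedSpace ℝ F] [CompleteSpace F] [FiniteDimensional ℝ V]
  [μ.IsAddHaarMeasure] {f : V → F}

lemma IsMollifier.enorm_sq_convolution_sub_le (hk : IsMollifier k μ) (hfm : StronglyMeasurable f)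
    (hf : LocallyIntegrable f μ) (y : V) :
    ‖(k ⋆[lsmul ℝ ℝ, μ] f) y - f y‖ₑ ^ 2 ≤ ∫⁻ z, ‖k z‖ₑ * ‖f (y - z) - f y‖ₑ ^ 2 ∂μ := by
  have int_shift : Integrable (fun z => k z • f (y - z)) μ :=
    (hk.hasCompactSupport.convolutionExists_left (lsmul ℝ ℝ) hk.contDiff.continuous hf y).integrable
  have sub_eq : (k ⋆[lsmul ℝ ℝ, μ] f) y - f y = ∫ z, k z • (f (y - z) - f y) ∂μ := by
    simp only [smul_sub]
    rw [integral_sub int_shift (hk.integrable.smul_const _), integral_smul_const,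
      hk.integral_eq_one, one_smul, convolution_lsmul]
  have hm : Measurable fun z => ‖f (y - z) - f y‖ₑ :=
    ((hfm.comp_measurable (by fun_prop)).sub stronglyMeasurable_const).enorm
  calc ‖(k ⋆[lsmul ℝ ℝ, μ] f) y - f y‖ₑ ^ 2
      ≤ (∫⁻ z, ‖k z‖ₑ * ‖f (y - z) - f y‖ₑ ∂μ) ^ 2 := by
        rw [sub_eq]
        gcongr
        refine (enorm_integral_le_lintegral_enorm _).trans_eq ?_
        simp only [enorm_smul]
    _ ≤ (∫⁻ z, ‖k z‖ₑ ∂μ) * ∫⁻ z, ‖k z‖ₑ * ‖f (y - z) - f y‖ₑ ^ 2 ∂μ :=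
        sq_lintegral_mul_le hm.aemeasurable hk.contDiff.continuous.enorm.measurable.aemeasurable
    _ = ∫⁻ z, ‖k z‖ₑ * ‖f (y - z) - f y‖ₑ ^ 2 ∂μ := by rw [hk.lintegral_enorm, one_mul]

lemma IsMollifier.eLpNorm_convolution_sub_le (hk : IsMollifier k μ) (hfm : StronglyMeasurable f)
    (hf : MemLp f 2 μ) {ε : ℝ≥0∞}
    (h : ∀ z ∈ tsupport k, eLpNorm (fun y => f (y - z) - f y) 2 μ ≤ ε) :
    eLpNorm (k ⋆[lsmul ℝ ℝ, μ] f - f) 2 μ ≤ ε := by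
  have hkm : Measurable fun z => ‖k z‖ₑ := hk.contDiff.continuous.enorm.measurable
  have hfm' : StronglyMeasurable fun q : V × V => f (q.1 - q.2) - f q.1 :=
    (hfm.comp_measurable (by fun_prop)).sub (hfm.comp_measurable (by fun_prop))
  have inner_le : ∀ z, ∫⁻ y, ‖k z‖ₑ * ‖f (y - z) - f y‖ₑ ^ 2 ∂μ ≤ ‖k z‖ₑ * ε ^ 2 := by
    intro z
    rw [lintegral_const_mul' _ _ enorm_ne_top, ← eLpNorm_two_sq]
    by_cases hz : z ∈ tsupport k
    · gcongr
      exact h z hz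
    · simp [image_eq_zero_of_notMem_tsupport hz]
  rw [← ENNReal.pow_le_pow_left_iff two_ne_zero, eLpNorm_two_sq]
  calc ∫⁻ y, ‖(k ⋆[lsmul ℝ ℝ, μ] f - f) y‖ₑ ^ 2 ∂μ
      ≤ ∫⁻ y, ∫⁻ z, ‖k z‖ₑ * ‖f (y - z) - f y‖ₑ ^ 2 ∂μ ∂μ :=
        lintegral_mono
          (hk.enorm_sq_convolution_sub_le hfm (hf.locallyIntegrable (by norm_num)))
    _ = ∫⁻ z, ∫⁻ y, ‖k z‖ₑ * ‖f (y - z) - f y‖ₑ ^ 2 ∂μ ∂μ :=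
        lintegral_lintegral_swap
          ((hkm.comp measurable_snd).mul (hfm'.enorm.pow_const 2)).aemeasurable
    _ ≤ ∫⁻ z, ‖k z‖ₑ * ε ^ 2 ∂μ := lintegral_mono inner_le
    _ = ε ^ 2 := by rw [lintegral_mul_const _ hkm, hk.lintegral_enorm, one_mul]

end Mollifier

section MollifierGradient

open ContinuousLinearMap (lsmul)

variable {V : Type*} [NormedAddCommGroup V] [InnerProductSpace ℝ V] [FiniteDimensional ℝ V]
  [MeasurableSpace V] [BorelSpace V] {k w : V → ℝ} {W : V → V} {μ : Measure V}
  [μ.IsAddHaarMeasure]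

lemma exists_isMollifier (e : V) {ρ δ s : ℝ} (hρ : 0 < ρ) (hδ : 0 < δ) (hs : 0 < s) :
    ∃ t ∈ Set.Ioo 0 δ, ∃ k : V → ℝ, IsMollifier k μ ∧
      ∀ z ∈ tsupport k, ‖z‖ < s ∧ ∃ z' ∈ Metric.ball e ρ, z = t • z' := by
  obtain ⟨t, ⟨ht, htδ⟩, hts⟩ : ∃ t ∈ Set.Ioo 0 δ, t * (‖e‖ + ρ) < s := by
    have lim : Filter.Tendsto (fun t : ℝ => t * (‖e‖ + ρ)) (𝓝[>] 0) (𝓝 0) := by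
      have : Continuous fun t : ℝ => t * (‖e‖ + ρ) := by fun_prop
      simpa using (this.tendsto 0).mono_left nhdsWithin_le_nhds
    obtain ⟨t, hts, htδ⟩ :=
      ((lim.eventually (gt_mem_nhds hs)).and (Ioo_mem_nhdsGT hδ)).exists
    exact ⟨t, htδ, hts⟩
  have htρ : 0 < t * ρ := mul_pos ht hρ
  let φ : ContDiffBump (t • e) := ⟨t * ρ / 4, t * ρ / 2, by linarith, by linarith⟩
  refine ⟨t, ⟨ht, htδ⟩, φ.normed μ, ⟨φ.contDiff_normed, φ.hasCompactSupport_normed,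
    φ.nonneg_normed, φ.integral_normed⟩, fun z hz => ?_⟩
  replace hz : ‖z - t • e‖ ≤ t * ρ / 2 := by
    rwa [φ.tsupport_normed_eq, mem_closedBall_iff_norm] at hz
  have hz' : ‖t⁻¹ • z - e‖ < ρ := by
    rw [show t⁻¹ • z - e = t⁻¹ • (z - t • e) by rw [smul_sub, inv_smul_smul₀ ht.ne'], norm_smul,
      norm_inv, Real.norm_of_nonneg ht.le, inv_mul_lt_iff₀ ht]
    linarith
  refine ⟨?_, t⁻¹ • z, mem_ball_iff_norm.2 hz', (smul_inv_smul₀ ht.ne' z).symm⟩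
  have norm_te : ‖t • e‖ = t * ‖e‖ := by rw [norm_smul, Real.norm_of_nonneg ht.le]
  linarith [norm_le_norm_add_norm_sub' z (t • e)]

lemma lsmul_convolution_eq_convolution_mul (k w : V → ℝ) :
    k ⋆[lsmul ℝ ℝ, μ] w = w ⋆[ContinuousLinearMap.mul ℝ ℝ, μ] k := by
  funext y
  rw [convolution_lsmul_swap, convolution_mul]
  simp only [smul_eq_mul, mul_comm]

lemma IsMollifier.contDiff_convolution (hk : IsMollifier k μ) (hw : LocallyIntegrable w μ) :
    ContDiff ℝ ∞ (k ⋆[lsmul ℝ ℝ, μ] w) := by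
  rw [lsmul_convolution_eq_convolution_mul]
  exact hk.hasCompactSupport.contDiff_convolution_right _ hw hk.contDiff

lemma IsMollifier.gradient_convolution (hk : IsMollifier k μ) (hw : LocallyIntegrable w μ)
    (hW : LocallyIntegrable W μ) {y : V}
    (h : ∀ v, ∫ x, w x * fderiv ℝ k (y - x) v ∂μ = ∫ x, inner ℝ (W x) v * k (y - x) ∂μ) :
    gradient (k ⋆[lsmul ℝ ℝ, μ] w) y = (k ⋆[lsmul ℝ ℝ, μ] W) y := by
  refine ext_inner_right ℝ fun v => ?_
  have fderiv_eq : fderiv ℝ (k ⋆[lsmul ℝ ℝ, μ] w) y v = ∫ x, w x * fderiv ℝ k (y - x) v ∂μ := by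
    rw [lsmul_convolution_eq_convolution_mul, (hk.hasCompactSupport.hasFDerivAt_convolution_right
      (ContinuousLinearMap.mul ℝ ℝ) hw (hk.contDiff.of_le (by simp)) y).fderiv,
      convolution_precompR_apply _ hw (hk.hasCompactSupport.fderiv ℝ)
        (hk.contDiff.continuous_fderiv (by simp))]
    rfl
  have int_shift : Integrable (fun x => k (y - x) • W x) μ :=
    convolutionExistsAt_iff_integrable_swap.1
      (hk.hasCompactSupport.convolutionExists_left (lsmul ℝ ℝ) hk.contDiff.continuous hW y)
  rw [inner_gradient_left, fderiv_eq, h v, convolution_lsmul_swap, real_inner_comm,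
    ← integral_inner int_shift]
  refine integral_congr_ae (.of_forall fun x => ?_)
  simp only [inner_smul_right, real_inner_comm, mul_comm]

end MollifierGradient

section SmoothFunctions

variable {V : Type*} [NormedAddCommGroup V] [NormedSpace ℝ V]

/-- The space `C¹(V)` of continuously differentiable real functions on `V`. The functions that are
`C¹` up to the boundary of a domain are the restrictions of its elements. -/
def C1 (V : Type*) [NormedAddCommGroup V] [NormedSpace ℝ V] : Submodule ℝ (V → ℝ) where
  carrier := {v | ContDiff ℝ 1 v}
  zero_mem' := contDiff_zero_fun (𝕜 := ℝ) (n := 1)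
  add_mem' hv hw := ContDiff.add (𝕜 := ℝ) (n := 1) hv hw
  smul_mem' c _ hv := ContDiff.const_smul (𝕜 := ℝ) (n := 1) c hv

lemma C1.contDiff (v : C1 V) : ContDiff ℝ 1 (v : V → ℝ) := v.2

lemma memLp_restrict_of_continuous {X F : Type*} [PseudoMetricSpace X] [ProperSpace X]
    [MeasurableSpace X] [OpensMeasurableSpace X] [NormedAddCommGroup F]
    [SecondCountableTopologyEither X F] {μ : Measure X} [IsFiniteMeasureOnCompacts μ] {A : Set X}
    (hA : Bornology.IsBounded A) {f : X → F} (hf : Continuous f) (p : ℝ≥0∞) :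
    MemLp f p (μ.restrict A) := by
  have hc : IsCompact (closure A) := hA.isCompact_closure
  have : IsFiniteMeasure (μ.restrict (closure A)) := ⟨by simpa using hc.measure_lt_top⟩
  obtain ⟨C, hC⟩ := hc.exists_bound_of_continuousOn hf.continuousOn
  have bound : ∀ᵐ x ∂μ.restrict (closure A), ‖f x‖ ≤ C :=
    (ae_restrict_mem isClosed_closure.measurableSet).mono hC
  exact (MemLp.of_bound hf.aestronglyMeasurable C bound).mono_measure
    (Measure.restrict_mono_set μ subset_closure)

end SmoothFunctions

section OfContDiff

variable {N : ℕ} {U : Set (E N)}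

lemma C1.gradient_add (v w : C1 (E N)) :
    gradient ((v + w : C1 (E N)) : E N → ℝ) = gradient (v : E N → ℝ) + gradient (w : E N → ℝ) := by
  funext x
  have diff (u : C1 (E N)) : DifferentiableAt ℝ (u : E N → ℝ) x :=
    (C1.contDiff u).differentiable one_ne_zero x
  simp only [gradient, Submodule.coe_add, Pi.add_apply, fderiv_add (diff v) (diff w), map_add]

lemma C1.gradient_smul (c : ℝ) (v : C1 (E N)) :
    gradient ((c • v : C1 (E N)) : E N → ℝ) = c • gradient (v : E N → ℝ) := by
  funext x
  simp only [gradient, Submodule.coe_smul, Pi.smul_apply, fderiv_const_smul_field, map_smul]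

lemma C1.memLp (hb : Bornology.IsBounded U) (v : C1 (E N)) :
    MemLp (v : E N → ℝ) 2 (volume.restrict U) :=
  memLp_restrict_of_continuous hb (C1.contDiff v).continuous 2

lemma C1.memLp_gradient (hb : Bornology.IsBounded U) (v : C1 (E N)) :
    MemLp (gradient (v : E N → ℝ)) 2 (volume.restrict U) :=
  memLp_restrict_of_continuous hb (continuous_gradient (C1.contDiff v)) 2

/-- The restriction to a bounded set `U` of a `C¹` function, as an element of `H¹(U)`. -/
def H1.ofContDiff (hb : Bornology.IsBounded U) : C1 (E N) →ₗ[ℝ] H1 U where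
  toFun v := H1.mk (C1.memLp hb v) (C1.memLp_gradient hb v)
    (hasWeakGradient_of_contDiff (C1.contDiff v))
  map_add' v w := H1.ext (MemLp.toLp_add (C1.memLp hb v) (C1.memLp hb w)) <| by
    rw [map_add, H1.grad_mk, H1.grad_mk, H1.grad_mk, ← MemLp.toLp_add]
    simp only [C1.gradient_add]
  map_smul' c v := H1.ext (MemLp.toLp_const_smul c (C1.memLp hb v)) <| by
    rw [map_smul, H1.grad_mk, H1.grad_mk, RingHom.id_apply, ← MemLp.toLp_const_smul]
    simp only [C1.gradient_smul]

variable (hb : Bornology.IsBounded U)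

lemma H1.coeFn_fn_ofContDiff (v : C1 (E N)) :
    H1.fn (H1.ofContDiff hb v) =ᵐ[volume.restrict U] v :=
  (C1.memLp hb v).coeFn_toLp

lemma H1.coeFn_grad_ofContDiff (v : C1 (E N)) :
    H1.grad (H1.ofContDiff hb v) =ᵐ[volume.restrict U] gradient (v : E N → ℝ) :=
  (C1.memLp_gradient hb v).coeFn_toLp

lemma H1.ext_fn (hU : IsOpen U) {u v : H1 U} (h : H1.fn u = H1.fn v) : u = v :=
  H1.ext h <| Lp.ext <| HasWeakGradient.unique hU (H1.hasWeakGradient u)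
    (h ▸ H1.hasWeakGradient v) (Lp.memLp _) (Lp.memLp _)

lemma H1.eq_ofContDiff (hU : IsOpen U) {u : H1 U} {v : C1 (E N)}
    (h : H1.fn u =ᵐ[volume.restrict U] v) : u = H1.ofContDiff hb v :=
  H1.ext_fn hU (Lp.ext (h.trans (H1.coeFn_fn_ofContDiff hb v).symm))

lemma H1.enorm_sq_ofContDiff (v : C1 (E N)) : ‖H1.ofContDiff hb v‖ₑ ^ 2 =
    ∫⁻ x in U, (‖(v : E N → ℝ) x‖ₑ ^ 2 + ‖fderiv ℝ (v : E N → ℝ) x‖ₑ ^ 2) := by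
  rw [H1.enorm_sq, ← lintegral_add_left' ((Lp.aestronglyMeasurable _).enorm.pow_const 2)]
  refine lintegral_congr_ae ?_
  filter_upwards [H1.coeFn_fn_ofContDiff hb v, H1.coeFn_grad_ofContDiff hb v] with x fn_x grad_x
  rw [fn_x, grad_x, enorm_gradient]

end OfContDiff

section Density

open ContinuousLinearMap (lsmul)

variable {N : ℕ} {U : Set (E N)} {u : E N → ℝ} {G : E N → E N} {k : E N → ℝ}

lemma HasWeakGradient.setIntegral_mul_fderiv_sub (h : HasWeakGradient U u G)
    (hk : ContDiff ℝ ∞ k) (hc : HasCompactSupport k) {y : E N}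
    (hy : ∀ z ∈ tsupport k, y - z ∈ U) (v : E N) :
    ∫ x in U, u x * fderiv ℝ k (y - x) v = ∫ x in U, inner ℝ (G x) v * k (y - x) := by
  have fderiv_eq : ∀ x, fderiv ℝ (fun x => k (y - x)) x v = -fderiv ℝ k (y - x) v := fun x => by
    have deriv_comp : HasFDerivAt (fun x => k (y - x))
        ((fderiv ℝ k (y - x)).comp (-(.id ℝ (E N)))) x :=
      (hk.differentiable (by simp) (y - x)).hasFDerivAt.comp x ((hasFDerivAt_id x).const_sub y)
    rw [deriv_comp.fderiv]
    simp
  have support_subset : tsupport (fun x => k (y - x)) ⊆ U := fun x hx => by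
    have hx' : y - x ∈ tsupport k :=
      (tsupport_comp_eq_preimage k (Homeomorph.subLeft y)).subset hx
    simpa using hy _ hx'
  have weak := h (fun x => k (y - x)) (hk.comp (contDiff_const.sub contDiff_id))
    (hc.comp_homeomorph (Homeomorph.subLeft y)) support_subset v
  simpa only [fderiv_eq, mul_neg, integral_neg, neg_inj] using weak

lemma IsMollifier.gradient_convolution_indicator (hk : IsMollifier k volume)
    (hU : MeasurableSet U) (hu : MemLp u 2 (volume.restrict U))
    (hG : MemLp G 2 (volume.restrict U)) {y : E N}
    (h : ∀ v, ∫ x in U, u x * fderiv ℝ k (y - x) v = ∫ x in U, inner ℝ (G x) v * k (y - x)) :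
    gradient (k ⋆[lsmul ℝ ℝ] U.indicator u) y = (k ⋆[lsmul ℝ ℝ] U.indicator G) y := by
  refine hk.gradient_convolution
    (((memLp_indicator_iff_restrict hU).2 hu).locallyIntegrable (by norm_num))
    (((memLp_indicator_iff_restrict hU).2 hG).locallyIntegrable (by norm_num)) fun v => ?_
  have inner_indicator : ∀ x, inner ℝ (U.indicator G x) v =
      U.indicator (fun x => inner ℝ (G x) v) x :=
    fun x => by by_cases hx : x ∈ U <;> simp [hx]
  have indicator_mul : ∀ (f g : E N → ℝ) x, U.indicator f x * g x =
      U.indicator (fun x => f x * g x) x := fun f g x => (Set.indicator_mul_left U f g).symm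
  rw [funext (indicator_mul u fun x => fderiv ℝ k (y - x) v), integral_indicator hU, h v,
    ← integral_indicator hU]
  simp only [inner_indicator, indicator_mul _ fun x => k (y - x)]

lemma enorm_sub_le_eLpNorm_sub_indicator {α F : Type*} [MeasurableSpace α] [NormedAddCommGroup F]
    {μ : Measure α} {p : ℝ≥0∞} [Fact (1 ≤ p)] {A : Set α} (hA : MeasurableSet A)
    (f g : Lp F p (μ.restrict A)) {φ : α → F} (hg : g =ᵐ[μ.restrict A] φ) :
    ‖g - f‖ₑ ≤ eLpNorm (φ - A.indicator f) p μ := by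
  rw [Lp.enorm_def, eLpNorm_congr_ae ((Lp.coeFn_sub g f).trans
    (hg.sub (indicator_ae_eq_restrict hA).symm))]
  exact eLpNorm_mono_measure _ Measure.restrict_le_self

lemma H1.enorm_le (u : H1 U) : ‖u‖ₑ ≤ ‖H1.fn u‖ₑ + ‖H1.grad u‖ₑ := by
  have norm_le : ‖u‖ ≤ ‖H1.fn u‖ + ‖H1.grad u‖ := by
    rw [← pow_le_pow_iff_left₀ (norm_nonneg _) (by positivity) two_ne_zero, H1.norm_sq]
    nlinarith [norm_nonneg (H1.fn u), norm_nonneg (H1.grad u)]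
  rw [← ofReal_norm, ← ofReal_norm, ← ofReal_norm,
    ← ENNReal.ofReal_add (norm_nonneg _) (norm_nonneg _)]
  exact ENNReal.ofReal_le_ofReal norm_le

lemma H1.exists_enorm_ofContDiff_sub_le (hU : IsOpen U) (hb : Bornology.IsBounded U)
    (hk : IsMollifier k volume) (q : H1 U) {ε : ℝ≥0∞}
    (h : ∀ y ∈ U, ∀ v, ∫ x in U, H1.fn q x * fderiv ℝ k (y - x) v =
      ∫ x in U, inner ℝ (H1.grad q x) v * k (y - x))
    (h_fn : ∀ z ∈ tsupport k,
      eLpNorm (fun y => U.indicator (H1.fn q) (y - z) - U.indicator (H1.fn q) y) 2 volume ≤ ε)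
    (h_grad : ∀ z ∈ tsupport k,
      eLpNorm (fun y => U.indicator (H1.grad q) (y - z) - U.indicator (H1.grad q) y) 2 volume ≤ ε) :
    ∃ v : C1 (E N), ‖H1.ofContDiff hb v - q‖ₑ ≤ ε + ε := by
  have hUm := hU.measurableSet
  have memLp_fn := (memLp_indicator_iff_restrict hUm).2 (Lp.memLp (H1.fn q))
  have memLp_grad := (memLp_indicator_iff_restrict hUm).2 (Lp.memLp (H1.grad q))
  let v : C1 (E N) := ⟨k ⋆[lsmul ℝ ℝ] U.indicator (H1.fn q),
    ContDiff.of_le (𝕜 := ℝ) (m := 1)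
      (hk.contDiff_convolution (memLp_fn.locallyIntegrable (by norm_num))) (by simp)⟩
  have gradient_eq : gradient (v : E N → ℝ) =ᵐ[volume.restrict U]
      k ⋆[lsmul ℝ ℝ] U.indicator (H1.grad q) :=
    (ae_restrict_mem hUm).mono fun y hy =>
      hk.gradient_convolution_indicator hUm (Lp.memLp _) (Lp.memLp _) (h y hy)
  refine ⟨v, (H1.enorm_le _).trans (add_le_add ?_ ?_)⟩
  · rw [map_sub]
    exact (enorm_sub_le_eLpNorm_sub_indicator hUm _ _ (H1.coeFn_fn_ofContDiff hb v)).trans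
      (hk.eLpNorm_convolution_sub_le ((Lp.stronglyMeasurable _).indicator hUm) memLp_fn h_fn)
  · rw [map_sub]
    exact (enorm_sub_le_eLpNorm_sub_indicator hUm _ _
      ((H1.coeFn_grad_ofContDiff hb v).trans gradient_eq)).trans
      (hk.eLpNorm_convolution_sub_le ((Lp.stronglyMeasurable _).indicator hUm) memLp_grad h_grad)

/-- `U` contains the truncated cones with directions near `-e` whose vertices are in `U` near `p`:
this is the cone property that lets a function supported near `p` be mollified inside `U`. -/
def HasConeAt (U : Set (E N)) (p e : E N) (r ρ δ : ℝ) : Prop :=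
  ∀ y ∈ U, y ∈ Metric.ball p r → ∀ t ∈ Set.Ioo 0 δ, ∀ z ∈ Metric.ball e ρ, y - t • z ∈ U

lemma HasConeAt.setIntegral_mul_fderiv_sub {p e : E N} {r ρ δ t : ℝ}
    (h : HasConeAt U p e r ρ δ) (hG : HasWeakGradient U u G)
    (h_fn : ∀ᵐ x ∂(volume.restrict U), x ∉ Metric.ball p (r / 2) → u x = 0)
    (h_grad : ∀ᵐ x ∂(volume.restrict U), x ∉ Metric.ball p (r / 2) → G x = 0)
    (hk : IsMollifier k volume) (ht : t ∈ Set.Ioo 0 δ)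
    (hkt : ∀ z ∈ tsupport k, ‖z‖ < r / 2 ∧ ∃ z' ∈ Metric.ball e ρ, z = t • z')
    {y : E N} (hy : y ∈ U) (v : E N) :
    ∫ x in U, u x * fderiv ℝ k (y - x) v = ∫ x in U, inner ℝ (G x) v * k (y - x) := by
  by_cases hyp : y ∈ Metric.ball p r
  · refine hG.setIntegral_mul_fderiv_sub hk.contDiff hk.hasCompactSupport (fun z hz => ?_) v
    obtain ⟨z', hz', rfl⟩ := (hkt z hz).2
    exact h y hy hyp t ht z' hz'
  · have notMem_tsupport : ∀ x ∈ Metric.ball p (r / 2), y - x ∉ tsupport k := fun x hx hyx => by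
      refine hyp (Metric.mem_ball.2 ((dist_triangle y x p).trans_lt ?_))
      have dist_lt := (hkt _ hyx).1
      rw [← dist_eq_norm] at dist_lt
      linarith [Metric.mem_ball.1 hx]
    refine integral_congr_ae ?_
    filter_upwards [h_fn, h_grad] with x hx hGx
    by_cases hxp : x ∈ Metric.ball p (r / 2)
    · rw [fderiv_of_notMem_tsupport ℝ (notMem_tsupport x hxp),
        image_eq_zero_of_notMem_tsupport (notMem_tsupport x hxp), mul_zero,
        zero_apply, mul_zero]
    · rw [hx hxp, hGx hxp, inner_zero_left, zero_mul, zero_mul]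

lemma HasConeAt.mem_closure_range_ofContDiff {p e : E N} {r ρ δ : ℝ} (h : HasConeAt U p e r ρ δ)
    (hr : 0 < r) (hρ : 0 < ρ) (hδ : 0 < δ) (hU : IsOpen U) (hb : Bornology.IsBounded U) {q : H1 U}
    (h_fn : ∀ᵐ x ∂(volume.restrict U), x ∉ Metric.ball p (r / 2) → H1.fn q x = 0)
    (h_grad : ∀ᵐ x ∂(volume.restrict U), x ∉ Metric.ball p (r / 2) → H1.grad q x = 0) :
    q ∈ closure (Set.range (H1.ofContDiff hb)) := by
  refine EMetric.mem_closure_iff.2 fun ε hε => ?_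
  obtain ⟨η, hη, hηε⟩ := exists_between (ENNReal.half_pos hε.ne')
  have hUm := hU.measurableSet
  have memLp_fn := (memLp_indicator_iff_restrict hUm).2 (Lp.memLp (H1.fn q))
  have memLp_grad := (memLp_indicator_iff_restrict hUm).2 (Lp.memLp (H1.grad q))
  have small_fn :=
    (tendsto_eLpNorm_translate_sub ENNReal.ofNat_ne_top memLp_fn).eventually (gt_mem_nhds hη)
  have small_grad :=
    (tendsto_eLpNorm_translate_sub ENNReal.ofNat_ne_top memLp_grad).eventually (gt_mem_nhds hη)
  obtain ⟨s, hs, small⟩ := Metric.eventually_nhds_iff.1 (small_fn.and small_grad)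
  obtain ⟨t, ht, k, hk, hkt⟩ := exists_isMollifier (μ := (volume : Measure (E N))) e hρ hδ
    (lt_min hs (half_pos hr))
  have small_tsupport : ∀ z ∈ tsupport k, dist z 0 < s := fun z hz => by
    rw [dist_zero_right]
    exact (hkt z hz).1.trans_le (min_le_left _ _)
  obtain ⟨v, hv⟩ := H1.exists_enorm_ofContDiff_sub_le hU hb hk q (ε := η)
    (fun y hy v => h.setIntegral_mul_fderiv_sub (H1.hasWeakGradient q) h_fn h_grad hk ht
      (fun z hz => ⟨(hkt z hz).1.trans_le (min_le_right _ _), (hkt z hz).2⟩) hy v)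
    (fun z hz => (small (small_tsupport z hz)).1.le)
    (fun z hz => (small (small_tsupport z hz)).2.le)
  refine ⟨_, Set.mem_range_self v, ?_⟩
  rw [edist_comm, edist_eq_enorm_sub]
  exact hv.trans_lt ((ENNReal.add_lt_add hηε hηε).trans_eq (ENNReal.add_halves ε))

/-- The product of a Sobolev function and a smooth function with compact support. -/
def H1.smoothMul (u : H1 U) {ζ : E N → ℝ} (hζ : ContDiff ℝ ∞ ζ) (hc : HasCompactSupport ζ) :
    H1 U :=
  have memLp_ζ : MemLp ζ ⊤ (volume.restrict U) :=
    hζ.continuous.memLp_top_of_hasCompactSupport hc _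
  have memLp_gradient : MemLp (gradient ζ) ⊤ (volume.restrict U) :=
    (continuous_gradient (hζ.of_le (by simp))).memLp_top_of_hasCompactSupport
      ((hc.fderiv ℝ).comp_left (g := (InnerProductSpace.toDual ℝ (E N)).symm) (map_zero _)) _
  H1.mk ((Lp.memLp (H1.fn u)).smul memLp_ζ)
    (((Lp.memLp (H1.grad u)).smul memLp_ζ).add (memLp_gradient.smul (Lp.memLp (H1.fn u))))
    ((H1.hasWeakGradient u).mul_smooth (Lp.memLp _) (Lp.memLp _) hζ)

lemma H1.coeFn_fn_smoothMul (u : H1 U) {ζ : E N → ℝ} (hζ : ContDiff ℝ ∞ ζ)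
    (hc : HasCompactSupport ζ) :
    H1.fn (H1.smoothMul u hζ hc) =ᵐ[volume.restrict U] fun x => ζ x * H1.fn u x := by
  rw [H1.smoothMul, H1.fn_mk]
  exact MemLp.coeFn_toLp _

lemma H1.coeFn_grad_smoothMul (u : H1 U) {ζ : E N → ℝ} (hζ : ContDiff ℝ ∞ ζ)
    (hc : HasCompactSupport ζ) : H1.grad (H1.smoothMul u hζ hc) =ᵐ[volume.restrict U]
      fun x => ζ x • H1.grad u x + H1.fn u x • gradient ζ x := by
  rw [H1.smoothMul, H1.grad_mk]
  exact MemLp.coeFn_toLp _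

end Density

section Cone

variable {N : ℕ} {U : Set (E N)} {p : E N}

lemma sub_smul_sub_mem_ball {V : Type*} [NormedAddCommGroup V] [NormedSpace ℝ V] {p y z : V}
    {R s t C : ℝ} (hy : y ∈ Metric.ball p (R - s)) (ht : 0 ≤ t) (hz : ‖z‖ ≤ C) (htC : t * C ≤ s) :
    y - t • z ∈ Metric.ball p R := by
  rw [Metric.mem_ball, dist_eq_norm] at hy ⊢
  have norm_smul_le : ‖t • z‖ ≤ t * C := by
    rw [norm_smul, Real.norm_eq_abs, abs_of_nonneg ht]
    gcongr
  have norm_sub := norm_sub_le (y - p) (t • z)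
  rw [sub_right_comm] at norm_sub
  linarith

lemma exists_hasConeAt_of_mem (hU : IsOpen U) (hp : p ∈ U) :
    ∃ (e : E N) (r ρ δ : ℝ), 0 < r ∧ 0 < ρ ∧ 0 < δ ∧ HasConeAt U p e r ρ δ := by
  obtain ⟨R, hR, hRU⟩ := Metric.isOpen_iff.1 hU p hp
  refine ⟨0, R / 2, 1, R / 2, half_pos hR, one_pos, half_pos hR, fun y _ hy t ht z hz => hRU ?_⟩
  refine sub_smul_sub_mem_ball (s := R / 2) (by rwa [sub_half]) ht.1.le
    (mem_ball_zero_iff.1 hz).le ?_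
  linarith [ht.2]

lemma IsChart.hasConeAt {e : E N} {g : E N → ℝ} {L : NNReal} {R : ℝ} (h : IsChart U p e g L R) :
    HasConeAt U p e (R / 2) (1 / (1 + L)) (R / 4) := by
  intro y hyU hy t ht z hz
  have hz' : (1 + L) * ‖z - e‖ < 1 := by
    rwa [Metric.mem_ball, dist_eq_norm, lt_div_iff₀' (by positivity)] at hz
  have norm_sub_le_one : ‖z - e‖ ≤ 1 := by
    nlinarith [norm_nonneg (z - e), L.coe_nonneg]
  have norm_z : ‖z‖ ≤ 2 := by
    have := norm_le_norm_add_norm_sub' z e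
    rw [h.norm_eq] at this
    linarith
  refine h.mem_of_inner_lt (sub_smul_sub_mem_ball (s := R / 2) (by rwa [sub_half]) ht.1.le norm_z
    (by linarith [ht.2])) ?_
  have inner_y : inner ℝ e y < g y :=
    (h.mem_iff y (Metric.ball_subset_ball (half_le_self h.pos.le) hy)).1 hyU
  have sub_smul_eq : y - t • z = y - t • (z - e) + (-t) • e := by module
  have g_ge : g y - L * (t * ‖z - e‖) ≤ g (y - t • (z - e)) := by
    have dist_g := h.lip.dist_le_mul (y - t • (z - e)) y
    rw [Real.dist_eq, dist_eq_norm, sub_sub_cancel_left, norm_neg, norm_smul, Real.norm_eq_abs,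
      abs_of_pos ht.1] at dist_g
    linarith [(abs_le.1 dist_g).1]
  have inner_ge : -‖z - e‖ ≤ inner ℝ e (z - e) := by
    have := abs_real_inner_le_norm e (z - e)
    rw [h.norm_eq, one_mul] at this
    exact (abs_le.1 this).1
  rw [sub_smul_eq, inner_add_smul_self h.norm_eq, h.inv, inner_sub_right, inner_smul_right]
  nlinarith [mul_lt_mul_of_pos_left hz' ht.1, mul_le_mul_of_nonneg_left inner_ge ht.1.le]

lemma HasLipschitzBoundary.exists_hasConeAt (hL : HasLipschitzBoundary U) (hU : IsOpen U)
    (hp : p ∈ closure U) :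
    ∃ (e : E N) (r ρ δ : ℝ), 0 < r ∧ 0 < ρ ∧ 0 < δ ∧ HasConeAt U p e r ρ δ := by
  by_cases hpU : p ∈ U
  · exact exists_hasConeAt_of_mem hU hpU
  · obtain ⟨e, g, L, R, h⟩ := hL.exists_isChart (p := p) (by rw [hU.frontier_eq]; exact ⟨hp, hpU⟩)
    have hR := h.pos
    exact ⟨e, R / 2, 1 / (1 + L), R / 4, half_pos hR, by positivity, by positivity, h.hasConeAt⟩

end Cone

/-! ### The trace operator -/

section Trace

variable {N : ℕ} {U : Set (E N)}

lemma H1.sum_smoothMul {ι : Type*} [Fintype ι] (hU : IsOpen U) (u : H1 U) {ζ : ι → E N → ℝ}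
    (hζ : ∀ i, ContDiff ℝ ∞ (ζ i)) (hc : ∀ i, HasCompactSupport (ζ i))
    (h : ∀ x ∈ U, ∑ i, ζ i x = 1) : ∑ i, H1.smoothMul u (hζ i) (hc i) = u := by
  refine H1.ext_fn hU (Lp.ext ?_)
  rw [map_sum]
  filter_upwards [Lp.coeFn_finsetSum Finset.univ fun i => H1.fn (H1.smoothMul u (hζ i) (hc i)),
    ae_all_iff.2 fun i => H1.coeFn_fn_smoothMul u (hζ i) (hc i),
    ae_restrict_mem hU.measurableSet] with x sum_x fn_x hx
  rw [sum_x, Finset.sum_apply]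
  simp only [fn_x]
  rw [← Finset.sum_mul, h x hx, one_mul]

lemma HasConeAt.smoothMul_mem_closure {p e : E N} {r ρ δ : ℝ} (h : HasConeAt U p e r ρ δ)
    (hr : 0 < r) (hρ : 0 < ρ) (hδ : 0 < δ) (hU : IsOpen U) (hb : Bornology.IsBounded U) (u : H1 U)
    {ζ : E N → ℝ} (hζ : ContDiff ℝ ∞ ζ) (hc : HasCompactSupport ζ)
    (hsupp : tsupport ζ ⊆ Metric.ball p (r / 2)) :
    H1.smoothMul u hζ hc ∈ closure (Set.range (H1.ofContDiff hb)) := by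
  refine h.mem_closure_range_ofContDiff hr hρ hδ hU hb ?_ ?_
  · filter_upwards [H1.coeFn_fn_smoothMul u hζ hc] with x fn_x hx
    rw [fn_x, image_eq_zero_of_notMem_tsupport (Set.notMem_subset hsupp hx), zero_mul]
  · filter_upwards [H1.coeFn_grad_smoothMul u hζ hc] with x grad_x hx
    have notMem := Set.notMem_subset hsupp hx
    rw [grad_x, image_eq_zero_of_notMem_tsupport notMem, gradient,
      fderiv_of_notMem_tsupport ℝ notMem, map_zero, zero_smul, smul_zero, add_zero]

theorem denseRange_ofContDiff (hU : IsOpen U) (hb : Bornology.IsBounded U)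
    (hL : HasLipschitzBoundary U) : DenseRange (H1.ofContDiff hb) := by
  intro u
  choose! e r ρ δ hr hρ hδ cone using fun p (hp : p ∈ closure U) => hL.exists_hasConeAt hU hp
  obtain ⟨t, ht, hcover⟩ := hb.isCompact_closure.elim_nhds_subcover
    (fun p => Metric.ball p (r p / 2)) fun p hp => Metric.ball_mem_nhds p (half_pos (hr p hp))
  obtain ⟨f, hf⟩ := SmoothPartitionOfUnity.exists_isSubordinate 𝓘(ℝ, E N)
    (isClosed_closure (s := U)) (fun p : t => Metric.ball (p : E N) (r p / 2))
    (fun _ => Metric.isOpen_ball) (by simpa [Set.iUnion_subtype] using hcover)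
  have contDiff_f : ∀ i, ContDiff ℝ ∞ (f i) := fun i => (f i).contMDiff.contDiff
  have hasCompactSupport_f : ∀ i, HasCompactSupport (f i) := fun i =>
    (isCompact_closedBall (i : E N) (r i / 2)).of_isClosed_subset (isClosed_tsupport _)
      ((hf i).trans Metric.ball_subset_closedBall)
  have sum_f : ∀ x ∈ U, ∑ i, f i x = 1 := fun x hx => by
    rw [← finsum_eq_sum_of_fintype, f.sum_eq_one (subset_closure hx)]
  rw [← H1.sum_smoothMul hU u contDiff_f hasCompactSupport_f sum_f]
  exact (LinearMap.range (H1.ofContDiff hb)).topologicalClosure.sum_mem fun i _ =>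
    have hi := ht i i.2
    (cone i hi).smoothMul_mem_closure (hr i hi) (hρ i hi) (hδ i hi) hU hb u _ _ (hf i)

lemma exists_lintegral_frontier_le (hU : IsOpen U) (hb : Bornology.IsBounded U)
    (hL : HasLipschitzBoundary U) : ∃ C : NNReal, ∀ v : E N → ℝ, ContDiff ℝ 1 v →
      ∫⁻ x in frontier U, ‖v x‖ₑ ^ 2 ∂(surf N) ≤
        C * ∫⁻ x in U, (‖v x‖ₑ ^ 2 + ‖fderiv ℝ v x‖ₑ ^ 2) := by
  have hc : IsCompact (frontier U) :=
    hb.isCompact_closure.of_isClosed_subset isClosed_frontier frontier_subset_closure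
  suffices h : ∃ C : NNReal, ∀ v : E N → ℝ, ContDiff ℝ 1 v →
      ∫⁻ x in frontier U ∩ frontier U, ‖v x‖ₑ ^ 2 ∂(surf N) ≤
        C * ∫⁻ x in U, (‖v x‖ₑ ^ 2 + ‖fderiv ℝ v x‖ₑ ^ 2) by
    simpa only [Set.inter_self] using h
  refine hc.induction_on (p := fun A => ∃ C : NNReal, ∀ v : E N → ℝ, ContDiff ℝ 1 v →
      ∫⁻ x in A ∩ frontier U, ‖v x‖ₑ ^ 2 ∂(surf N) ≤
        C * ∫⁻ x in U, (‖v x‖ₑ ^ 2 + ‖fderiv ℝ v x‖ₑ ^ 2)) ?_ ?_ ?_ ?_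
  · exact ⟨0, fun v _ => by simp⟩
  · rintro A B hAB ⟨C, hC⟩
    exact ⟨C, fun v hv => (lintegral_mono_set (Set.inter_subset_inter_left _ hAB)).trans (hC v hv)⟩
  · rintro A B ⟨C, hC⟩ ⟨C', hC'⟩
    refine ⟨C + C', fun v hv => ?_⟩
    rw [Set.union_inter_distrib_right, ENNReal.coe_add, add_mul]
    exact (lintegral_union_le _ _ _).trans (add_le_add (hC v hv) (hC' v hv))
  · intro p hp
    obtain ⟨e, g, L, R, h⟩ := hL.exists_isChart hp
    exact ⟨Metric.ball p (R / 2), mem_nhdsWithin_of_mem_nhds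
      (Metric.ball_mem_nhds p (half_pos h.pos)), h.lintegral_surf_le hU⟩

/-- The class in `Lᵖ(μ)` of a continuously differentiable function, for a measure `μ` for which all
of these are `p`-integrable. -/
def C1.toLp {V : Type*} [NormedAddCommGroup V] [NormedSpace ℝ V] [MeasurableSpace V]
    {μ : Measure V} {p : ℝ≥0∞} (h : ∀ v : C1 V, MemLp (v : V → ℝ) p μ) : C1 V →ₗ[ℝ] Lp ℝ p μ where
  toFun v := (h v).toLp v
  map_add' v w := MemLp.toLp_add (h v) (h w)
  map_smul' c v := MemLp.toLp_const_smul c (h v)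

lemma exists_norm_toLp_le (hU : IsOpen U) (hb : Bornology.IsBounded U)
    (hL : HasLipschitzBoundary U) :
    ∃ (h : ∀ v : C1 (E N), MemLp (v : E N → ℝ) 2 ((surf N).restrict (frontier U))) (C : ℝ),
      ∀ v, ‖C1.toLp h v‖ ≤ C * ‖H1.ofContDiff hb v‖ := by
  obtain ⟨C, hC⟩ := exists_lintegral_frontier_le hU hb hL
  have bound : ∀ v : C1 (E N), ∫⁻ x in frontier U, ‖(v : E N → ℝ) x‖ₑ ^ 2 ∂(surf N) ≤
      C * ‖H1.ofContDiff hb v‖ₑ ^ 2 := fun v => by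
    rw [H1.enorm_sq_ofContDiff]
    exact hC v (C1.contDiff v)
  have memLp : ∀ v : C1 (E N), MemLp (v : E N → ℝ) 2 ((surf N).restrict (frontier U)) := fun v =>
    memLp_two_of_lintegral_lt_top (C1.contDiff v).continuous.aestronglyMeasurable <|
      (bound v).trans_lt (ENNReal.mul_lt_top (by simp) (ENNReal.pow_lt_top (by simp)))
  refine ⟨memLp, NNReal.sqrt C, fun v => ?_⟩
  have enorm_le : ‖C1.toLp memLp v‖ₑ ≤ (NNReal.sqrt C : ℝ≥0∞) * ‖H1.ofContDiff hb v‖ₑ := by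
    rw [← ENNReal.pow_le_pow_left_iff two_ne_zero, mul_pow, ← ENNReal.coe_pow, NNReal.sq_sqrt]
    refine le_trans (le_of_eq ?_) (bound v)
    rw [← eLpNorm_two_sq, C1.toLp, LinearMap.coe_mk, AddHom.coe_mk, Lp.enorm_toLp]
  rwa [enorm_eq_nnnorm, enorm_eq_nnnorm, ← ENNReal.coe_mul, ENNReal.coe_le_coe] at enorm_le

theorem existsUnique_isTraceOperator (hU : IsOpen U) (hb : Bornology.IsBounded U)
    (hL : HasLipschitzBoundary U) : ∃! T, IsTraceOperator U T := by
  have dense := denseRange_ofContDiff hU hb hL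
  obtain ⟨memLp, bound⟩ := exists_norm_toLp_le hU hb hL
  refine ⟨(C1.toLp memLp).extendOfNorm (H1.ofContDiff hb), fun w hw u hu => ?_, fun T hT => ?_⟩
  · rw [H1.eq_ofContDiff hb hU (v := ⟨w, hw⟩) hu, LinearMap.extendOfNorm_eq dense bound]
    exact (memLp ⟨w, hw⟩).coeFn_toLp
  · refine ContinuousLinearMap.coeFn_injective <|
      dense.equalizer T.continuous (ContinuousLinearMap.continuous _) <| funext fun v => ?_
    rw [Function.comp_apply, Function.comp_apply, LinearMap.extendOfNorm_eq dense bound]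
    exact Lp.ext ((hT v (C1.contDiff v) _ (H1.coeFn_fn_ofContDiff hb v)).trans
      (memLp v).coeFn_toLp.symm)

lemma isTraceOperator_trace (hU : IsOpen U) (hb : Bornology.IsBounded U)
    (hL : HasLipschitzBoundary U) : IsTraceOperator U (trace U) := by
  have exists_trace : ∃ T, IsTraceOperator U T := (existsUnique_isTraceOperator hU hb hL).exists
  rw [trace, dif_pos exists_trace]
  exact exists_trace.choose_spec

end Trace

/-! ### Common boundaries of nested Lipschitz domains -/

section CommonBoundary

lemma subset_compl_closure_of_isPreconnected {X : Type*} [TopologicalSpace X] {s A : Set X}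
    (hs : IsPreconnected s) (hA : IsOpen A) (hdisj : Disjoint s (frontier A))
    (hne : (s ∩ (closure A)ᶜ).Nonempty) : s ⊆ (closure A)ᶜ := by
  refine hs.subset_left_of_subset_union isClosed_closure.isOpen_compl hA
    (Set.disjoint_left.2 fun y hy hyA => hy (subset_closure hyA)) (fun y hy => ?_) hne
  have notMem_frontier := Set.disjoint_left.1 hdisj hy
  rw [hA.frontier_eq, Set.mem_sdiff, not_and_not_right] at notMem_frontier
  exact (em (y ∈ closure A)).elim (fun h => .inr (notMem_frontier h)) .inl

variable {V : Type*} [NormedAddCommGroup V] [InnerProductSpace ℝ V] {U Ω : Set V} {p e : V}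
  {g : V → ℝ} {L : NNReal} {R : ℝ}

lemma IsChart.lt_inner_of_notMem_closure (h : IsChart U p e g L R) {y : V}
    (hy : y ∈ Metric.ball p R) (hyU : y ∉ closure U) : g y < inner ℝ e y := by
  refine (not_lt.1 fun hlt => hyU (subset_closure (h.mem_of_inner_lt hy hlt))).lt_of_ne
    fun heq => hyU (frontier_subset_closure ((h.mem_frontier_iff hy).2 heq.symm))

lemma IsChart.mem_closure_compl_closure (h : IsChart U p e g L R) (hp : p ∈ frontier U) :
    p ∈ closure (closure U)ᶜ := by
  have tendsto_line : Filter.Tendsto (fun t : ℝ => p + t • e) (𝓝[>] 0) (𝓝 p) := by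
    have : Continuous fun t : ℝ => p + t • e := by fun_prop
    simpa using (this.tendsto 0).mono_left nhdsWithin_le_nhds
  refine mem_closure_of_tendsto tendsto_line ?_
  filter_upwards [tendsto_line.eventually (Metric.ball_mem_nhds p h.pos), self_mem_nhdsWithin]
    with t ht ht0
  refine h.not_mem_closure ht ?_
  rw [h.inv, inner_add_smul_self h.norm_eq,
    (h.mem_frontier_iff (Metric.mem_ball_self h.pos)).1 hp]
  exact lt_add_of_pos_right _ ht0

lemma IsChart.dist_add_mul_smul_le (h : IsChart U p e g L R) {σ : ℝ} (hσ : |σ| = 1) (y : V) :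
    dist (y + (σ * (g y - g p)) • e) p ≤ (1 + L) * dist y p := by
  refine (dist_triangle_left _ _ y).trans ?_
  rw [dist_self_add_right, norm_smul, h.norm_eq, mul_one, norm_mul, Real.norm_eq_abs σ, hσ, one_mul,
    ← dist_eq_norm]
  linarith [h.lip.dist_le_mul y p]

/-- Sliding along `e` straightens the graph, and maps the points above it to a half-space. -/
lemma IsChart.exists_isPreconnected_above (h : IsChart U p e g L R) (hp : p ∈ frontier U) :
    ∃ a, 0 < a ∧ a ≤ R ∧ ∃ X : Set V, IsPreconnected X ∧
      X ⊆ Metric.ball p R ∩ {y | g y < inner ℝ e y} ∧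
      Metric.ball p a ∩ {y | g y < inner ℝ e y} ⊆ X := by
  have g_p : inner ℝ e p = g p := (h.mem_frontier_iff (Metric.mem_ball_self h.pos)).1 hp
  have one_le : (1 : ℝ) ≤ (1 + L) * (1 + L) := by nlinarith [L.coe_nonneg]
  have isPreconnected_half : IsPreconnected
      ({x | inner ℝ e p < inner ℝ e x} ∩ Metric.ball p (R / (1 + L))) :=
    ((convex_halfSpace_gt (innerₗ V e).isLinear _).inter (convex_ball _ _)).isPreconnected
  refine ⟨R / ((1 + L) * (1 + L)), div_pos h.pos (by positivity), div_le_self h.pos.le one_le,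
    (fun x => x + (1 * (g x - g p)) • e) '' _, isPreconnected_half.image _ ?_, ?_, ?_⟩
  · have := h.lip.continuous
    fun_prop
  · rintro _ ⟨x, ⟨inner_lt, hx⟩, rfl⟩
    rw [Metric.mem_ball, lt_div_iff₀' (by positivity)] at hx
    refine ⟨(h.dist_add_mul_smul_le abs_one x).trans_lt hx, ?_⟩
    rw [Set.mem_ofPred_eq] at inner_lt ⊢
    rw [h.inv, inner_add_smul_self h.norm_eq]
    linarith
  · rintro y ⟨hy, lt_inner⟩
    rw [Metric.mem_ball, lt_div_iff₀' (by positivity), mul_assoc] at hy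
    refine ⟨y + (-1 * (g y - g p)) • e, ⟨?_, ?_⟩, ?_⟩
    · rw [Set.mem_ofPred_eq] at lt_inner ⊢
      rw [inner_add_smul_self h.norm_eq]
      linarith
    · rw [Metric.mem_ball, lt_div_iff₀' (by positivity)]
      refine lt_of_le_of_lt ?_ hy
      gcongr
      exact h.dist_add_mul_smul_le (by simp) y
    · simp only [h.inv]
      module

lemma IsChart.exists_notMem_closure_of_ball_inter_frontier_subset (h : IsChart U p e g L R)
    (hΩ : IsOpen Ω) (hUΩ : U ⊆ Ω) (hp : p ∈ frontier U) (hpΩ : p ∈ closure (closure Ω)ᶜ)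
    (hsub : Metric.ball p R ∩ frontier Ω ⊆ frontier U) :
    ∃ a, 0 < a ∧ a ≤ R ∧ ∀ y ∈ Metric.ball p a, y ∉ closure U → y ∉ closure Ω := by
  obtain ⟨a, ha, haR, X, hX, hXR, haX⟩ := h.exists_isPreconnected_above hp
  have mem_X : ∀ y ∈ Metric.ball p a, y ∉ closure U → y ∈ X := fun y hy hyU =>
    haX ⟨hy, h.lt_inner_of_notMem_closure (Metric.ball_subset_ball haR hy) hyU⟩
  have disjoint_frontier : Disjoint X (frontier Ω) := Set.disjoint_left.2 fun y hy hyΩ =>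
    h.not_mem_closure (hXR hy).1 (hXR hy).2 (frontier_subset_closure (hsub ⟨(hXR hy).1, hyΩ⟩))
  obtain ⟨y, hyΩ, hy⟩ := Metric.mem_closure_iff.1 hpΩ a ha
  have subset_compl : X ⊆ (closure Ω)ᶜ :=
    subset_compl_closure_of_isPreconnected hX hΩ disjoint_frontier
      ⟨y, mem_X y (by rwa [Metric.mem_ball, dist_comm]) fun hyU => hyΩ (closure_mono hUΩ hyU), hyΩ⟩
  exact ⟨a, ha, haR, fun y hy hyU => subset_compl (mem_X y hy hyU)⟩

end CommonBoundary

section RelInterior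

variable {N : ℕ} {U Ω : Set (E N)}

lemma mem_relInterior {A B : Set (E N)} {x : E N} :
    x ∈ relInterior A B ↔ x ∈ A ∧ ∃ O ∈ 𝓝 x, O ∩ A ⊆ B := by
  constructor
  · rintro ⟨y, hy, rfl⟩
    obtain ⟨O, hO, h⟩ := (mem_nhds_induced Subtype.val y _).1 (mem_interior_iff_mem_nhds.1 hy)
    exact ⟨y.2, O, hO, fun z hz => h (a := ⟨z, hz.2⟩) hz.1⟩
  · rintro ⟨hx, O, hO, h⟩
    refine ⟨⟨x, hx⟩, mem_interior_iff_mem_nhds.2 ?_, rfl⟩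
    exact (mem_nhds_induced Subtype.val _ _).2 ⟨O, hO, fun z hz => h ⟨hz, z.2⟩⟩

lemma measurableSet_relInterior {A B : Set (E N)} (hA : MeasurableSet A) :
    MeasurableSet (relInterior A B) :=
  hA.subtype_image isOpen_interior.measurableSet

lemma HasLipschitzBoundary.mem_closure_compl_closure (hU : HasLipschitzBoundary U) {p : E N}
    (hp : p ∈ frontier U) : p ∈ closure (closure U)ᶜ := by
  obtain ⟨e, g, L, R, h⟩ := hU.exists_isChart hp
  exact h.mem_closure_compl_closure hp

/-- Near `p`, a point of `bdry U` inside `Ω` would be a limit of points of `Ω` outside `closure U`;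
but the points outside `closure U` form a connected set there that avoids `bdry Ω`, so they are
all outside `closure Ω`. -/
lemma exists_ball_inter_frontier_subset (hΩ : IsOpen Ω) (hUΩ : U ⊆ Ω)
    (hLU : HasLipschitzBoundary U) (hLΩ : HasLipschitzBoundary Ω) {p : E N}
    (hp : p ∈ relInterior (frontier Ω) (frontier U ∩ frontier Ω)) :
    ∃ ρ : ℝ, 0 < ρ ∧
      Metric.ball p ρ ∩ frontier U ⊆ relInterior (frontier Ω) (frontier U ∩ frontier Ω) := by
  obtain ⟨hpΩ, O, hO, hOsub⟩ := mem_relInterior.1 hp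
  have hpU : p ∈ frontier U := (hOsub ⟨mem_of_mem_nhds hO, hpΩ⟩).1
  obtain ⟨e, g, L, R₀, h₀⟩ := hLU.exists_isChart hpU
  obtain ⟨R₁, hR₁, hRO⟩ := Metric.mem_nhds_iff.1 hO
  have ball_subset : Metric.ball p (min R₀ R₁) ⊆ O :=
    (Metric.ball_subset_ball (min_le_right _ _)).trans hRO
  obtain ⟨a, ha, haR, notMem_closure⟩ := (h₀.mono (lt_min h₀.pos hR₁)
    (min_le_left R₀ R₁)).exists_notMem_closure_of_ball_inter_frontier_subset hΩ hUΩ hpU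
    (hLΩ.mem_closure_compl_closure hpΩ) fun y hy => (hOsub ⟨ball_subset hy.1, hy.2⟩).1
  refine ⟨a, ha, fun q ⟨hqa, hqU⟩ => mem_relInterior.2 ⟨?_, O,
    Filter.mem_of_superset (Metric.isOpen_ball.mem_nhds hqa)
      ((Metric.ball_subset_ball haR).trans ball_subset), hOsub⟩⟩
  rw [hΩ.frontier_eq]
  refine ⟨closure_mono hUΩ (frontier_subset_closure hqU), fun hqΩ => ?_⟩
  obtain ⟨y, ⟨hya, hyΩ⟩, hyU⟩ := mem_closure_iff.1 (hLU.mem_closure_compl_closure hqU)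
    (Metric.ball p a ∩ Ω) (Metric.isOpen_ball.inter hΩ) ⟨hqa, hqΩ⟩
  exact notMem_closure y hya hyU (subset_closure hyΩ)

end RelInterior

/-! ### The Poincaré inequality -/

section Poincare

variable {N : ℕ} {U Γ : Set (E N)}

lemma H1.continuous_lintegral_fn {A : Set (E N)} (hA : A ⊆ U) :
    Continuous fun u : H1 U => ∫⁻ x in A, ‖H1.fn u x‖ₑ ^ 2 :=
  (continuous_setLIntegral_enorm_sq hA).comp (H1.fn (U := U)).continuous

lemma H1.continuous_lintegral_grad :
    Continuous fun u : H1 U => ∫⁻ x in U, ‖H1.grad u x‖ₑ ^ 2 :=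
  (continuous_setLIntegral_enorm_sq (le_refl U)).comp (H1.grad (U := U)).continuous

lemma H1.lintegral_fn_ofContDiff (hb : Bornology.IsBounded U) (v : C1 (E N)) {A : Set (E N)}
    (hA : A ⊆ U) :
    ∫⁻ x in A, ‖H1.fn (H1.ofContDiff hb v) x‖ₑ ^ 2 = ∫⁻ x in A, ‖v.1 x‖ₑ ^ 2 := by
  refine lintegral_congr_ae ?_
  filter_upwards [ae_mono (Measure.restrict_mono_set volume hA)
    (H1.coeFn_fn_ofContDiff hb v)] with x hx
  rw [hx]

lemma H1.lintegral_grad_ofContDiff (hb : Bornology.IsBounded U) (v : C1 (E N)) :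
    ∫⁻ x in U, ‖H1.grad (H1.ofContDiff hb v) x‖ₑ ^ 2 = ∫⁻ x in U, ‖fderiv ℝ v.1 x‖ₑ ^ 2 := by
  refine lintegral_congr_ae ?_
  filter_upwards [H1.coeFn_grad_ofContDiff hb v] with x hx
  rw [hx, enorm_gradient]

lemma H1.lintegral_le_translate (hU : IsOpen U) (hb : Bornology.IsBounded U)
    (hL : HasLipschitzBoundary U) {A : Set (E N)} (hA : MeasurableSet A) {h : E N}
    (hAU : ∀ y ∈ A, ∀ t ∈ Set.Icc (0 : ℝ) 1, y + t • h ∈ U) (u : H1 U) :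
    ∫⁻ x in A, ‖H1.fn u x‖ₑ ^ 2 ≤ 2 * (∫⁻ x in (· - h) ⁻¹' A, ‖H1.fn u x‖ₑ ^ 2) +
      2 * (‖h‖ₑ ^ 2 * ∫⁻ x in U, ‖H1.grad u x‖ₑ ^ 2) := by
  have hA_subset : A ⊆ U := fun y hy => by simpa using hAU y hy 0 (by simp)
  have preimage_subset : (· - h) ⁻¹' A ⊆ U := fun y hy => by simpa using hAU (y - h) hy 1 (by simp)
  induction u using (denseRange_ofContDiff hU hb hL).induction_on with
  | hp =>
    exact isClosed_le (H1.continuous_lintegral_fn hA_subset)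
      (((ENNReal.continuous_const_mul (by simp)).comp
        (H1.continuous_lintegral_fn preimage_subset)).add
      ((ENNReal.continuous_const_mul (by simp)).comp
        ((ENNReal.continuous_const_mul (by simp)).comp H1.continuous_lintegral_grad)))
  | ih v =>
    have segment_subset : ∀ y ∈ (· - h) ⁻¹' A, ∀ t ∈ Set.Icc (0 : ℝ) 1, y + t • -h ∈ U := by
      intro y hy t ht
      convert hAU _ hy (1 - t) ⟨by linarith [ht.2], by linarith [ht.1]⟩ using 1
      module
    have translate_le := lintegral_translate_le (μ := volume) (C1.contDiff v)
      (hA.preimage (measurable_sub_const h)) hU.measurableSet segment_subset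
    simp only [← sub_eq_add_neg, enorm_neg] at translate_le
    rw [(measurePreserving_sub_right volume h).setLIntegral_comp_preimage hA
      (f := fun x => ‖v.1 x‖ₑ ^ 2) (by have := (C1.contDiff v).continuous.measurable; fun_prop)]
      at translate_le
    rwa [H1.lintegral_fn_ofContDiff hb v hA_subset, H1.lintegral_fn_ofContDiff hb v preimage_subset,
      H1.lintegral_grad_ofContDiff]

lemma IsChart.lintegral_ball_le_trace (hU : IsOpen U) (hb : Bornology.IsBounded U)
    (hL : HasLipschitzBoundary U) {p e : E N} {g : E N → ℝ} {L : NNReal} {R : ℝ}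
    (h : IsChart U p e g L R) (hp : p ∈ frontier U) :
    ∃ ρ : ℝ, 0 < ρ ∧ ∃ C : NNReal, ∀ u : H1 U,
      ∫⁻ x in Metric.ball p ρ ∩ U, ‖H1.fn u x‖ₑ ^ 2 ≤
        C * ((∫⁻ x in Metric.ball p (R / 2) ∩ frontier U, ‖trace U u x‖ₑ ^ 2 ∂(surf N)) +
          ∫⁻ x in U, ‖H1.grad u x‖ₑ ^ 2) := by
  obtain ⟨ρ, hρ, C, hC⟩ := h.lintegral_ball_le hU hp
  refine ⟨ρ, hρ, C, fun u => ?_⟩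
  induction u using (denseRange_ofContDiff hU hb hL).induction_on with
  | hp =>
    exact isClosed_le (H1.continuous_lintegral_fn Set.inter_subset_right)
      ((ENNReal.continuous_const_mul (by simp)).comp
      (((continuous_setLIntegral_enorm_sq Set.inter_subset_right).comp
        (trace U).continuous).add H1.continuous_lintegral_grad))
  | ih v =>
    have trace_eq : trace U (H1.ofContDiff hb v) =ᵐ[(surf N).restrict (frontier U)] v.1 :=
      isTraceOperator_trace hU hb hL v.1 (C1.contDiff v) _ (H1.coeFn_fn_ofContDiff hb v)
    have lintegral_trace :
        ∫⁻ x in Metric.ball p (R / 2) ∩ frontier U,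
            ‖trace U (H1.ofContDiff hb v) x‖ₑ ^ 2 ∂(surf N) =
          ∫⁻ x in Metric.ball p (R / 2) ∩ frontier U, ‖v.1 x‖ₑ ^ 2 ∂(surf N) := by
      refine lintegral_congr_ae ?_
      filter_upwards [ae_mono (Measure.restrict_mono_set (surf N) Set.inter_subset_right) trace_eq]
        with x hx
      rw [hx]
    rw [lintegral_trace, H1.lintegral_fn_ofContDiff hb v Set.inter_subset_right,
      H1.lintegral_grad_ofContDiff]
    exact hC v.1 (C1.contDiff v)

/-- The Poincaré inequality on the part `A ∩ U` of `U`, for the functions of `H¹(U)` with trace zero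
on `Γ`. The gradient is integrated over all of `U`, so that the inequality can be carried from one
part of `U` to another. -/
def IsPoincareSet (U Γ A : Set (E N)) : Prop :=
  ∃ C : NNReal, ∀ u ∈ traceZero U Γ,
    ∫⁻ x in A ∩ U, ‖H1.fn u x‖ₑ ^ 2 ≤ C * ∫⁻ x in U, ‖H1.grad u x‖ₑ ^ 2

namespace IsPoincareSet

variable {A B : Set (E N)} {x h : E N}

lemma empty : IsPoincareSet U Γ ∅ := ⟨0, fun u _ => by simp⟩

lemma mono (hB : IsPoincareSet U Γ B) (hAB : A ⊆ B) : IsPoincareSet U Γ A :=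
  hB.imp fun _ hC u hu =>
    (lintegral_mono_set (Set.inter_subset_inter_left _ hAB)).trans (hC u hu)

lemma union (hA : IsPoincareSet U Γ A) (hB : IsPoincareSet U Γ B) : IsPoincareSet U Γ (A ∪ B) := by
  obtain ⟨C, hC⟩ := hA
  obtain ⟨C', hC'⟩ := hB
  refine ⟨C + C', fun u hu => ?_⟩
  rw [Set.union_inter_distrib_right, ENNReal.coe_add, add_mul]
  exact (lintegral_union_le _ _ _).trans (add_le_add (hC u hu) (hC' u hu))

lemma exists_mem_nhds_of_add (hU : IsOpen U) (hb : Bornology.IsBounded U)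
    (hL : HasLipschitzBoundary U) (hA : IsPoincareSet U Γ A) (hAx : A ∈ 𝓝 (x + h))
    (hx : ∀ᶠ y in 𝓝 x, y ∈ U → ∀ t ∈ Set.Icc (0 : ℝ) 1, y + t • h ∈ U) :
    ∃ B ∈ 𝓝 x, IsPoincareSet U Γ B := by
  obtain ⟨C, hC⟩ := hA
  have eventually_mem : ∀ᶠ y in 𝓝 x, y + h ∈ A :=
    (continuous_add_const h).continuousAt.eventually_mem hAx
  obtain ⟨B, hB, B_open, hxB⟩ := eventually_nhds_iff.1 (eventually_mem.and hx)
  have segment_subset : ∀ y ∈ B ∩ U, ∀ t ∈ Set.Icc (0 : ℝ) 1, y + t • h ∈ U :=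
    fun y hy => (hB y hy.1).2 hy.2
  have preimage_subset : (· - h) ⁻¹' (B ∩ U) ⊆ A ∩ U := fun y hy =>
    ⟨by simpa using (hB _ hy.1).1, by simpa using segment_subset _ hy 1 (by simp)⟩
  refine ⟨B, B_open.mem_nhds hxB, 2 * C + 2 * ‖h‖₊ ^ 2, fun u hu => ?_⟩
  calc ∫⁻ x in B ∩ U, ‖H1.fn u x‖ₑ ^ 2
      ≤ 2 * (∫⁻ x in (· - h) ⁻¹' (B ∩ U), ‖H1.fn u x‖ₑ ^ 2) +
          2 * (‖h‖ₑ ^ 2 * ∫⁻ x in U, ‖H1.grad u x‖ₑ ^ 2) :=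
        H1.lintegral_le_translate hU hb hL (B_open.inter hU).measurableSet segment_subset u
    _ ≤ 2 * (C * ∫⁻ x in U, ‖H1.grad u x‖ₑ ^ 2) +
          2 * (‖h‖ₑ ^ 2 * ∫⁻ x in U, ‖H1.grad u x‖ₑ ^ 2) := by
        gcongr
        exact (lintegral_mono_set preimage_subset).trans (hC u hu)
    _ = _ := by rw [enorm_eq_nnnorm]; push_cast; ring

lemma exists_mem_nhds_of_ball_inter_frontier_subset (hU : IsOpen U) (hb : Bornology.IsBounded U)
    (hL : HasLipschitzBoundary U) (hx : x ∈ frontier U)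
    (hΓ : ∃ ρ : ℝ, 0 < ρ ∧ Metric.ball x ρ ∩ frontier U ⊆ Γ) :
    ∃ B ∈ 𝓝 x, IsPoincareSet U Γ B := by
  obtain ⟨r, hr, ball_subset⟩ := hΓ
  obtain ⟨e, g, L, R, chart⟩ := hL.exists_isChart hx
  have half_ball_subset : Metric.ball x (min R r / 2) ∩ frontier U ⊆ Γ := by
    refine (Set.inter_subset_inter_left _ (Metric.ball_subset_ball ?_)).trans ball_subset
    linarith [min_le_right R r, lt_min chart.pos hr]
  obtain ⟨ρ, hρ, C, hC⟩ :=
    (chart.mono (lt_min chart.pos hr) (min_le_left R r)).lintegral_ball_le_trace hU hb hL hx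
  refine ⟨_, Metric.ball_mem_nhds x hρ, C, fun u hu => (hC u).trans_eq ?_⟩
  have trace_eq_zero : ∀ᵐ y ∂(surf N).restrict (frontier U), y ∈ Γ → trace U u y = 0 := hu
  have lintegral_trace :
      ∫⁻ y in Metric.ball x (min R r / 2) ∩ frontier U, ‖trace U u y‖ₑ ^ 2 ∂(surf N) = 0 := by
    refine (lintegral_congr_ae ?_).trans lintegral_zero
    filter_upwards [ae_mono (Measure.restrict_mono_set (surf N) Set.inter_subset_right)
      trace_eq_zero, ae_restrict_mem
      (Metric.isOpen_ball.measurableSet.inter isClosed_frontier.measurableSet)] with y hy hyB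
    simp [hy (half_ball_subset hyB)]
  rw [lintegral_trace, zero_add]

lemma exists_mem_nhds_of_mem_closure (hU : IsOpen U) (hb : Bornology.IsBounded U)
    (hL : HasLipschitzBoundary U) (hx : x ∈ U)
    (hxW : x ∈ closure {y | ∃ B ∈ 𝓝 y, IsPoincareSet U Γ B}) :
    ∃ B ∈ 𝓝 x, IsPoincareSet U Γ B := by
  obtain ⟨r, hr, ball_subset⟩ := Metric.isOpen_iff.1 hU x hx
  obtain ⟨y, ⟨A, hAy, hA⟩, dist_lt⟩ := Metric.mem_closure_iff.1 hxW (r / 2) (half_pos hr)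
  refine hA.exists_mem_nhds_of_add (h := y - x) hU hb hL (by rwa [add_sub_cancel]) ?_
  filter_upwards [Metric.ball_mem_nhds x (half_pos hr)] with z hz _ t ht
  refine ball_subset ((convex_ball x r).add_smul_mem
    (Metric.ball_subset_ball (half_le_self hr.le) hz) ?_ ht)
  rw [Metric.mem_ball, dist_eq_norm] at hz ⊢
  rw [dist_comm, dist_eq_norm] at dist_lt
  calc ‖z + (y - x) - x‖ = ‖(z - x) + (y - x)‖ := by congr 1; abel
    _ ≤ ‖z - x‖ + ‖y - x‖ := norm_add_le _ _
    _ < r := by linarith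

/-- The set of the points with a neighborhood on which the inequality holds is open, and closed
relative to `U`. -/
lemma exists_mem_nhds_of_mem (hU : IsOpen U) (hb : Bornology.IsBounded U)
    (hL : HasLipschitzBoundary U)
    (hΓ : ∀ p ∈ Γ, p ∈ frontier U ∧ ∃ ρ : ℝ, 0 < ρ ∧ Metric.ball p ρ ∩ frontier U ⊆ Γ)
    (hcomp : (closure (connectedComponentIn U x) ∩ Γ).Nonempty) (hx : x ∈ U) :
    ∃ B ∈ 𝓝 x, IsPoincareSet U Γ B := by
  have isOpen_good : IsOpen {y | ∃ B ∈ 𝓝 y, IsPoincareSet U Γ B} :=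
    isOpen_iff_mem_nhds.2 fun y ⟨B, hBy, hB⟩ =>
      (eventually_mem_nhds_iff.2 hBy).mono fun z hz => ⟨B, hz, hB⟩
  obtain ⟨p, hp, hpΓ⟩ := hcomp
  have component_inter_nonempty :
      (connectedComponentIn U x ∩ {y | ∃ B ∈ 𝓝 y, IsPoincareSet U Γ B}).Nonempty := by
    rw [Set.inter_comm]
    exact mem_closure_iff.1 hp _ isOpen_good
      (exists_mem_nhds_of_ball_inter_frontier_subset hU hb hL (hΓ p hpΓ).1 (hΓ p hpΓ).2)
  exact isPreconnected_connectedComponentIn.subset_of_closure_inter_subset isOpen_good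
    component_inter_nonempty (fun z hz => exists_mem_nhds_of_mem_closure hU hb hL
      (connectedComponentIn_subset U x hz.2) hz.1) (mem_connectedComponentIn hx)

lemma exists_mem_nhds_of_mem_frontier (hU : IsOpen U) (hb : Bornology.IsBounded U)
    (hL : HasLipschitzBoundary U) (hgood : ∀ y ∈ U, ∃ B ∈ 𝓝 y, IsPoincareSet U Γ B)
    (hx : x ∈ frontier U) : ∃ B ∈ 𝓝 x, IsPoincareSet U Γ B := by
  obtain ⟨e, g, L, R, chart⟩ := hL.exists_isChart hx
  have hR := half_pos chart.pos
  have inner_x := (chart.mem_frontier_iff (Metric.mem_ball_self chart.pos)).1 hx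
  obtain ⟨A, hAx, hA⟩ := hgood _ (chart.sub_smul_mem (Metric.mem_ball_self hR) inner_x ⟨hR, le_rfl⟩)
  rw [sub_eq_add_neg] at hAx
  refine hA.exists_mem_nhds_of_add hU hb hL hAx ?_
  filter_upwards [Metric.ball_mem_nhds x hR] with y hy hyU t ht
  have depth_nonneg : 0 ≤ t * (R / 2) := mul_nonneg ht.1 hR.le
  have depth_le : t * (R / 2) ≤ R / 2 := mul_le_of_le_one_left hR.le ht.2
  have inner_y := (chart.mem_iff y (Metric.ball_subset_ball (half_le_self chart.pos.le) hy)).1 hyU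
  rw [← neg_smul, smul_smul, mul_neg]
  refine chart.mem_of_inner_lt (chart.add_smul_mem_ball hy ?_) ?_
  · rw [abs_neg, abs_of_nonneg depth_nonneg]
    linarith
  · rw [chart.inv, inner_add_smul_self chart.norm_eq]
    linarith

end IsPoincareSet

theorem exists_lintegral_fn_le_lintegral_grad (hU : IsOpen U) (hb : Bornology.IsBounded U)
    (hL : HasLipschitzBoundary U)
    (hΓ : ∀ p ∈ Γ, p ∈ frontier U ∧ ∃ ρ : ℝ, 0 < ρ ∧ Metric.ball p ρ ∩ frontier U ⊆ Γ)
    (hcomp : ∀ x ∈ U, (closure (connectedComponentIn U x) ∩ Γ).Nonempty) :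
    ∃ C : NNReal, ∀ u ∈ traceZero U Γ,
      ∫⁻ x in U, ‖H1.fn u x‖ₑ ^ 2 ≤ C * ∫⁻ x in U, ‖H1.grad u x‖ₑ ^ 2 := by
  have good_of_mem : ∀ x ∈ U, ∃ B ∈ 𝓝 x, IsPoincareSet U Γ B := fun x hx =>
    IsPoincareSet.exists_mem_nhds_of_mem hU hb hL hΓ (hcomp x hx) hx
  have good_of_mem_closure : ∀ x ∈ closure U, ∃ B ∈ 𝓝[closure U] x, IsPoincareSet U Γ B := by
    intro x hx
    have : ∃ B ∈ 𝓝 x, IsPoincareSet U Γ B := by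
      rw [closure_eq_self_union_frontier] at hx
      exact hx.elim (good_of_mem x)
        (IsPoincareSet.exists_mem_nhds_of_mem_frontier hU hb hL good_of_mem)
    exact this.imp fun B hB => ⟨mem_nhdsWithin_of_mem_nhds hB.1, hB.2⟩
  obtain ⟨C, hC⟩ : IsPoincareSet U Γ (closure U) :=
    hb.isCompact_closure.induction_on IsPoincareSet.empty (fun _ _ hAB hB => hB.mono hAB)
      (fun _ _ => IsPoincareSet.union) good_of_mem_closure
  exact ⟨C, by rwa [Set.inter_eq_right.2 subset_closure] at hC⟩

end Poincare

/-! ### Convex functions with values in the extended reals -/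

section EReal

variable {ι : Type*} {s : Finset ι} {f : ι → EReal} {x y z : EReal}

lemma coe_finsetSum (s : Finset ι) (f : ι → ℝ) :
    ((∑ i ∈ s, f i : ℝ) : EReal) = ∑ i ∈ s, (f i : EReal) :=
  map_sum (⟨⟨Real.toEReal, EReal.coe_zero⟩, EReal.coe_add⟩ : ℝ →+ EReal) f s

lemma finsetSum_ne_bot (hf : ∀ i ∈ s, f i ≠ ⊥) : ∑ i ∈ s, f i ≠ ⊥ :=
  Finset.sum_induction f (· ≠ ⊥) (fun _ _ hx hy => EReal.add_ne_bot_iff.2 ⟨hx, hy⟩)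
    EReal.zero_ne_bot hf

lemma finsetSum_ne_top (hf : ∀ i ∈ s, f i ≠ ⊤) : ∑ i ∈ s, f i ≠ ⊤ :=
  Finset.sum_induction f (· ≠ ⊤) (fun _ _ => EReal.add_ne_top) EReal.zero_ne_top hf

lemma ne_top_of_finsetSum_ne_top (hf : ∀ i ∈ s, f i ≠ ⊥) (h : ∑ i ∈ s, f i ≠ ⊤) {i : ι}
    (hi : i ∈ s) : f i ≠ ⊤ := by
  classical
  intro htop
  refine h ?_
  rw [← Finset.add_sum_erase s f hi, htop]
  exact EReal.top_add_of_ne_bot (finsetSum_ne_bot fun j hj => hf j (Finset.mem_of_mem_erase hj))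

lemma ne_top_of_add_coe_le {r : ℝ} (h : x + r ≤ y) (hy : y ≠ ⊤) : x ≠ ⊤ := by
  rintro rfl
  exact hy (top_le_iff.1 (by rwa [EReal.top_add_coe] at h))

lemma le_of_add_le_add_right_of_ne (hz : z ≠ ⊤) (hz' : z ≠ ⊥) (h : x + z ≤ y + z) : x ≤ y := by
  lift z to ℝ using ⟨hz, hz'⟩
  exact (EReal.addLECancellable_coe z).add_le_add_iff_right.1 h

/-- The test point is varied in one component at a time; the other terms are finite and cancel. -/
lemma forall_add_le_iff_forall_sum_add_le [Fintype ι] {α : ι → Type*} {F : ∀ i, α i → EReal}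
    {a : ∀ i, α i → ℝ} {x : ∀ i, α i} (hbot : ∀ i z, F i z ≠ ⊥) (htop : ∀ i, ∃ z, F i z ≠ ⊤)
    (ha : ∀ i, a i (x i) = 0) :
    (∀ i z, F i (x i) + a i z ≤ F i z) ↔
      ∀ z : ∀ i, α i, ∑ i, F i (x i) + ((∑ i, a i (z i) : ℝ) : EReal) ≤ ∑ i, F i (z i) := by
  classical
  refine ⟨fun h z => ?_, fun h i w => ?_⟩
  · rw [coe_finsetSum, ← Finset.sum_add_distrib]
    exact Finset.sum_le_sum fun i _ => h i (z i)
  · choose z₀ hz₀ using htop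
    have hfinite (j) : F j (x j) ≠ ⊤ :=
      ne_top_of_finsetSum_ne_top (fun j _ => hbot j (x j))
        (ne_top_of_add_coe_le (h z₀) (finsetSum_ne_top fun j _ => hz₀ j)) (Finset.mem_univ j)
    have hrest : ∑ j ∈ Finset.univ.erase i, F j (Function.update x i w j) =
        ∑ j ∈ Finset.univ.erase i, F j (x j) :=
      Finset.sum_congr rfl fun j hj => by rw [Function.update_of_ne (Finset.ne_of_mem_erase hj)]
    have hslope : ∑ j, a j (Function.update x i w j) = a i w := by
      rw [Finset.sum_eq_single i (fun j _ hj => by rw [Function.update_of_ne hj, ha])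
        (fun hi => absurd (Finset.mem_univ i) hi), Function.update_self]
    have hw := h (Function.update x i w)
    rw [hslope, ← Finset.add_sum_erase _ (fun j => F j (x j)) (Finset.mem_univ i),
      ← Finset.add_sum_erase _ (fun j => F j (Function.update x i w j)) (Finset.mem_univ i),
      hrest, Function.update_self, add_right_comm] at hw
    exact le_of_add_le_add_right_of_ne (finsetSum_ne_top fun j _ => hfinite j)
      (finsetSum_ne_bot fun j _ => hbot j _) hw

lemma forall_add_le_and_iff_forall_add_add_le {α β : Type*} {F : α → EReal} {G : β → EReal}
    {a : α → ℝ} {b : β → ℝ} {x₀ : α} {y₀ : β} (hF : ∀ x, F x ≠ ⊥) (hG : ∀ y, G y ≠ ⊥)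
    (hF' : ∃ x, F x ≠ ⊤) (hG' : ∃ y, G y ≠ ⊤) (ha : a x₀ = 0) (hb : b y₀ = 0) :
    ((∀ x, F x₀ + a x ≤ F x) ∧ ∀ y, G y₀ + b y ≤ G y) ↔
      ∀ x y, F x₀ + G y₀ + ((a x + b y : ℝ) : EReal) ≤ F x + G y := by
  refine ⟨fun ⟨hx, hy⟩ x y => ?_, fun h => ?_⟩
  · rw [EReal.coe_add, add_add_add_comm]
    exact add_le_add (hx x) (hy y)
  · obtain ⟨x₁, hx₁⟩ := hF'
    obtain ⟨y₁, hy₁⟩ := hG'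
    have hsum : F x₀ + G y₀ ≠ ⊤ := ne_top_of_add_coe_le (h x₁ y₁) (EReal.add_ne_top hx₁ hy₁)
    have hx₀ : F x₀ ≠ ⊤ := fun hx => hsum (by rw [hx, EReal.top_add_of_ne_bot (hG y₀)])
    have hy₀ : G y₀ ≠ ⊤ := fun hy => hsum (by rw [hy, EReal.add_top_of_ne_bot (hF x₀)])
    refine ⟨fun x => le_of_add_le_add_right_of_ne hy₀ (hG y₀) ?_,
      fun y => le_of_add_le_add_right_of_ne hx₀ (hF x₀) ?_⟩
    · simpa only [hb, add_zero, add_right_comm] using h x y₀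
    · simpa only [ha, zero_add, add_right_comm, add_comm (F x₀)] using h x₀ y

end EReal

/-- Lower semicontinuous convex functions with values in `]-∞, +∞]`. Unlike `IsGammaZero`, this
allows the constant `+∞`, and is therefore stable under sums and composition. -/
structure IsLscConvex {H : Type*} [AddCommGroup H] [Module ℝ H] [TopologicalSpace H]
    (f : H → EReal) : Prop where
  ne_bot : ∀ u, f u ≠ ⊥
  lsc : LowerSemicontinuous f
  convex : ∀ u v : H, ∀ a b : ℝ, 0 < a → 0 < b → a + b = 1 →
    f (a • u + b • v) ≤ (a : EReal) * f u + (b : EReal) * f v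

lemma IsGammaZero.isLscConvex {H : Type*} [SeminormedAddCommGroup H] [InnerProductSpace ℝ H]
    {f : H → EReal} (hf : IsGammaZero f) : IsLscConvex f := ⟨hf.ne_bot, hf.lsc, hf.convex⟩

namespace IsLscConvex

variable {H : Type*} [AddCommGroup H] [Module ℝ H] [TopologicalSpace H] {f g : H → EReal}

lemma add (hf : IsLscConvex f) (hg : IsLscConvex g) : IsLscConvex fun u => f u + g u where
  ne_bot u := EReal.add_ne_bot_iff.2 ⟨hf.ne_bot u, hg.ne_bot u⟩
  lsc := hf.lsc.add' hg.lsc fun x =>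
    EReal.continuousAt_add (Or.inr (hg.ne_bot x)) (Or.inl (hf.ne_bot x))
  convex u v a b ha hb hab := by
    refine (add_le_add (hf.convex u v a b ha hb hab) (hg.convex u v a b ha hb hab)).trans_eq ?_
    rw [EReal.left_distrib_of_nonneg_of_ne_top (EReal.coe_nonneg.2 ha.le) (EReal.coe_ne_top a),
      EReal.left_distrib_of_nonneg_of_ne_top (EReal.coe_nonneg.2 hb.le) (EReal.coe_ne_top b),
      add_add_add_comm]

lemma of_linear (ℓ : H →L[ℝ] ℝ) : IsLscConvex fun u => ((ℓ u : ℝ) : EReal) where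
  ne_bot u := EReal.coe_ne_bot _
  lsc := (continuous_coe_real_ereal.comp ℓ.continuous).lowerSemicontinuous
  convex u v a b _ _ _ := by
    rw [map_add, map_smul, map_smul, smul_eq_mul, smul_eq_mul]
    push_cast
    exact le_rfl

lemma sum {ι : Type*} (s : Finset ι) {f : ι → H → EReal} (hf : ∀ i, IsLscConvex (f i)) :
    IsLscConvex fun u => ∑ i ∈ s, f i u := by
  classical
  induction s using Finset.induction_on with
  | empty => simpa using of_linear (H := H) 0
  | insert a s ha ih =>
    simp only [Finset.sum_insert ha]
    exact (hf a).add ih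

lemma comp {H' : Type*} [AddCommGroup H'] [Module ℝ H'] [TopologicalSpace H']
    (hf : IsLscConvex f) (ℓ : H' →L[ℝ] H) : IsLscConvex fun u => f (ℓ u) where
  ne_bot u := hf.ne_bot _
  lsc := hf.lsc.comp ℓ.continuous
  convex u v a b ha hb hab := by
    rw [map_add, map_smul, map_smul]
    exact hf.convex _ _ a b ha hb hab

lemma isClosed_sublevel (hf : IsLscConvex f) (c : EReal) : IsClosed {u | f u ≤ c} :=
  hf.lsc.isClosed_preimage c

lemma convex_sublevel (hf : IsLscConvex f) (c : EReal) : Convex ℝ {u | f u ≤ c} := by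
  refine convex_iff_forall_pos.2 fun u hu v hv a b ha hb hab => ?_
  have ha' : (0 : EReal) ≤ a := EReal.coe_nonneg.2 ha.le
  have hb' : (0 : EReal) ≤ b := EReal.coe_nonneg.2 hb.le
  calc f (a • u + b • v) ≤ a * f u + b * f v := hf.convex u v a b ha hb hab
    _ ≤ a * c + b * c :=
        add_le_add (mul_le_mul_of_nonneg_left hu ha') (mul_le_mul_of_nonneg_left hv hb')
    _ = c := by
        rw [← EReal.right_distrib_of_nonneg ha' hb', ← EReal.coe_add, hab, EReal.coe_one, one_mul]

end IsLscConvex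

section Conjugate

variable {H : Type*} [SeminormedAddCommGroup H] [InnerProductSpace ℝ H] {f : H → EReal} {u w : H}

lemma IsGammaZero.ne_top_of_mem_subdifferential (hf : IsGammaZero f)
    (h : w ∈ subdifferential f u) : f u ≠ ⊤ :=
  have ⟨v, hv⟩ := hf.proper
  ne_top_of_add_coe_le (h v) hv

lemma IsGammaZero.coe_toReal_of_mem_subdifferential (hf : IsGammaZero f)
    (h : w ∈ subdifferential f u) : ((f u).toReal : EReal) = f u :=
  EReal.coe_toReal (hf.ne_top_of_mem_subdifferential h) (hf.ne_bot u)

variable {r : ℝ}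

lemma inner_sub_le_conjugate (hr : r = f u) (w : H) :
    ((inner ℝ u w - r : ℝ) : EReal) ≤ conjugate f w := by
  rw [EReal.coe_sub, hr]
  exact le_iSup (fun u => ((inner ℝ u w : ℝ) : EReal) - f u) u

lemma conjugate_eq_of_mem_subdifferential (hr : r = f u) (h : w ∈ subdifferential f u) :
    conjugate f w = ((inner ℝ u w - r : ℝ) : EReal) := by
  refine le_antisymm (iSup_le fun v => ?_) (inner_sub_le_conjugate hr w)
  refine EReal.sub_le_of_le_add' (le_trans (le_of_eq ?_) (add_le_add_left (h v) _))
  rw [← hr, inner_sub_left, ← EReal.coe_add, ← EReal.coe_add]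
  ring_nf

end Conjugate

/-! ### Primal-dual solutions of composite minimization problems -/

lemma existsUnique_closest {H : Type*} [NormedAddCommGroup H] [InnerProductSpace ℝ H]
    [CompleteSpace H] {K : Set H} (hne : K.Nonempty) (hc : IsClosed K) (hK : Convex ℝ K) (p₀ : H) :
    ∃! p, p ∈ K ∧ ∀ q ∈ K, ‖p - p₀‖ ≤ ‖q - p₀‖ := by
  obtain ⟨p, hp, hdist⟩ := exists_norm_eq_iInf_of_complete_convex hne hc.isComplete hK p₀
  have hmin : ∀ q ∈ K, ‖p - p₀‖ ≤ ‖q - p₀‖ := fun q hq => by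
    rw [norm_sub_rev p, norm_sub_rev q, hdist]
    exact ciInf_le ⟨0, by rintro _ ⟨w, rfl⟩; exact norm_nonneg _⟩ (⟨q, hq⟩ : K)
  refine ⟨p, ⟨hp, hmin⟩, fun q ⟨hq, hq'⟩ => ?_⟩
  by_contra hne
  have hmid : (1 / 2 : ℝ) • q + (1 / 2 : ℝ) • p ∈ K :=
    hK hq hp (by norm_num) (by norm_num) (by norm_num)
  have hlt : ‖(1 / 2 : ℝ) • (q - p₀) + (1 / 2 : ℝ) • (p - p₀)‖ < ‖p - p₀‖ :=
    norm_combo_lt_of_ne (hq' p hp) le_rfl (fun h => hne (sub_left_injective h))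
      (by norm_num) (by norm_num) (by norm_num)
  have hcombo : (1 / 2 : ℝ) • (q - p₀) + (1 / 2 : ℝ) • (p - p₀) =
      (1 / 2 : ℝ) • q + (1 / 2 : ℝ) • p - p₀ := by module
  exact (hmin _ hmid).not_gt (hcombo ▸ hlt)

section KuhnTucker

variable {ι κ : Type*} [Fintype ι] [Fintype κ] {X : ι → Type*} {Y : κ → Type*}

variable [∀ i, NormedAddCommGroup (X i)] [∀ i, InnerProductSpace ℝ (X i)]
  [∀ k, NormedAddCommGroup (Y k)] [∀ k, InnerProductSpace ℝ (Y k)]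

/-- The Kuhn-Tucker set of the problem of minimizing `∑ φ_i(x_i) + ∑ ψ_k((A x)_k)`: the pairs
`(x, y)` with `y ∈ ∂ψ(A x)` and `-B y ∈ ∂φ(x)`, where `B` plays the role of the adjoint of `A`. -/
def kuhnTuckerSet (φ : ∀ i, X i → EReal) (ψ : ∀ k, Y k → EReal) (A : PiLp 2 X →L[ℝ] PiLp 2 Y)
    (B : PiLp 2 Y → PiLp 2 X) : Set (WithLp 2 (PiLp 2 X × PiLp 2 Y)) :=
  {p | (∀ k, p.snd k ∈ subdifferential (ψ k) (A p.fst k)) ∧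
    ∀ i, -B p.snd i ∈ subdifferential (φ i) (p.fst i)}

/-- The functional `(x, y) ↦ ⟨w - A v, y⟩`, the slope at `(v, w)` of the Kuhn-Tucker inequality. -/
def kuhnTuckerSlope (A : PiLp 2 X →L[ℝ] PiLp 2 Y) (v : PiLp 2 X) (w : PiLp 2 Y) :
    WithLp 2 (PiLp 2 X × PiLp 2 Y) →L[ℝ] ℝ :=
  (innerSL ℝ (w - A v)).comp (WithLp.sndL 2 ℝ _ _)

variable {φ : ∀ i, X i → EReal} {ψ : ∀ k, Y k → EReal} {A : PiLp 2 X →L[ℝ] PiLp 2 Y}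
  {B : PiLp 2 Y → PiLp 2 X} {p : WithLp 2 (PiLp 2 X × PiLp 2 Y)}

lemma kuhnTuckerSlope_eq_of_adjoint (hAB : ∀ x y, inner ℝ x (B y) = inner ℝ (A x) y)
    (v : PiLp 2 X) (w : PiLp 2 Y) (p : WithLp 2 (PiLp 2 X × PiLp 2 Y)) :
    kuhnTuckerSlope A v w p = ∑ i, inner ℝ (v i - p.fst i) (-B p.snd i) +
      ∑ k, inner ℝ (w k - A p.fst k) (p.snd k) := by
  have hsum : ∑ i, inner ℝ (v i - p.fst i) (-B p.snd i) = -inner ℝ (v - p.fst) (B p.snd) := by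
    simp [PiLp.inner_apply]
  change inner ℝ (w - A v) p.snd = _ + inner ℝ (w - A p.fst) p.snd
  rw [hsum, hAB, map_sub, inner_sub_left, inner_sub_left, inner_sub_left]
  ring

/-- By adjointness the terms bilinear in `p` cancel, so that both sides of the inequality are
convex in `p`. -/
lemma mem_kuhnTuckerSet_iff (hφ : ∀ i, IsGammaZero (φ i)) (hψ : ∀ k, IsGammaZero (ψ k))
    (hAB : ∀ x y, inner ℝ x (B y) = inner ℝ (A x) y) :
    p ∈ kuhnTuckerSet φ ψ A B ↔ ∀ v w,
      ∑ i, φ i (p.fst i) + ∑ k, ψ k (A p.fst k) + (kuhnTuckerSlope A v w p : EReal) ≤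
        ∑ i, φ i (v i) + ∑ k, ψ k (w k) := by
  choose v₁ hv₁ using fun i => (hφ i).proper
  choose w₁ hw₁ using fun k => (hψ k).proper
  have hX : (∀ i, -B p.snd i ∈ subdifferential (φ i) (p.fst i)) ↔ ∀ v : PiLp 2 X,
      ∑ i, φ i (p.fst i) + ((∑ i, inner ℝ (v i - p.fst i) (-B p.snd i) : ℝ) : EReal) ≤
        ∑ i, φ i (v i) :=
    (forall_add_le_iff_forall_sum_add_le (fun i => (hφ i).ne_bot) (fun i => (hφ i).proper)
      (by simp)).trans (WithLp.ofLp_surjective 2).forall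
  have hY : (∀ k, p.snd k ∈ subdifferential (ψ k) (A p.fst k)) ↔ ∀ w : PiLp 2 Y,
      ∑ k, ψ k (A p.fst k) + ((∑ k, inner ℝ (w k - A p.fst k) (p.snd k) : ℝ) : EReal) ≤
        ∑ k, ψ k (w k) :=
    (forall_add_le_iff_forall_sum_add_le (fun k => (hψ k).ne_bot) (fun k => (hψ k).proper)
      (by simp)).trans (WithLp.ofLp_surjective 2).forall
  simp only [kuhnTuckerSlope_eq_of_adjoint hAB]
  refine (and_comm.trans (and_congr hX hY)).trans ?_
  exact forall_add_le_and_iff_forall_add_add_le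
    (fun v => finsetSum_ne_bot fun i _ => (hφ i).ne_bot _)
    (fun w => finsetSum_ne_bot fun k _ => (hψ k).ne_bot _)
    ⟨WithLp.toLp 2 v₁, finsetSum_ne_top fun i _ => hv₁ i⟩
    ⟨WithLp.toLp 2 w₁, finsetSum_ne_top fun k _ => hw₁ k⟩ (by simp) (by simp)

lemma isClosed_and_convex_kuhnTuckerSet (hφ : ∀ i, IsGammaZero (φ i))
    (hψ : ∀ k, IsGammaZero (ψ k))
    (hAB : ∀ x y, inner ℝ x (B y) = inner ℝ (A x) y) :
    IsClosed (kuhnTuckerSet φ ψ A B) ∧ Convex ℝ (kuhnTuckerSet φ ψ A B) := by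
  have hprimal : IsLscConvex fun p : WithLp 2 (PiLp 2 X × PiLp 2 Y) =>
      ∑ i, φ i (p.fst i) + ∑ k, ψ k (A p.fst k) :=
    (IsLscConvex.sum Finset.univ fun i => (hφ i).isLscConvex.comp
      ((PiLp.proj 2 X i).comp (WithLp.fstL 2 ℝ _ _))).add
    (IsLscConvex.sum Finset.univ fun k => (hψ k).isLscConvex.comp
      ((PiLp.proj 2 Y k).comp (A.comp (WithLp.fstL 2 ℝ _ _))))
  have hlsc (v w) : IsLscConvex fun p : WithLp 2 (PiLp 2 X × PiLp 2 Y) =>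
      ∑ i, φ i (p.fst i) + ∑ k, ψ k (A p.fst k) + (kuhnTuckerSlope A v w p : EReal) :=
    hprimal.add (.of_linear _)
  have hset : kuhnTuckerSet φ ψ A B = ⋂ (v) (w),
      {p | ∑ i, φ i (p.fst i) + ∑ k, ψ k (A p.fst k) + (kuhnTuckerSlope A v w p : EReal) ≤
        ∑ i, φ i (v i) + ∑ k, ψ k (w k)} := by
    ext p
    simp only [Set.mem_iInter]
    exact mem_kuhnTuckerSet_iff hφ hψ hAB
  rw [hset]
  exact ⟨isClosed_iInter fun v => isClosed_iInter fun w => (hlsc v w).isClosed_sublevel _,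
    convex_iInter fun v => convex_iInter fun w => (hlsc v w).convex_sublevel _⟩

lemma primal_le_of_mem_kuhnTuckerSet (hφ : ∀ i, IsGammaZero (φ i)) (hψ : ∀ k, IsGammaZero (ψ k))
    (hAB : ∀ x y, inner ℝ x (B y) = inner ℝ (A x) y)
    (hp : p ∈ kuhnTuckerSet φ ψ A B) (u : PiLp 2 X) :
    ∑ i, φ i (p.fst i) + ∑ k, ψ k (A p.fst k) ≤ ∑ i, φ i (u i) + ∑ k, ψ k (A u k) := by
  simpa [kuhnTuckerSlope] using (mem_kuhnTuckerSet_iff hφ hψ hAB).1 hp u (A u)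

/-- By the Fenchel-Young inequality, the dual objective is bounded below by minus the primal
objective, with equality at `p`. -/
lemma dual_le_of_mem_kuhnTuckerSet (hφ : ∀ i, IsGammaZero (φ i)) (hψ : ∀ k, IsGammaZero (ψ k))
    (hAB : ∀ x y, inner ℝ x (B y) = inner ℝ (A x) y)
    (hp : p ∈ kuhnTuckerSet φ ψ A B) (g : PiLp 2 Y) :
    ∑ i, conjugate (φ i) (-B p.snd i) + ∑ k, conjugate (ψ k) (p.snd k) ≤
      ∑ i, conjugate (φ i) (-B g i) + ∑ k, conjugate (ψ k) (g k) := by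
  have hr (i) := (hφ i).coe_toReal_of_mem_subdifferential (hp.2 i)
  have hs (k) := (hψ k).coe_toReal_of_mem_subdifferential (hp.1 k)
  have hconst (g : PiLp 2 Y) :
      ∑ i, ((inner ℝ (p.fst i) (-B g i) - (φ i (p.fst i)).toReal : ℝ) : EReal) +
        ∑ k, ((inner ℝ (A p.fst k) (g k) - (ψ k (A p.fst k)).toReal : ℝ) : EReal) =
      ((-∑ i, (φ i (p.fst i)).toReal - ∑ k, (ψ k (A p.fst k)).toReal : ℝ) : EReal) := by
    rw [← coe_finsetSum, ← coe_finsetSum, ← EReal.coe_add, EReal.coe_eq_coe_iff]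
    simp only [inner_neg_right, Finset.sum_sub_distrib, Finset.sum_neg_distrib, ← PiLp.inner_apply,
      hAB]
    ring
  simp only [fun i => conjugate_eq_of_mem_subdifferential (hr i) (hp.2 i),
    fun k => conjugate_eq_of_mem_subdifferential (hs k) (hp.1 k)]
  rw [hconst, ← hconst g]
  exact add_le_add (Finset.sum_le_sum fun i _ => inner_sub_le_conjugate (hr i) _)
    (Finset.sum_le_sum fun k _ => inner_sub_le_conjugate (hs k) _)

lemma existsUnique_closest_kuhnTuckerSet [∀ i, CompleteSpace (X i)] [∀ k, CompleteSpace (Y k)]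
    (hφ : ∀ i, IsGammaZero (φ i)) (hψ : ∀ k, IsGammaZero (ψ k))
    (hAB : ∀ x y, inner ℝ x (B y) = inner ℝ (A x) y)
    (hne : (kuhnTuckerSet φ ψ A B).Nonempty) (p₀ : WithLp 2 (PiLp 2 X × PiLp 2 Y)) :
    ∃! p, p ∈ kuhnTuckerSet φ ψ A B ∧ ∀ q ∈ kuhnTuckerSet φ ψ A B, ‖p - p₀‖ ≤ ‖q - p₀‖ :=
  have ⟨hc, hK⟩ := isClosed_and_convex_kuhnTuckerSet hφ hψ hAB
  existsUnique_closest hne hc hK p₀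

end KuhnTucker

variable {N : ℕ}

/-! ### The spaces `ℋ_i` and the operators `Q_i` -/

section TraceZero

variable {U Γ : Set (E N)}

lemma mem_traceZero_iff (hm : MeasurableSet Γ) (hΓ : Γ ⊆ frontier U) (u : H1 U) :
    u ∈ traceZero U Γ ↔ restrictSurf hΓ (trace U u) = 0 := by
  have hrestrict := coeFn_restrictLp hΓ (trace U u)
  have hzero := Lp.coeFn_zero ℝ 2 ((surf N).restrict Γ)
  change (∀ᵐ x ∂((surf N).restrict (frontier U)), x ∈ Γ → trace U u x = 0) ↔ _
  rw [← ae_restrict_iff' hm, Measure.restrict_restrict_of_subset hΓ, Lp.ext_iff]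
  refine ⟨fun h => hrestrict.trans (.trans h hzero.symm), fun h => ?_⟩
  exact hrestrict.symm.trans (.trans h hzero)

lemma isClosed_traceZero (hm : MeasurableSet Γ) (hΓ : Γ ⊆ frontier U) :
    IsClosed (traceZero U Γ : Set (H1 U)) := by
  have hker : (traceZero U Γ : Set (H1 U)) = ((restrictLp 2 hΓ).comp (trace U)) ⁻¹' {0} :=
    Set.ext fun u => mem_traceZero_iff hm hΓ u
  rw [hker]
  exact isClosed_singleton.preimage (ContinuousLinearMap.continuous _)

namespace HZero

lemma toH1_injective : Function.Injective (toH1 : HZero U Γ → H1 U) := Subtype.val_injective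

lemma norm_eq (u : HZero U Γ) : ‖u‖ = ‖H1.grad (toH1 u)‖ := rfl

lemma norm_toH1_le_of_lintegral_fn_le {C : NNReal}
    (hC : ∀ u ∈ traceZero U Γ, ∫⁻ x in U, ‖H1.fn u x‖ₑ ^ 2 ≤ C * ∫⁻ x in U, ‖H1.grad u x‖ₑ ^ 2)
    (u : HZero U Γ) : ‖toH1 u‖ ≤ √(C + 1) * ‖u‖ := by
  have henorm : ‖toH1 u‖ₑ ^ 2 ≤ ((C + 1 : NNReal) : ℝ≥0∞) * ‖H1.grad (toH1 u)‖ₑ ^ 2 := by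
    rw [H1.enorm_sq, enorm_sq_Lp, ENNReal.coe_add, add_mul, ENNReal.coe_one, one_mul]
    exact add_le_add (hC _ u.2) le_rfl
  have hnorm : ‖toH1 u‖ ^ 2 ≤ ((C : ℝ) + 1) * ‖u‖ ^ 2 := by
    rw [enorm_eq_nnnorm, enorm_eq_nnnorm] at henorm
    rw [norm_eq]
    exact_mod_cast henorm
  rw [← Real.sqrt_sq (norm_nonneg u), ← Real.sqrt_mul (by positivity)]
  exact Real.le_sqrt_of_sq_le hnorm

variable {K : ℝ}

lemma eq_zero_of_norm_eq_zero (hK : ∀ u : HZero U Γ, ‖toH1 u‖ ≤ K * ‖u‖) (u : HZero U Γ)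
    (hu : ‖u‖ = 0) : u = 0 := by
  have h := hK u
  rw [hu, mul_zero, norm_le_zero_iff] at h
  exact toH1_injective (h.trans (map_zero _).symm)

lemma completeSpace (hK : ∀ u : HZero U Γ, ‖toH1 u‖ ≤ K * ‖u‖)
    (hc : IsClosed (traceZero U Γ : Set (H1 U))) : CompleteSpace (HZero U Γ) := by
  refine Metric.complete_of_cauchySeq_tendsto fun a ha => ?_
  let ι : HZero U Γ →L[ℝ] H1 U := LinearMap.mkContinuous toH1 K hK
  have hcauchy : CauchySeq fun n => ι (a n) := ha.map ι.uniformContinuous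
  obtain ⟨u, hu⟩ := cauchySeq_tendsto_of_complete hcauchy
  have hmem : u ∈ traceZero U Γ := hc.mem_of_tendsto hu (.of_forall fun n => (a n).2)
  let v : HZero U Γ := ⟨u, hmem⟩
  have hgrad := tendsto_iff_norm_sub_tendsto_zero.1 ((H1.grad.continuous.tendsto u).comp hu)
  refine ⟨v, tendsto_iff_norm_sub_tendsto_zero.2 (hgrad.congr fun n => ?_)⟩
  rw [norm_eq (a n - v), map_sub, map_sub]
  rfl

end HZero

end TraceZero

lemma integral_mul_eq_inner {α : Type*} [MeasurableSpace α] {μ : Measure α} (a b : Lp ℝ 2 μ) :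
    ∫ x, a x * b x ∂μ = inner ℝ a b := by
  rw [L2.inner_def]
  exact integral_congr_ae (.of_forall fun x => by simp [mul_comm])

lemma inner_restrictSurf_of_eq {A B : Set (E N)} (h : A = B) (f g : L2Surf B) :
    inner ℝ (restrictSurf h.subset f) (restrictSurf h.subset g) = inner ℝ f g := by
  subst h
  have hid (f : L2Surf A) : restrictSurf (Set.Subset.refl A) f = f := Lp.toLp_coeFn _ _
  rw [hid, hid]

lemma restrictSurf_traceOn {U Γ A B : Set (E N)} (hAB : A ⊆ B) (hB : B ⊆ frontier U)
    (v : HZero U Γ) :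
    restrictSurf hAB (HZero.traceOn hB v) = HZero.traceOn (hAB.trans hB) v :=
  MemLp.toLp_congr _
    ((Lp.memLp _).mono_measure (Measure.restrict_mono_set _ (hAB.trans hB)))
    (ae_mono (Measure.restrict_mono_set _ hAB) (coeFn_restrictLp hB _))

namespace Decomposition

variable {m : ℕ} {D : Decomposition N m}

lemma measurableSet_Υ (i j : Fin m) : MeasurableSet (D.Υ i j) := by
  unfold Υ
  split_ifs <;> exact measurableSet_relInterior isClosed_frontier.measurableSet

lemma exists_norm_toH1_le (hD : D.IsAdmissible) (i : Fin m) :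
    ∃ K : ℝ, ∀ u : D.H i, ‖HZero.toH1 u‖ ≤ K * ‖u‖ := by
  have hΥ : D.Υ i i = relInterior (frontier D.Ω) (frontier (D.sub i) ∩ frontier D.Ω) := if_pos rfl
  have hball : ∀ p ∈ D.Υ i i, p ∈ frontier (D.sub i) ∧
      ∃ ρ, 0 < ρ ∧ Metric.ball p ρ ∩ frontier (D.sub i) ⊆ D.Υ i i := fun p hp => by
    refine ⟨D.Υ_subset_left i i hp, ?_⟩
    rw [hΥ] at hp ⊢
    exact exists_ball_inter_frontier_subset hD.isOpen (hD.sub_subset i) (hD.lipschitz_sub i)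
      hD.lipschitz hp
  obtain ⟨C, hC⟩ := exists_lintegral_fn_le_lintegral_grad (hD.isOpen_sub i)
    (hD.bounded.subset (hD.sub_subset i)) (hD.lipschitz_sub i) hball (hD.component i)
  exact ⟨_, HZero.norm_toH1_le_of_lintegral_fn_le hC⟩

lemma eq_zero_of_norm_eq_zero (hD : D.IsAdmissible) (i : Fin m) (u : D.H i) (hu : ‖u‖ = 0) :
    u = 0 :=
  have ⟨_, hK⟩ := exists_norm_toH1_le hD i
  HZero.eq_zero_of_norm_eq_zero hK u hu

lemma completeSpace (hD : D.IsAdmissible) (i : Fin m) : CompleteSpace (D.H i) :=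
  have ⟨_, hK⟩ := exists_norm_toH1_le hD i
  HZero.completeSpace hK (isClosed_traceZero (measurableSet_Υ i i) (D.Υ_subset_left i i))

/-- On an admissible decomposition the seminorm of `ℋ_i` is a norm. It is not an instance, since
it depends on `hD`. -/
abbrev normedAddCommGroup (hD : D.IsAdmissible) (i : Fin m) : NormedAddCommGroup (D.H i) :=
  .ofSeparation (eq_zero_of_norm_eq_zero hD i)

/-- The inclusion of `ℋ_i` in `H¹(Ω_i)` as a bounded linear operator. -/
def toH1L (hD : D.IsAdmissible) (i : Fin m) : D.H i →L[ℝ] H1 (D.sub i) :=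
  LinearMap.mkContinuous HZero.toH1 (exists_norm_toH1_le hD i).choose
    (exists_norm_toH1_le hD i).choose_spec

/-- The trace on `A ⊆ bdry Ω_i` as a bounded linear operator on `ℋ_i`. -/
def traceOnL (hD : D.IsAdmissible) {i : Fin m} {A : Set (E N)} (hA : A ⊆ frontier (D.sub i)) :
    D.H i →L[ℝ] L2Surf A :=
  (restrictLp 2 hA).comp ((trace (D.sub i)).comp (toH1L hD i))

/-- The right-hand side of the weak formulation as a bounded linear functional. -/
def weakFunctional (hD : D.IsAdmissible) (i : Fin m) (f : L2Vol (D.sub i))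
    (h : (j : D.J i) → L2Surf (D.Υ i j)) : D.H i →L[ℝ] ℝ :=
  (innerSL ℝ f).comp (H1.fn.comp (toH1L hD i)) +
    ∑ j : D.J i, (if i < j.1 then (1 : ℝ) else -1) •
      (innerSL ℝ (h j)).comp (traceOnL hD (D.Υ_subset_left i j))

lemma weakFunctional_apply (hD : D.IsAdmissible) (i : Fin m) (f : L2Vol (D.sub i))
    (h : (j : D.J i) → L2Surf (D.Υ i j)) (v : D.H i) :
    weakFunctional hD i f h v = (∫ x in D.sub i, f x * HZero.fn v x) + ∑ j : D.J i,
      (if i < j.1 then 1 else -1) * ∫ x in D.Υ i j, h j x * D.T i j v x ∂(surf N) := by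
  simp only [weakFunctional, integral_mul_eq_inner, add_apply, sum_apply, smul_apply, smul_eq_mul]
  rfl

lemma isWeakSolution_iff (hD : D.IsAdmissible) (i : Fin m) (f : L2Vol (D.sub i))
    (h : (j : D.J i) → L2Surf (D.Υ i j)) (u : D.H i) :
    D.IsWeakSolution i f h u ↔ ∀ v, inner ℝ u v = weakFunctional hD i f h v := by
  simp only [weakFunctional_apply]
  rfl

lemma existsUnique_isWeakSolution (hD : D.IsAdmissible) (i : Fin m) (f : L2Vol (D.sub i))
    (h : (j : D.J i) → L2Surf (D.Υ i j)) : ∃! u, D.IsWeakSolution i f h u := by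
  have := completeSpace hD i
  let := normedAddCommGroup hD i
  simp only [isWeakSolution_iff hD]
  simpa [ContinuousLinearMap.ext_iff] using
    (InnerProductSpace.toDual ℝ (D.H i)).bijective.existsUnique (weakFunctional hD i f h)

lemma isWeakSolution_Q (hD : D.IsAdmissible) (i : Fin m) (f : L2Vol (D.sub i))
    (h : (j : D.J i) → L2Surf (D.Υ i j)) : D.IsWeakSolution i f h (D.Q i f h) := by
  have hu : ∃ u, D.IsWeakSolution i f h u := (existsUnique_isWeakSolution hD i f h).exists
  rw [Q, dif_pos hu]
  exact hu.choose_spec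

lemma inner_Q_zero (hD : D.IsAdmissible) (i : Fin m) (h : (j : D.J i) → L2Surf (D.Υ i j))
    (v : D.H i) : inner ℝ v (D.Q i 0 h) =
      ∑ j : D.J i, (if i < j.1 then 1 else -1) * inner ℝ (h j) (D.T i j v) := by
  have hQ := isWeakSolution_Q hD i 0 h v
  simp only [integral_mul_eq_inner, inner_zero_left, zero_add] at hQ
  rw [real_inner_comm]
  exact hQ

/-! ### The minimization problem of the decomposition -/

/-- For an interface `(i, j) ∈ K`, the index `j` as an element of `J(i+)`. -/
abbrev rightNeighbor (k : D.K) : D.J k.1.1 := ⟨k.1.2, k.2.2⟩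

/-- For an interface `(i, j) ∈ K`, the index `i` as an element of `J(j-)`. -/
abbrev leftNeighbor (k : D.K) : D.J k.1.2 :=
  ⟨k.1.1, k.2.1.ne, (D.Υ_comm k.1.1 k.1.2).symm ▸ k.2.2.2⟩

lemma bijective_rightNeighbor_leftNeighbor : Function.Bijective
    (Sum.elim (fun k => ⟨k.1.1, rightNeighbor k⟩) fun k => ⟨k.1.2, leftNeighbor k⟩ :
      D.K ⊕ D.K → Σ i, D.J i) := by
  refine ⟨?_, fun ⟨i, j, hji, hj⟩ => ?_⟩
  · rintro (⟨⟨i, j⟩, hij, _⟩ | ⟨⟨i, j⟩, hij, _⟩) (⟨⟨i', j'⟩, hij', _⟩ | ⟨⟨i', j'⟩, hij', _⟩) h <;>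
      simp only [Sum.elim_inl, Sum.elim_inr, Sigma.mk.injEq] at h <;> grind
  · obtain hij | hij := hji.lt_or_gt
    · exact ⟨.inr ⟨(j, i), hij, hji.symm, (D.Υ_comm i j) ▸ hj⟩, rfl⟩
    · exact ⟨.inl ⟨(i, j), hij, hji, hj⟩, rfl⟩

lemma sum_sum_J {R : Type*} [AddCommMonoid R] (F : ∀ i, D.J i → R) :
    ∑ i, ∑ j, F i j =
      ∑ k : D.K, (F k.1.1 (rightNeighbor k) + F k.1.2 (leftNeighbor k)) := by
  rw [Finset.sum_add_distrib, ← Fintype.sum_sigma',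
    ← bijective_rightNeighbor_leftNeighbor.sum_comp, Fintype.sum_sum_type]
  rfl

lemma inner_interfaceData_rightNeighbor (g : D.Dual) (k : D.K) (v : D.H k.1.1) :
    inner ℝ (D.interfaceData g k.1.1 (rightNeighbor k)) (D.T k.1.1 k.1.2 v) =
      inner ℝ (g k) (D.T k.1.1 k.1.2 v) :=
  congrArg (inner ℝ · (D.T k.1.1 k.1.2 v)) (dif_pos k.2.1)

lemma inner_interfaceData_leftNeighbor (g : D.Dual) (k : D.K) (v : D.H k.1.2) :
    inner ℝ (D.interfaceData g k.1.2 (leftNeighbor k)) (D.T k.1.2 k.1.1 v) =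
      inner ℝ (g k) (D.T' k.1.1 k.1.2 v) := by
  have hdata : D.interfaceData g k.1.2 (leftNeighbor k) =
      restrictSurf (D.Υ_comm k.1.2 k.1.1).subset (g k) := dif_neg k.2.1.not_gt
  have htrace : D.T k.1.2 k.1.1 v =
      restrictSurf (D.Υ_comm k.1.2 k.1.1).subset (D.T' k.1.1 k.1.2 v) :=
    (restrictSurf_traceOn _ _ _).symm
  rw [hdata, htrace]
  exact inner_restrictSurf_of_eq (D.Υ_comm k.1.2 k.1.1) _ _

lemma sum_inner_Q (hD : D.IsAdmissible) (v : D.Primal) (g : D.Dual) :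
    ∑ i, inner ℝ (v i) (D.Q i 0 (D.interfaceData g i)) = ∑ k, inner ℝ (D.jump v k) (g k) := by
  simp only [inner_Q_zero hD]
  rw [sum_sum_J fun i j => (if i < j.1 then 1 else -1) *
    inner ℝ (D.interfaceData g i j) (D.T i j (v i))]
  refine Finset.sum_congr rfl fun k _ => ?_
  rw [if_pos k.2.1, if_neg k.2.1.not_gt, inner_interfaceData_rightNeighbor,
    inner_interfaceData_leftNeighbor, ← real_inner_comm (D.jump v k),
    jump, inner_sub_right]
  ring

/-- The jumps across the interfaces as a bounded linear operator. -/
def jumpL (hD : D.IsAdmissible) : D.Primal →L[ℝ] D.Dual :=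
  (PiLp.continuousLinearEquiv 2 ℝ _).symm.toContinuousLinearMap.comp <|
    (ContinuousLinearMap.pi fun k : D.K =>
      (traceOnL hD (D.Υ_subset_left k.1.1 k.1.2)).comp (.proj k.1.1) -
        (traceOnL hD (D.Υ_subset_right k.1.1 k.1.2)).comp (.proj k.1.2)).comp
      (PiLp.continuousLinearEquiv 2 ℝ _).toContinuousLinearMap

/-- The operators `Q_i(0, ·)`, as a map from the dual to the primal space. It is the adjoint of
`jumpL hD`, and `D.optimalitySet φ ψ` is by definition the Kuhn-Tucker set of these two maps. -/
def dualToPrimal (D : Decomposition N m) (g : D.Dual) : D.Primal :=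
  WithLp.toLp 2 fun i => D.Q i 0 (D.interfaceData g i)

variable {φ : (i : Fin m) → D.H i → EReal} {ψ : (k : D.K) → L2Surf (D.Υ k.1.1 k.1.2) → EReal}
  {p : WithLp 2 (D.Primal × D.Dual)}

lemma existsUnique_isSolution (hD : D.IsAdmissible) (hφ : ∀ i, IsGammaZero (φ i))
    (hψ : ∀ k, IsGammaZero (ψ k)) (hne : (D.optimalitySet φ ψ).Nonempty)
    (p₀ : WithLp 2 (D.Primal × D.Dual)) : ∃! p, D.IsSolution φ ψ p₀ p :=
  let := normedAddCommGroup hD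
  have := completeSpace hD
  existsUnique_closest_kuhnTuckerSet (X := fun i => D.H i)
    (Y := fun k : D.K => L2Surf (D.Υ k.1.1 k.1.2)) hφ hψ (A := jumpL hD) (B := D.dualToPrimal)
    (sum_inner_Q hD) hne p₀

lemma primalObjective_le (hD : D.IsAdmissible) (hφ : ∀ i, IsGammaZero (φ i))
    (hψ : ∀ k, IsGammaZero (ψ k)) (hp : p ∈ D.optimalitySet φ ψ) (u : D.Primal) :
    D.primalObjective φ ψ p.fst ≤ D.primalObjective φ ψ u :=
  let := normedAddCommGroup hD
  primal_le_of_mem_kuhnTuckerSet (X := fun i => D.H i)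
    (Y := fun k : D.K => L2Surf (D.Υ k.1.1 k.1.2)) hφ hψ (A := jumpL hD) (B := D.dualToPrimal)
    (sum_inner_Q hD) hp u

lemma dualObjective_le (hD : D.IsAdmissible) (hφ : ∀ i, IsGammaZero (φ i))
    (hψ : ∀ k, IsGammaZero (ψ k)) (hp : p ∈ D.optimalitySet φ ψ) (g : D.Dual) :
    D.dualObjective φ ψ p.snd ≤ D.dualObjective φ ψ g :=
  let := normedAddCommGroup hD
  dual_le_of_mem_kuhnTuckerSet (X := fun i => D.H i)
    (Y := fun k : D.K => L2Surf (D.Υ k.1.1 k.1.2)) hφ hψ (A := jumpL hD) (B := D.dualToPrimal)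
    (sum_inner_Q hD) hp g

end Decomposition

end DomainDecomposition

end

theorem proposition3p3 {N m : ℕ} (hm : 2 ≤ m)
    (D : DomainDecomposition.Decomposition N m) (hD : D.IsAdmissible)
    (φ : (i : Fin m) → D.H i → EReal)
    (ψ : (k : D.K) → DomainDecomposition.L2Surf (D.Υ k.1.1 k.1.2) → EReal)
    (hφ : ∀ i, DomainDecomposition.IsGammaZero (φ i))
    (hψ : ∀ k, DomainDecomposition.IsGammaZero (ψ k))
    (hne : (D.optimalitySet φ ψ).Nonempty)
    (p₀ : WithLp 2 (D.Primal × D.Dual)) :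
    -- the trace operators, the Hilbert spaces and the operators `Q_i` are well defined
    (∀ i, ∃! T, DomainDecomposition.IsTraceOperator (D.sub i) T) ∧
    (∀ i, (∀ u : D.H i, ‖u‖ = 0 → u = 0) ∧ CompleteSpace (D.H i)) ∧
    (∀ i f h, ∃! u, D.IsWeakSolution i f h u) ∧
    -- existence and uniqueness of the solution, and its primal and dual optimality
    (∃! p, D.IsSolution φ ψ p₀ p) ∧
    (∀ p, D.IsSolution φ ψ p₀ p →
      (∀ u, D.primalObjective φ ψ p.fst ≤ D.primalObjective φ ψ u) ∧
      (∀ g, D.dualObjective φ ψ p.snd ≤ D.dualObjective φ ψ g)) := by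
  have hbdd (i) : Bornology.IsBounded (D.sub i) := hD.bounded.subset (hD.sub_subset i)
  refine ⟨fun i => ?trace, fun i => ⟨?separated, ?complete⟩, fun i f h => ?weakSolution,
    ?solution, fun p hp => ⟨?primal, ?dual⟩⟩
  case trace =>
    exact DomainDecomposition.existsUnique_isTraceOperator
      (hD.isOpen_sub i) (hbdd i) (hD.lipschitz_sub i)
  case separated => exact DomainDecomposition.Decomposition.eq_zero_of_norm_eq_zero hD i
  case complete => exact DomainDecomposition.Decomposition.completeSpace hD i
  case weakSolution => exact DomainDecomposition.Decomposition.existsUnique_isWeakSolution hD i f h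
  case solution => exact DomainDecomposition.Decomposition.existsUnique_isSolution hD hφ hψ hne p₀
  case primal => exact DomainDecomposition.Decomposition.primalObjective_le hD hφ hψ hp.1
  case dual => exact DomainDecomposition.Decomposition.dualObjective_le hD hφ hψ hp.1
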